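/- Let $n,p,q\ge 0$ be integers and let $G=\mathrm{GL}_n(\mathbb C)$ act on $W=\mathrm M_{n,p}(\mathbb C)\oplus \mathrm M_{q,n}(\mathbb C)\oplus \mathrm M_n(\mathbb C)$ by $g\cdot(\xi,\eta,v)=(g\xi,\ \eta g^{-1},\ gvg^{-1})$. Let $B\subset G$ be the Borel subgroup of upper triangular matrices, and let $\mathfrak N(W)=\{w\in W\mid f(w)=f(0)\text{ for all } f\in\mathbb C[W]^G\}$ be the null cone, i.e. the fibre through $0$ of the affine quotient map $W\to W/\!\!/G=\operatorname{Spec}\mathbb C[W]^G$. For $0\le k\le n$ let $$U_k=\{(\xi,\eta,v)\in W\mid \xi_{i,j}=0\ (i>k),\ \ \eta_{i,j}=0\ (j\le k),\ \ v \text{ strictly upper triangular}\},$$ let $C_k=G\cdot U_k\subset W$, and let $G\times_B U_k$ be the quotient of $G\times U_k$ by the action $b\cdot(g,u)=(gb^{-1},b\cdot u)$ of $B$. Then for every $0\le k\le n$: 1. The stabilizer $\{g\in G\mid g\cdot U_k=U_k\}$ of $U_k$ is equal to $B$. 2. $C_k\subset\mathfrak N(W)$, and the map $\psi_k:G\times_B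 U_k\to C_k$, $[g,u]\mapsto g\cdot u$, is a resolution of singularities: $G\times_B U_k$ is a nonsingular irreducible variety and $\psi_k$ is a proper birational morphism of varieties. 3. In particular, $C_k$ is a Zariski closed irreducible subvariety of $\mathfrak N(W)$ of dimension $n^2-n+pk+q(n-k)$. -/

import Mathlib

open Filter Topology

/-!
## Complex algebraic varieties as spaces with functions

A variety over `ℂ` is treated classically: it is its set of (closed) points, with the Zariski
topology and the sheaf of `ℂ`-valued regular functions.  The sheaf is recorded by saying which
functions are regular at which point; `f` is regular on an open set `U` if it is regular at every
point of `U`, and only the germ of `f` at the point matters.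
-/

/-- A space with functions over `ℂ`: a topological space with a sheaf of `ℂ`-algebras of
`ℂ`-valued functions such that, for `f` in the sheaf, the locus `f ≠ 0` is open and `1 / f` belongs
to the sheaf there. -/
structure FunctionSpace where
  /-- the set of points -/
  carrier : Type
  /-- the topology -/
  top : TopologicalSpace carrier
  /-- `IsRegularAt f x`: the function `f` is regular at the point `x` -/
  IsRegularAt : (carrier → ℂ) → carrier → Prop
  congr : ∀ {f g : carrier → ℂ} {x : carrier},
    f =ᶠ[𝓝 x] g → IsRegularAt f x → IsRegularAt g x
  eventually : ∀ {f : carrier → ℂ} {x : carrier},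
    IsRegularAt f x → ∀ᶠ y in 𝓝 x, IsRegularAt f y
  const : ∀ (c : ℂ) (x : carrier), IsRegularAt (fun _ => c) x
  add : ∀ {f g : carrier → ℂ} {x : carrier},
    IsRegularAt f x → IsRegularAt g x → IsRegularAt (f + g) x
  mul : ∀ {f g : carrier → ℂ} {x : carrier},
    IsRegularAt f x → IsRegularAt g x → IsRegularAt (f * g) x
  eventually_ne : ∀ {f : carrier → ℂ} {x : carrier},
    IsRegularAt f x → f x ≠ 0 → ∀ᶠ y in 𝓝 x, f y ≠ 0
  inv : ∀ {f : carrier → ℂ} {x : carrier},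
    IsRegularAt f x → f x ≠ 0 → IsRegularAt f⁻¹ x

namespace FunctionSpace

instance instTopologicalSpaceCarrier (X : FunctionSpace) : TopologicalSpace X.carrier := X.top

/-- `f` is regular on the set `U` (used for open `U`). -/
def IsRegularOn (X : FunctionSpace) (f : X.carrier → ℂ) (U : Set X.carrier) : Prop :=
  ∀ x ∈ U, X.IsRegularAt f x

/-- Morphisms: continuous maps that pull back regular functions to regular functions. -/
structure IsMorphism (X Y : FunctionSpace) (φ : X.carrier → Y.carrier) : Prop where
  continuous : Continuous φ
  comp_regular : ∀ (x : X.carrier) (f : Y.carrier → ℂ),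
    Y.IsRegularAt f (φ x) → X.IsRegularAt (f ∘ φ) x

/-- Isomorphisms: bijections that are morphisms in both directions. -/
structure Iso (X Y : FunctionSpace) extends X.carrier ≃ Y.carrier where
  isMorphism : IsMorphism X Y toFun
  isMorphism_inv : IsMorphism Y X invFun

/-- The structure induced along a map `ι : S → X`: the induced topology, and the functions that
are locally of the form `F ∘ ι` with `F` regular on `X`. -/
def induced (X : FunctionSpace) {S : Type} (ι : S → X.carrier) : FunctionSpace where
  carrier := S
  top := X.top.induced ι
  IsRegularAt f s := ∃ F : X.carrier → ℂ, X.IsRegularAt F (ι s) ∧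
    f =ᶠ[@nhds S (X.top.induced ι) s] F ∘ ι
  congr := by
    rintro f g x h ⟨F, hF, hf⟩
    exact ⟨F, hF, h.symm.trans hf⟩
  eventually := by
    let := X.top.induced ι
    rintro f x ⟨F, hF, hf⟩
    have h1 : ∀ᶠ y in 𝓝 x, X.IsRegularAt F (ι y) :=
      continuous_induced_dom.continuousAt.eventually (X.eventually hF)
    filter_upwards [h1, hf.eventuallyEq_nhds] with y hy hy'
    exact ⟨F, hy, hy'⟩
  const c x := ⟨fun _ => c, X.const c _, EventuallyEq.rfl⟩
  add := by
    rintro f g x ⟨F, hF, hf⟩ ⟨H, hH, hg⟩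
    exact ⟨F + H, X.add hF hH, hf.add hg⟩
  mul := by
    rintro f g x ⟨F, hF, hf⟩ ⟨H, hH, hg⟩
    exact ⟨F * H, X.mul hF hH, hf.mul hg⟩
  eventually_ne := by
    let := X.top.induced ι
    rintro f x ⟨F, hF, hf⟩ hx
    have hx' : F (ι x) ≠ 0 := by rwa [hf.eq_of_nhds] at hx
    have h1 : ∀ᶠ y in 𝓝 x, F (ι y) ≠ 0 :=
      continuous_induced_dom.continuousAt.eventually (X.eventually_ne hF hx')
    filter_upwards [h1, hf] with y hy hy'
    rwa [hy']
  inv := by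
    let := X.top.induced ι
    rintro f x ⟨F, hF, hf⟩ hx
    have hx' : F (ι x) ≠ 0 := by rwa [hf.eq_of_nhds] at hx
    exact ⟨F⁻¹, X.inv hF hx', hf.inv⟩

/-- A subset with the induced structure. -/
def subspace (X : FunctionSpace) (S : Set X.carrier) : FunctionSpace :=
  X.induced (Subtype.val : S → X.carrier)

/-- The quotient by an equivalence relation: the quotient topology, and `f` is regular on an open
set exactly if its pull-back is regular on the preimage. -/
def quotient (X : FunctionSpace) (r : Setoid X.carrier) : FunctionSpace where
  carrier := Quotient r
  top := X.top.coinduced (Quotient.mk r)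
  IsRegularAt f z := ∃ V : Set (Quotient r), IsOpen[X.top.coinduced (Quotient.mk r)] V ∧ z ∈ V ∧
    X.IsRegularOn (f ∘ Quotient.mk r) (Quotient.mk r ⁻¹' V)
  congr := by
    let := X.top.coinduced (Quotient.mk r)
    rintro f g z h ⟨V, hV, hz, hf⟩
    obtain ⟨V', h', hV', hz'⟩ := eventually_nhds_iff.1 h
    refine ⟨V ∩ V', hV.inter hV', ⟨hz, hz'⟩, fun y hy => X.congr ?_ (hf y hy.1)⟩
    exact (continuous_coinduced_rng.isOpen_preimage _ hV').eventually_mem hy.2 |>.mono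
      fun w hw => h' _ hw
  eventually := by
    let := X.top.coinduced (Quotient.mk r)
    rintro f z ⟨V, hV, hz, hf⟩
    exact (hV.eventually_mem hz).mono fun y hy => ⟨V, hV, hy, hf⟩
  const c z := ⟨Set.univ, @isOpen_univ _ (X.top.coinduced (Quotient.mk r)), trivial,
    fun y _ => X.const c y⟩
  add := by
    let := X.top.coinduced (Quotient.mk r)
    rintro f g z ⟨V, hV, hz, hf⟩ ⟨V', hV', hz', hg⟩
    exact ⟨V ∩ V', hV.inter hV', ⟨hz, hz'⟩, fun y hy => X.add (hf y hy.1) (hg y hy.2)⟩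
  mul := by
    let := X.top.coinduced (Quotient.mk r)
    rintro f g z ⟨V, hV, hz, hf⟩ ⟨V', hV', hz', hg⟩
    exact ⟨V ∩ V', hV.inter hV', ⟨hz, hz'⟩, fun y hy => X.mul (hf y hy.1) (hg y hy.2)⟩
  eventually_ne := by
    let := X.top.coinduced (Quotient.mk r)
    rintro f z ⟨V, hV, hz, hf⟩ hne
    have ho : IsOpen (V ∩ {y | f y ≠ 0}) := by
      refine isOpen_coinduced.2 (isOpen_iff_mem_nhds.2 fun y hy => ?_)
      filter_upwards [X.eventually_ne (hf y hy.1) hy.2,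
        (continuous_coinduced_rng.isOpen_preimage _ hV).eventually_mem hy.1] with w h1 h2
      exact ⟨h2, h1⟩
    exact (ho.eventually_mem ⟨hz, hne⟩).mono fun y hy => hy.2
  inv := by
    let := X.top.coinduced (Quotient.mk r)
    rintro f z ⟨V, hV, hz, hf⟩ hne
    have ho : IsOpen (V ∩ {y | f y ≠ 0}) := by
      refine isOpen_coinduced.2 (isOpen_iff_mem_nhds.2 fun y hy => ?_)
      filter_upwards [X.eventually_ne (hf y hy.1) hy.2,
        (continuous_coinduced_rng.isOpen_preimage _ hV).eventually_mem hy.1] with w h1 h2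
      exact ⟨h2, h1⟩
    exact ⟨_, ho, ⟨hz, hne⟩, fun y hy => X.inv (hf y hy.1) hy.2⟩

end FunctionSpace

section FractionSpaces

/-- A common pattern for affine spaces and products: a family `A i` of algebras of functions, each
used on a subset `D i`, the family being directed under intersection of the domains.  The sets
`{x ∈ D i | P x ≠ 0}` with `P ∈ A i` generate the topology, and a function is regular at a point
if near this point it is a fraction of members of some `A i`. -/
abbrev fractionTopology {T I : Type} (D : I → Set T) (A : I → Subalgebra ℂ (T → ℂ)) :
    TopologicalSpace T :=
  TopologicalSpace.generateFrom {O | ∃ i, ∃ P ∈ A i, O = {x ∈ D i | P x ≠ 0}}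

/-- See `fractionTopology`. -/
def fractionSpace {T I : Type} (D : I → Set T) (A : I → Subalgebra ℂ (T → ℂ))
    (hcover : ∀ x, ∃ i, x ∈ D i)
    (hdir : ∀ i j, ∃ l, D i ∩ D j ⊆ D l ∧ A i ≤ A l ∧ A j ≤ A l) : FunctionSpace :=
  letI := fractionTopology D A
  have hbasic : ∀ i, ∀ P ∈ A i, IsOpen {x ∈ D i | P x ≠ 0} := fun i P hP =>
    TopologicalSpace.isOpen_generateFrom_of_mem ⟨i, P, hP, rfl⟩
  { carrier := T
    top := fractionTopology D A
    IsRegularAt := fun f x => ∃ i, x ∈ D i ∧ ∃ P ∈ A i, ∃ Q ∈ A i, Q x ≠ 0 ∧ f =ᶠ[𝓝 x] P / Q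
    congr := by
      rintro f g x h ⟨i, hi, P, hP, Q, hQ, hx, hf⟩
      exact ⟨i, hi, P, hP, Q, hQ, hx, h.symm.trans hf⟩
    eventually := by
      rintro f x ⟨i, hi, P, hP, Q, hQ, hx, hf⟩
      filter_upwards [(hbasic i Q hQ).eventually_mem ⟨hi, hx⟩, hf.eventuallyEq_nhds] with y hy hy'
      exact ⟨i, hy.1, P, hP, Q, hQ, hy.2, hy'⟩
    const := by
      intro c x
      obtain ⟨i, hi⟩ := hcover x
      refine ⟨i, hi, algebraMap ℂ _ c, (A i).algebraMap_mem c, 1, (A i).one_mem, by simp, ?_⟩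
      exact Eventually.of_forall fun y => by simp
    add := by
      rintro f g x ⟨i, hi, P, hP, Q, hQ, hx, hf⟩ ⟨j, hj, P', hP', Q', hQ', hx', hg⟩
      obtain ⟨l, hl, hil, hjl⟩ := hdir i j
      refine ⟨l, hl ⟨hi, hj⟩, P * Q' + Q * P', (A l).add_mem ((A l).mul_mem (hil hP) (hjl hQ'))
        ((A l).mul_mem (hil hQ) (hjl hP')), Q * Q', (A l).mul_mem (hil hQ) (hjl hQ'),
        mul_ne_zero hx hx', ?_⟩
      filter_upwards [hf, hg, (hbasic i Q hQ).eventually_mem ⟨hi, hx⟩,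
        (hbasic j Q' hQ').eventually_mem ⟨hj, hx'⟩] with y h1 h2 h3 h4
      simp only [Pi.add_apply, h1, h2, Pi.div_apply, Pi.mul_apply]
      exact div_add_div _ _ h3.2 h4.2
    mul := by
      rintro f g x ⟨i, hi, P, hP, Q, hQ, hx, hf⟩ ⟨j, hj, P', hP', Q', hQ', hx', hg⟩
      obtain ⟨l, hl, hil, hjl⟩ := hdir i j
      refine ⟨l, hl ⟨hi, hj⟩, P * P', (A l).mul_mem (hil hP) (hjl hP'), Q * Q',
        (A l).mul_mem (hil hQ) (hjl hQ'), mul_ne_zero hx hx', ?_⟩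
      filter_upwards [hf, hg] with y h1 h2
      simp only [h1, h2, Pi.div_apply, Pi.mul_apply]
      exact div_mul_div_comm _ _ _ _
    eventually_ne := by
      rintro f x ⟨i, hi, P, hP, Q, hQ, hx, hf⟩ hne
      have hPx : P x ≠ 0 := by
        intro h0
        exact hne (by rw [hf.eq_of_nhds]; simp [h0])
      filter_upwards [hf, (hbasic i P hP).eventually_mem ⟨hi, hPx⟩,
        (hbasic i Q hQ).eventually_mem ⟨hi, hx⟩] with y h1 h2 h3
      rw [h1]
      exact div_ne_zero h2.2 h3.2
    inv := by
      rintro f x ⟨i, hi, P, hP, Q, hQ, hx, hf⟩ hne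
      have hPx : P x ≠ 0 := by
        intro h0
        exact hne (by rw [hf.eq_of_nhds]; simp [h0])
      refine ⟨i, hi, Q, hQ, P, hP, hPx, ?_⟩
      filter_upwards [hf] with y h1
      simp [h1] }

end FractionSpaces

/-- The polynomial functions on a finite-dimensional complex vector space: the algebra of
functions generated by the linear forms. -/
def polyFunctions (V : Type) [AddCommGroup V] [Module ℂ V] [FiniteDimensional ℂ V] :
    Subalgebra ℂ (V → ℂ) :=
  Algebra.adjoin ℂ {f | ∃ φ : Module.Dual ℂ V, f = φ}

/-- A finite-dimensional complex vector space as an affine space: the Zariski topology (with the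
nonvanishing loci of polynomial functions as basic open sets), and the functions that are locally
fractions of polynomial functions. -/
def affineSpace (V : Type) [AddCommGroup V] [Module ℂ V] [FiniteDimensional ℂ V] :
    FunctionSpace :=
  fractionSpace (T := V) (I := Unit) (fun _ => Set.univ) (fun _ => polyFunctions V)
    (fun _ => ⟨(), trivial⟩) (fun _ _ => ⟨(), Set.subset_univ _, le_rfl, le_rfl⟩)

namespace FunctionSpace

/-- The functions `(x, y) ↦ ∑ aᵢ(x) bᵢ(y)` with `aᵢ` regular on `U` and `bᵢ` regular on `V`. -/
def tensorFunctions (X Y : FunctionSpace) (U : Set X.carrier) (V : Set Y.carrier) :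
    Subalgebra ℂ (X.carrier × Y.carrier → ℂ) :=
  Algebra.adjoin ℂ
    ({f | ∃ a, X.IsRegularOn a U ∧ f = a ∘ Prod.fst} ∪
      {f | ∃ b, Y.IsRegularOn b V ∧ f = b ∘ Prod.snd})

theorem tensorFunctions_mono (X Y : FunctionSpace) {U U' : Set X.carrier} {V V' : Set Y.carrier}
    (hU : U' ⊆ U) (hV : V' ⊆ V) : tensorFunctions X Y U V ≤ tensorFunctions X Y U' V' := by
  refine Algebra.adjoin_mono (Set.union_subset_union ?_ ?_)
  · rintro f ⟨a, ha, rfl⟩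
    exact ⟨a, fun x hx => ha x (hU hx), rfl⟩
  · rintro f ⟨a, ha, rfl⟩
    exact ⟨a, fun x hx => ha x (hV hx), rfl⟩

/-- The product in the category of spaces with functions (for varieties: the product variety, whose
topology is finer than the product topology).  Basic open sets are
`{(x, y) ∈ U × V | ∑ aᵢ(x) bᵢ(y) ≠ 0}` with `U`, `V` open, `aᵢ` regular on `U` and `bᵢ` on `V`, and
regular functions are locally fractions of such sums. -/
def prod (X Y : FunctionSpace) : FunctionSpace :=
  fractionSpace (T := X.carrier × Y.carrier)
    (I := TopologicalSpace.Opens X.carrier × TopologicalSpace.Opens Y.carrier)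
    (fun i => (i.1 : Set X.carrier) ×ˢ (i.2 : Set Y.carrier))
    (fun i => tensorFunctions X Y i.1 i.2)
    (fun _ => ⟨(⊤, ⊤), trivial, trivial⟩)
    (fun i j => ⟨(i.1 ⊓ j.1, i.2 ⊓ j.2), fun _ h => ⟨⟨h.1.1, h.2.1⟩, ⟨h.1.2, h.2.2⟩⟩,
      tensorFunctions_mono X Y Set.inter_subset_left Set.inter_subset_left,
      tensorFunctions_mono X Y Set.inter_subset_right Set.inter_subset_right⟩)

/-- Affine varieties (possibly reducible): closed subsets of some affine space `ℂᵐ`, up to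
isomorphism. -/
def IsAffine (X : FunctionSpace) : Prop :=
  ∃ (m : ℕ) (S : Set (affineSpace (Fin m → ℂ)).carrier),
    IsClosed S ∧ Nonempty (Iso X ((affineSpace (Fin m → ℂ)).subspace S))

/-- Varieties (possibly reducible): covered by finitely many affine open subsets, and separated. -/
structure IsVariety (X : FunctionSpace) : Prop where
  affine_cover : ∃ 𝒰 : Set (Set X.carrier), 𝒰.Finite ∧ ⋃₀ 𝒰 = Set.univ ∧
    ∀ U ∈ 𝒰, IsOpen U ∧ (X.subspace U).IsAffine
  separated : IsClosed {z : (prod X X).carrier | z.1 = z.2}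

/-- The local ring at `x`: germs of functions regular at `x`. -/
def localRing (X : FunctionSpace) (x : X.carrier) : Subring (Germ (𝓝 x) ℂ) where
  carrier := {γ | ∃ f, X.IsRegularAt f x ∧ γ = (f : Germ (𝓝 x) ℂ)}
  zero_mem' := ⟨_, X.const 0 x, rfl⟩
  one_mem' := ⟨_, X.const 1 x, rfl⟩
  add_mem' := by
    rintro _ _ ⟨f, hf, rfl⟩ ⟨g, hg, rfl⟩
    exact ⟨f + g, X.add hf hg, rfl⟩
  mul_mem' := by
    rintro _ _ ⟨f, hf, rfl⟩ ⟨g, hg, rfl⟩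
    exact ⟨f * g, X.mul hf hg, rfl⟩
  neg_mem' := by
    rintro _ ⟨f, hf, rfl⟩
    refine ⟨(fun _ => -1) * f, X.mul (X.const (-1) x) hf, ?_⟩
    rw [show ((fun _ => -1) * f : X.carrier → ℂ) = -f by ext; simp]
    rfl

/-- Nonsingular: all local rings are regular. -/
def IsNonsingular (X : FunctionSpace) : Prop :=
  ∀ x, IsRegularLocalRing (X.localRing x)

/-- Proper morphisms of varieties: morphisms that are universally closed, i.e. for every variety
`Z` and morphism `h : Z → Y` the projection `X ×_Y Z → Z` is closed, where
`X ×_Y Z = {(x, z) | φ x = h z} ⊆ X × Z`. -/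
def IsProperMorphism (X Y : FunctionSpace) (φ : X.carrier → Y.carrier) : Prop :=
  IsMorphism X Y φ ∧
  ∀ (Z : FunctionSpace) (h : Z.carrier → Y.carrier), IsVariety Z → IsMorphism Z Y h →
    ∀ T : Set (prod X Z).carrier, IsClosed T →
      IsClosed {z : Z.carrier | ∃ x : X.carrier, (x, z) ∈ T ∧ φ x = h z}

/-- Birational morphisms: morphisms that restrict to an isomorphism between dense open subsets. -/
def IsBirationalMorphism (X Y : FunctionSpace) (φ : X.carrier → Y.carrier) : Prop :=
  IsMorphism X Y φ ∧
  ∃ (U : Set X.carrier) (V : Set Y.carrier), IsOpen U ∧ Dense U ∧ IsOpen V ∧ Dense V ∧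
    ∃ e : Iso (X.subspace U) (Y.subspace V), ∀ x : U, (e.toFun x : V).1 = φ x.1

/-- `φ : X → Y` is a resolution of singularities of the irreducible variety `Y`: `X` is a
nonsingular irreducible variety, and `φ` is proper and birational. -/
structure IsResolution (X Y : FunctionSpace) (φ : X.carrier → Y.carrier) : Prop where
  variety : IsVariety X
  irreducible : IrreducibleSpace X.carrier
  nonsingular : IsNonsingular X
  target_variety : IsVariety Y
  target_irreducible : IrreducibleSpace Y.carrier
  proper : IsProperMorphism X Y φ
  birational : IsBirationalMorphism X Y φ

end FunctionSpace

/-! ## The enhanced adjoint representation -/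

/-- `W = M_{n,p} ⊕ M_{q,n} ⊕ M_n`. -/
def EnhancedSpace (n p q : ℕ) : Type :=
  Matrix (Fin n) (Fin p) ℂ × Matrix (Fin q) (Fin n) ℂ × Matrix (Fin n) (Fin n) ℂ

namespace EnhancedSpace

variable {n p q : ℕ}

instance instAddCommGroup : AddCommGroup (EnhancedSpace n p q) :=
  inferInstanceAs (AddCommGroup
    (Matrix (Fin n) (Fin p) ℂ × Matrix (Fin q) (Fin n) ℂ × Matrix (Fin n) (Fin n) ℂ))

instance instModule : Module ℂ (EnhancedSpace n p q) :=
  inferInstanceAs (Module ℂ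
    (Matrix (Fin n) (Fin p) ℂ × Matrix (Fin q) (Fin n) ℂ × Matrix (Fin n) (Fin n) ℂ))

instance instFiniteDimensional : FiniteDimensional ℂ (EnhancedSpace n p q) :=
  inferInstanceAs (FiniteDimensional ℂ
    (Matrix (Fin n) (Fin p) ℂ × Matrix (Fin q) (Fin n) ℂ × Matrix (Fin n) (Fin n) ℂ))

/-- The enhanced adjoint action `g · (ξ, η, v) = (g ξ, η g⁻¹, g v g⁻¹)`. -/
instance instMulAction : MulAction (Matrix.GeneralLinearGroup (Fin n) ℂ) (EnhancedSpace n p q) where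
  smul g w := (g.val * w.1, w.2.1 * g⁻¹.val, g.val * w.2.2 * g⁻¹.val)
  one_smul := by
    rintro ⟨ξ, η, v⟩
    change (_, _, _) = (_, _, _)
    simp
  mul_smul := by
    rintro g h ⟨ξ, η, v⟩
    change ((g * h).val * ξ, η * (g * h)⁻¹.val, (g * h).val * v * (g * h)⁻¹.val) =
      (g.val * (h.val * ξ), η * h⁻¹.val * g⁻¹.val, g.val * (h.val * v * h⁻¹.val) * g⁻¹.val)
    simp only [mul_inv_rev, Units.val_mul, Matrix.mul_assoc]

end EnhancedSpace

/-- The subgroup `B` of upper triangular matrices in `GL_n(ℂ)`. -/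
def upperBorel (n : ℕ) : Subgroup (Matrix.GeneralLinearGroup (Fin n) ℂ) where
  carrier := {g | ∀ i j : Fin n, j < i → g.val i j = 0}
  one_mem' := by
    intro i j h
    simp [Matrix.one_apply_ne h.ne']
  mul_mem' := by
    intro g h hg hh
    exact Matrix.BlockTriangular.mul (b := id) (M := g.val) (N := h.val) hg hh
  inv_mem' := by
    intro g hg
    let := g.invertible
    have := Matrix.blockTriangular_inv_of_blockTriangular (b := id) (M := g.val) hg
    intro i j h
    rw [Matrix.coe_units_inv]
    exact this h

/-- `U_k`: the triples `(ξ, η, v)` such that only the first `k` rows of `ξ` and only the last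
`n - k` columns of `η` may be nonzero, and `v` is strictly upper triangular (indices start
at `0`). -/
def unstableSubspace (n p q k : ℕ) : Submodule ℂ (EnhancedSpace n p q) where
  carrier := {w | (∀ (i : Fin n) (j : Fin p), k ≤ i.val → w.1 i j = 0) ∧
    (∀ (i : Fin q) (j : Fin n), j.val < k → w.2.1 i j = 0) ∧
    (∀ i j : Fin n, j ≤ i → w.2.2 i j = 0)}
  zero_mem' := ⟨fun _ _ _ => rfl, fun _ _ _ => rfl, fun _ _ _ => rfl⟩
  add_mem' := by
    rintro a b ⟨h1, h2, h3⟩ ⟨h1', h2', h3'⟩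
    refine ⟨fun i j h => ?_, fun i j h => ?_, fun i j h => ?_⟩
    · change a.1 i j + b.1 i j = 0
      rw [h1 i j h, h1' i j h, add_zero]
    · change a.2.1 i j + b.2.1 i j = 0
      rw [h2 i j h, h2' i j h, add_zero]
    · change a.2.2 i j + b.2.2 i j = 0
      rw [h3 i j h, h3' i j h, add_zero]
  smul_mem' := by
    rintro c a ⟨h1, h2, h3⟩
    refine ⟨fun i j h => ?_, fun i j h => ?_, fun i j h => ?_⟩
    · change c * a.1 i j = 0
      rw [h1 i j h, mul_zero]
    · change c * a.2.1 i j = 0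
      rw [h2 i j h, mul_zero]
    · change c * a.2.2 i j = 0
      rw [h3 i j h, mul_zero]

/-- `W` as an affine space with its Zariski topology. -/
def enhancedVariety (n p q : ℕ) : FunctionSpace := affineSpace (EnhancedSpace n p q)

/-- `GL_n(ℂ)` as a variety: the structure induced from the affine space of all matrices. -/
def glVariety (n : ℕ) : FunctionSpace :=
  (affineSpace (Matrix (Fin n) (Fin n) ℂ)).induced
    (S := Matrix.GeneralLinearGroup (Fin n) ℂ) (fun g => g.val)

/-- The null cone `π⁻¹(π(0))` of the affine quotient `π : W → W // G = Spec ℂ[W]^G`: all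
`G`-invariant polynomial functions take the same value as at the origin. -/
def nullCone (n p q : ℕ) : Set (enhancedVariety n p q).carrier :=
  {w : EnhancedSpace n p q | ∀ f ∈ polyFunctions (EnhancedSpace n p q),
    (∀ (g : Matrix.GeneralLinearGroup (Fin n) ℂ) (x : EnhancedSpace n p q), f (g • x) = f x) →
      f w = f 0}

/-- `C_k = G · U_k`. -/
def nullComponent (n p q k : ℕ) : Set (enhancedVariety n p q).carrier :=
  {w : EnhancedSpace n p q | ∃ g : Matrix.GeneralLinearGroup (Fin n) ℂ,
    ∃ u ∈ unstableSubspace n p q k, w = g • u}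

/-- `C_k` with the structure induced from `W`. -/
def nullComponentVariety (n p q k : ℕ) : FunctionSpace :=
  (enhancedVariety n p q).subspace (nullComponent n p q k)

/-- The product variety `G × U_k`. -/
def groupTimesUnstable (n p q k : ℕ) : FunctionSpace :=
  (glVariety n).prod ((enhancedVariety n p q).subspace
    (unstableSubspace n p q k : Set (EnhancedSpace n p q)))

/-- The orbit relation of the action `b · (g, u) = (g b⁻¹, b · u)` of `B` on `G × U_k`. -/
def associatedSetoid (n p q k : ℕ) : Setoid (groupTimesUnstable n p q k).carrier where
  r := fun (x y : Matrix.GeneralLinearGroup (Fin n) ℂ ×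
      (unstableSubspace n p q k : Set (EnhancedSpace n p q))) =>
    ∃ b ∈ upperBorel n, y.1 = x.1 * b⁻¹ ∧ (y.2 : EnhancedSpace n p q) = b • x.2.1
  iseqv :=
    { refl := fun x => ⟨1, (upperBorel n).one_mem, by simp, by simp⟩
      symm := by
        rintro x y ⟨b, hb, h1, h2⟩
        exact ⟨b⁻¹, (upperBorel n).inv_mem hb, by simp [h1], by simp [h2]⟩
      trans := by
        rintro x y z ⟨b, hb, h1, h2⟩ ⟨c, hc, h3, h4⟩
        exact ⟨c * b, (upperBorel n).mul_mem hc hb, by simp [h1, h3, mul_assoc],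
          by simp [h2, h4, mul_smul]⟩ }

/-- The associated bundle `G ×_B U_k = (G × U_k) / B`. -/
def associatedBundle (n p q k : ℕ) : FunctionSpace :=
  (groupTimesUnstable n p q k).quotient (associatedSetoid n p q k)

/-- `ψ_k : G ×_B U_k → C_k`, `[g, u] ↦ g · u`. -/
def collapsingMap (n p q k : ℕ) :
    (associatedBundle n p q k).carrier → (nullComponentVariety n p q k).carrier :=
  Quotient.lift (s := associatedSetoid n p q k)
    (fun (x : Matrix.GeneralLinearGroup (Fin n) ℂ ×
        (unstableSubspace n p q k : Set (EnhancedSpace n p q))) =>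
      (⟨x.1 • x.2.1, x.1, x.2.1, x.2.2, rfl⟩ : nullComponent n p q k))
    (by
      rintro x y ⟨b, hb, h1, h2⟩
      refine Subtype.ext ?_
      have key : ∀ (g g' b : Matrix.GeneralLinearGroup (Fin n) ℂ) (u u' : EnhancedSpace n p q),
          g' = g * b⁻¹ → u' = b • u → g • u = g' • u' := by
        rintro g _ b u _ rfl rfl
        rw [smul_smul, inv_mul_cancel_right]
      exact key _ _ b _ _ h1 h2)

/-! The main tool is the Krylov matrix `K(v, w)` with columns `v ^ (n - 1) w, …, v w, w`. It is
upper triangular when `v` is strictly upper triangular, and `K(g v g⁻¹, g w) = g K(v, w)`. Hence, if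
`v` and `g v g⁻¹` are both strictly upper triangular and `v` has a cyclic vector, then `g = K(g v
g⁻¹, g w) K(v, w)⁻¹` lies in `B` (`mem_upperBorel_of_conj`). Applied to a Jordan block, this bounds
the stabilizer. It also makes `ψ_k` injective over the open locus where `v` has a cyclic vector, and
there `x ↦ [K, K⁻¹ x]`, with `K` the Krylov matrix of `x`, is a regular inverse. So `ψ_k` is
birational.

`C_k` lies in the null cone because a one-parameter subgroup of diagonal matrices contracts `U_k` to
`0`.

The translates of the big cell (lower unipotent times `B`) give charts of `G ×_B U_k` isomorphic to
an affine space (`chartIso`). They are cut out by leading minors, and the LU factorisation gives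
their coordinates. Nonsingularity follows from that of affine space. Separatedness follows because
`[g, u]` is determined by `gB` and `g u`.

Properness rests on the completeness of `G / B`: a closed `B`-stable subset of `GL_n × ℂᵐ` has
closed projection (`exists_mem_of_mem_closure_image`). The proof is valuative: a generic point
specialising to the given `z₀` has values in a field `K` with a valuation ring `O`; the Iwasawa
decomposition `GL_n(K) = GL_n(O) B(K)` makes its matrix integral; reduction and the Nullstellensatz
produce a complex point. The same projection statement shows that `C_k` is closed in `W`.

For the dimension, a chart maps polynomially onto a dense subset of `C_k`, which bounds it from
above by a transcendence degree; a nonempty open part of the chart embeds topologically in `C_k`,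
which bounds it from below. -/

namespace FunctionSpace

/-! ### Formal properties of spaces with functions: morphisms, products, local rings -/

variable {X Y Z : FunctionSpace}

/-- The functions that are regular at a point form an algebra. -/
def regularAt (X : FunctionSpace) (x : X.carrier) : Subalgebra ℂ (X.carrier → ℂ) where
  carrier := {f | X.IsRegularAt f x}
  mul_mem' := X.mul
  add_mem' := X.add
  algebraMap_mem' c := X.const c x

theorem mem_regularAt {x : X.carrier} {f : X.carrier → ℂ} :
    f ∈ X.regularAt x ↔ X.IsRegularAt f x := Iff.rfl

theorem isOpen_ne_zero {f : X.carrier → ℂ} {U : Set X.carrier} (hU : IsOpen U)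
    (hf : X.IsRegularOn f U) : IsOpen {x ∈ U | f x ≠ 0} := by
  refine isOpen_iff_mem_nhds.2 fun x hx => ?_
  filter_upwards [X.eventually_ne (hf x hx.1) hx.2, hU.eventually_mem hx.1] with y h1 h2
  exact ⟨h2, h1⟩

theorem IsMorphism.id : IsMorphism X X id := ⟨continuous_id, fun _ _ h => h⟩

theorem IsMorphism.comp {ψ : Y.carrier → Z.carrier} {φ : X.carrier → Y.carrier}
    (hψ : IsMorphism Y Z ψ) (hφ : IsMorphism X Y φ) : IsMorphism X Z (ψ ∘ φ) :=
  ⟨hψ.continuous.comp hφ.continuous,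
    fun x f hf => hφ.comp_regular x (f ∘ ψ) (hψ.comp_regular (φ x) f hf)⟩

theorem isMorphism_induced_map {S : Type} (ι : S → X.carrier) : IsMorphism (X.induced ι) X ι :=
  ⟨continuous_induced_dom, fun _ f hf => ⟨f, hf, EventuallyEq.rfl⟩⟩

theorem isMorphism_val (U : Set X.carrier) :
    IsMorphism (X.subspace U) X (Subtype.val : U → X.carrier) :=
  isMorphism_induced_map _

theorem isMorphism_to_induced {S : Type} {ι : S → X.carrier} {φ : Z.carrier → S} :
    IsMorphism Z (X.induced ι) φ ↔ IsMorphism Z X (ι ∘ φ) := by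
  refine ⟨fun h => (isMorphism_induced_map ι).comp h, fun h => ?_⟩
  have hc : Continuous[Z.top, (X.induced ι).top] φ := continuous_induced_rng.2 h.continuous
  refine ⟨hc, ?_⟩
  rintro z f ⟨F, hF, hf⟩
  exact Z.congr ((hc.tendsto z).eventually hf.symm) (h.comp_regular z F hF)

theorem isMorphism_to_subspace {U : Set X.carrier} {φ : Z.carrier → U} :
    IsMorphism Z (X.subspace U) φ ↔ IsMorphism Z X (fun z => (φ z : X.carrier)) :=
  isMorphism_to_induced

theorem map_val_nhds {U : Set X.carrier} (hU : IsOpen U) (x : U) :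
    Filter.map (Subtype.val : U → X.carrier) (@nhds U (X.subspace U).top x) = 𝓝 x.1 :=
  hU.isOpenEmbedding_subtypeVal.map_nhds_eq x

theorem isRegularAt_subspace {U : Set X.carrier} (hU : IsOpen U) (x : U) {f : X.carrier → ℂ} :
    (X.subspace U).IsRegularAt (f ∘ Subtype.val) x ↔ X.IsRegularAt f x.1 := by
  refine ⟨?_, fun h => ⟨f, h, EventuallyEq.rfl⟩⟩
  rintro ⟨F, hF, hf⟩
  refine X.congr ?_ hF
  have : ∀ᶠ y in Filter.map (Subtype.val : U → X.carrier) (@nhds U (X.subspace U).top x),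
      F y = f y :=
    Filter.eventually_map.2 (hf.mono fun y hy => hy.symm)
  rwa [map_val_nhds hU] at this

theorem isMorphism_of_locally {φ : X.carrier → Y.carrier}
    (h : ∀ x, ∃ U : Set X.carrier, IsOpen U ∧ x ∈ U ∧
      IsMorphism (X.subspace U) Y (fun u : U => φ u)) : IsMorphism X Y φ := by
  constructor
  · refine continuous_iff_continuousAt.2 fun x => ?_
    obtain ⟨U, hU, hx, hm⟩ := h x
    have h1 := hm.continuous.tendsto (⟨x, hx⟩ : U)
    have h2 := map_val_nhds hU ⟨x, hx⟩
    change Filter.Tendsto φ (𝓝 x) (𝓝 (φ x))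
    rw [← h2]
    exact tendsto_map'_iff.2 h1
  · intro x f hf
    obtain ⟨U, hU, hx, hm⟩ := h x
    exact (isRegularAt_subspace hU ⟨x, hx⟩).1 (hm.comp_regular ⟨x, hx⟩ f hf)

theorem isMorphism_quotient_mk (r : Setoid X.carrier) :
    IsMorphism X (X.quotient r) (Quotient.mk r) := by
  refine ⟨continuous_coinduced_rng, ?_⟩
  rintro x f ⟨V, -, hx, hf⟩
  exact hf x hx

theorem isMorphism_from_quotient {r : Setoid X.carrier} {φ : Quotient r → Y.carrier}
    (h : IsMorphism X Y (φ ∘ Quotient.mk r)) : IsMorphism (X.quotient r) Y φ := by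
  have hc : Continuous[(X.quotient r).top, Y.top] φ := continuous_coinduced_dom.2 h.continuous
  refine ⟨hc, fun z f hf => ?_⟩
  obtain ⟨O, hO, hOo, hz⟩ := eventually_nhds_iff.1 (Y.eventually hf)
  exact ⟨φ ⁻¹' O, hOo.preimage hc, hz, fun x hx => h.comp_regular x f (hO _ hx)⟩

theorem isMorphism_fst : IsMorphism (prod X Y) X Prod.fst := by
  constructor
  · refine ⟨fun U hU => TopologicalSpace.isOpen_generateFrom_of_mem ⟨(⟨U, hU⟩, ⊤), 1,
      Subalgebra.one_mem _, ?_⟩⟩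
    ext z
    simp
    rfl
  · intro z f hf
    obtain ⟨O, hO, hOo, hz⟩ := eventually_nhds_iff.1 (X.eventually hf)
    exact ⟨(⟨O, hOo⟩, ⊤), ⟨hz, trivial⟩, f ∘ Prod.fst,
      Algebra.subset_adjoin (Or.inl ⟨f, hO, rfl⟩), 1, Subalgebra.one_mem _, one_ne_zero,
      Eventually.of_forall fun y => (div_one _).symm⟩

theorem isMorphism_snd : IsMorphism (prod X Y) Y Prod.snd := by
  constructor
  · refine ⟨fun U hU => TopologicalSpace.isOpen_generateFrom_of_mem ⟨(⊤, ⟨U, hU⟩), 1,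
      Subalgebra.one_mem _, ?_⟩⟩
    ext z
    simp
    rfl
  · intro z f hf
    obtain ⟨O, hO, hOo, hz⟩ := eventually_nhds_iff.1 (Y.eventually hf)
    exact ⟨(⊤, ⟨O, hOo⟩), ⟨trivial, hz⟩, f ∘ Prod.snd,
      Algebra.subset_adjoin (Or.inr ⟨f, hO, rfl⟩), 1, Subalgebra.one_mem _, one_ne_zero,
      Eventually.of_forall fun y => (div_one _).symm⟩

/-- The functions regular at a point form an algebra, so only the two kinds of generators of the
tensor functions need checking. -/
theorem isRegularAt_tensor_comp {a : Z.carrier → X.carrier} {b : Z.carrier → Y.carrier}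
    (ha : IsMorphism Z X a) (hb : IsMorphism Z Y b) {U : Set X.carrier} {V : Set Y.carrier}
    {P : X.carrier × Y.carrier → ℂ} (hP : P ∈ tensorFunctions X Y U V) {z : Z.carrier}
    (hU : a z ∈ U) (hV : b z ∈ V) : Z.IsRegularAt (fun z => P (a z, b z)) z := by
  rw [← mem_regularAt]
  induction hP using Algebra.adjoin_induction with
  | mem f hf =>
    rcases hf with ⟨c, hc, rfl⟩ | ⟨c, hc, rfl⟩
    · exact ha.comp_regular z c (hc _ hU)
    · exact hb.comp_regular z c (hc _ hV)
  | algebraMap r => exact (Z.regularAt z).algebraMap_mem r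
  | add f g _ _ hf hg => exact add_mem hf hg
  | mul f g _ _ hf hg => exact mul_mem hf hg

theorem IsMorphism.prodMk {a : Z.carrier → X.carrier} {b : Z.carrier → Y.carrier}
    (ha : IsMorphism Z X a) (hb : IsMorphism Z Y b) :
    IsMorphism Z (prod X Y) (fun z => (a z, b z)) := by
  have hc : Continuous[Z.top, (prod X Y).top] (fun z => (a z, b z)) := by
    refine continuous_generateFrom_iff.2 ?_
    rintro _ ⟨⟨U, V⟩, P, hP, rfl⟩
    exact isOpen_ne_zero ((U.2.preimage ha.continuous).inter (V.2.preimage hb.continuous))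
      fun z hz => isRegularAt_tensor_comp ha hb hP hz.1 hz.2
  refine ⟨hc, ?_⟩
  rintro z f ⟨⟨U, V⟩, hz, P, hP, Q, hQ, hne, hf⟩
  have h1 := isRegularAt_tensor_comp ha hb hP hz.1 hz.2
  have h2 := isRegularAt_tensor_comp ha hb hQ hz.1 hz.2
  refine Z.congr ((hc.tendsto z).eventually hf.symm) ?_
  rw [div_eq_mul_inv]
  exact Z.mul h1 (Z.inv h2 hne)

/-- A space is separated if distinct points are told apart by functions on products of open sets
which vanish on the diagonal. -/
theorem isClosed_diagonal_of_tensorFunctions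
    (h : ∀ x y : X.carrier, x ≠ y → ∃ U V : Set X.carrier, IsOpen U ∧ IsOpen V ∧ x ∈ U ∧ y ∈ V ∧
      ∃ P ∈ tensorFunctions X X U V, P (x, y) ≠ 0 ∧ ∀ z ∈ U ∩ V, P (z, z) = 0) :
    IsClosed {z : (prod X X).carrier | z.1 = z.2} := by
  refine ⟨isOpen_iff_mem_nhds.2 ?_⟩
  rintro ⟨x, y⟩ hxy
  obtain ⟨U, V, hU, hV, hx, hy, P, hP, hne, hz⟩ := h x y hxy
  have ho : IsOpen[(prod X X).top] {z ∈ U ×ˢ V | P z ≠ 0} :=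
    TopologicalSpace.isOpen_generateFrom_of_mem ⟨(⟨U, hU⟩, ⟨V, hV⟩), P, hP, rfl⟩
  refine Filter.mem_of_superset (ho.mem_nhds ⟨⟨hx, hy⟩, hne⟩) ?_
  rintro ⟨z, w⟩ ⟨hzw, h0⟩ (rfl : z = w)
  exact h0 (hz z hzw)

namespace Iso

/-- The inverse isomorphism. -/
def symm (e : Iso X Y) : Iso Y X where
  toEquiv := e.toEquiv.symm
  isMorphism := e.isMorphism_inv
  isMorphism_inv := e.isMorphism

/-- The composition of isomorphisms. -/
def trans (e : Iso X Y) (f : Iso Y Z) : Iso X Z where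
  toEquiv := e.toEquiv.trans f.toEquiv
  isMorphism := f.isMorphism.comp e.isMorphism
  isMorphism_inv := e.isMorphism_inv.comp f.isMorphism_inv

/-- The underlying homeomorphism. -/
def toHomeomorph (e : Iso X Y) : X.carrier ≃ₜ Y.carrier where
  toEquiv := e.toEquiv
  continuous_toFun := e.isMorphism.continuous
  continuous_invFun := e.isMorphism_inv.continuous

theorem isRegularAt_comp (e : Iso X Y) (x : X.carrier) (f : Y.carrier → ℂ) :
    X.IsRegularAt (f ∘ e.toFun) x ↔ Y.IsRegularAt f (e.toFun x) := by
  refine ⟨fun h => ?_, e.isMorphism.comp_regular x f⟩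
  have h1 := e.isMorphism_inv.comp_regular (e.toFun x) (f ∘ e.toFun)
    (by rw [show e.invFun (e.toFun x) = x from e.left_inv x]; exact h)
  rwa [show (f ∘ e.toFun) ∘ e.invFun = f from funext fun y => congrArg f (e.right_inv y)] at h1

end Iso

theorem IsAffine.of_iso (e : Iso X Y) (h : Y.IsAffine) : X.IsAffine := by
  obtain ⟨m, S, hS, ⟨f⟩⟩ := h
  exact ⟨m, S, hS, ⟨e.trans f⟩⟩

/-- The subspace of all points. -/
def isoSubspaceUniv (X : FunctionSpace) : Iso (X.subspace Set.univ) X where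
  toEquiv := Equiv.Set.univ _
  isMorphism := isMorphism_val _
  isMorphism_inv := isMorphism_to_subspace.2 IsMorphism.id

/-- Local rings only depend on a neighbourhood. -/
noncomputable def localRingEquiv {φ : X.carrier → Y.carrier} (x : X.carrier)
    (hinj : Function.Injective φ) (hmap : Filter.map φ (𝓝 x) = 𝓝 (φ x))
    (hreg : ∀ f, X.IsRegularAt (f ∘ φ) x ↔ Y.IsRegularAt f (φ x)) :
    Y.localRing (φ x) ≃+* X.localRing x := by
  have ht : Tendsto φ (𝓝 x) (𝓝 (φ x)) := hmap.le
  let F : Germ (𝓝 (φ x)) ℂ →+* Germ (𝓝 x) ℂ :=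
    { toFun := fun γ => γ.compTendsto φ ht
      map_one' := rfl
      map_zero' := rfl
      map_mul' := by rintro ⟨f⟩ ⟨g⟩; rfl
      map_add' := by rintro ⟨f⟩ ⟨g⟩; rfl }
  have hF : ∀ f : Y.carrier → ℂ, F (f : Germ (𝓝 (φ x)) ℂ) = ((f ∘ φ : X.carrier → ℂ) : Germ _ ℂ) :=
    fun f => rfl
  let G : Y.localRing (φ x) →+* X.localRing x := F.restrict _ _ (by
    rintro _ ⟨f, hf, rfl⟩
    exact ⟨f ∘ φ, (hreg f).2 hf, hF f⟩)
  refine RingEquiv.ofBijective G ⟨?_, ?_⟩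
  · rintro ⟨_, f, hf, rfl⟩ ⟨_, g, hg, rfl⟩ h
    refine Subtype.ext (Germ.coe_eq.2 ?_)
    have h1 := Germ.coe_eq.1 (congrArg Subtype.val h)
    change ∀ᶠ y in 𝓝 (φ x), f y = g y
    rw [← hmap]
    exact h1
  · rintro ⟨_, f, hf, rfl⟩
    -- Injectivity of `φ` lets `f` factor through `φ`. The default value `0` off the image plays no
    -- role, since `hreg` only sees `g ∘ φ`.
    obtain ⟨g, rfl⟩ : ∃ g : Y.carrier → ℂ, g ∘ φ = f :=
      ⟨Function.extend φ f 0, funext fun y => hinj.extend_apply f 0 y⟩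
    exact ⟨⟨_, g, (hreg g).1 hf, rfl⟩, rfl⟩

theorem isNonsingular_of_cover {E : FunctionSpace} (hE : E.IsNonsingular)
    (h : ∀ x : X.carrier, ∃ U : Set X.carrier, IsOpen U ∧ x ∈ U ∧ Nonempty (Iso (X.subspace U) E)) :
    X.IsNonsingular := by
  intro x
  obtain ⟨U, hU, hx, ⟨e⟩⟩ := h x
  let u : (X.subspace U).carrier := (⟨x, hx⟩ : U)
  have := hE (e.toFun u)
  have e1 := localRingEquiv u e.toEquiv.injective (e.toHomeomorph.map_nhds_eq u)
    (e.isRegularAt_comp u)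
  have e2 := localRingEquiv (X := X.subspace U) (Y := X) (φ := (Subtype.val : U → X.carrier)) u
    Subtype.val_injective (map_val_nhds hU u) (fun f => isRegularAt_subspace hU u)
  have := IsRegularLocalRing.of_ringEquiv e1
  exact IsRegularLocalRing.of_ringEquiv e2.symm

end FunctionSpace

/-! ### Polynomial functions on a finite-dimensional vector space -/

section PolynomialFunctions

variable {V W : Type} [AddCommGroup V] [Module ℂ V] [FiniteDimensional ℂ V]
  [AddCommGroup W] [Module ℂ W] [FiniteDimensional ℂ W]

theorem dual_mem_polyFunctions (φ : Module.Dual ℂ V) : (φ : V → ℂ) ∈ polyFunctions V :=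
  Algebra.subset_adjoin ⟨φ, rfl⟩

/-- A map is polynomial if its linear coordinates are; then it pulls back polynomials. -/
theorem polyFunctions_comp {χ : V → W} (h : ∀ φ : Module.Dual ℂ W, (fun v => φ (χ v)) ∈ polyFunctions V)
    {f : W → ℂ} (hf : f ∈ polyFunctions W) : f ∘ χ ∈ polyFunctions V := by
  induction hf using Algebra.adjoin_induction with
  | mem f hf => obtain ⟨φ, rfl⟩ := hf; exact h φ
  | algebraMap r => exact (polyFunctions V).algebraMap_mem r
  | add f g _ _ hf hg => exact add_mem hf hg
  | mul f g _ _ hf hg => exact mul_mem hf hg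

/-- Polynomial functions are polynomials in the coordinates of a basis. -/
noncomputable def polyEquiv {σ : Type*} [Finite σ] (b : Module.Basis σ ℂ V) :
    MvPolynomial σ ℂ ≃ₐ[ℂ] polyFunctions V :=
  AlgEquiv.ofBijective
    (MvPolynomial.aeval fun i => (⟨b.coord i, dual_mem_polyFunctions _⟩ : polyFunctions V)) (by
    have key : ∀ (P : MvPolynomial σ ℂ) (v : V), ((MvPolynomial.aeval fun i =>
        (⟨b.coord i, dual_mem_polyFunctions _⟩ : polyFunctions V)) P).1 v =
          MvPolynomial.eval (b.repr v) P := by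
      intro P v
      induction P using MvPolynomial.induction_on with
      | C a => simp
      | add p q hp hq => simp [hp, hq]
      | mul_X p i hp => simp [hp]
    constructor
    · intro P Q h
      -- Over the infinite field `ℂ` a polynomial is determined by its values.
      refine MvPolynomial.funext fun x => ?_
      have := congrFun (congrArg Subtype.val h) (b.equivFun.symm x)
      rw [key, key] at this
      have hx : (b.repr (b.equivFun.symm x) : σ → ℂ) = x := b.equivFun.apply_symm_apply x
      rwa [hx] at this
    · rintro ⟨f, hf⟩
      induction hf using Algebra.adjoin_induction with
      | mem f hf =>
        obtain ⟨φ, rfl⟩ := hf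
        have := Fintype.ofFinite σ
        refine ⟨∑ i, MvPolynomial.C (φ (b i)) * MvPolynomial.X i, Subtype.ext (funext fun v => ?_)⟩
        rw [key]
        conv_rhs => rw [← b.sum_repr v]
        simp [-Module.Basis.sum_repr, mul_comm]
      | algebraMap r => exact ⟨algebraMap _ _ r, AlgHom.commutes _ _⟩
      | add f g _ _ hf hg =>
        obtain ⟨P, hP⟩ := hf
        obtain ⟨Q, hQ⟩ := hg
        exact ⟨P + Q, by rw [map_add, hP, hQ]; rfl⟩
      | mul f g _ _ hf hg =>
        obtain ⟨P, hP⟩ := hf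
        obtain ⟨Q, hQ⟩ := hg
        exact ⟨P * Q, by rw [map_mul, hP, hQ]; rfl⟩)

theorem polyEquiv_apply {σ : Type*} [Finite σ] (b : Module.Basis σ ℂ V) (P : MvPolynomial σ ℂ)
    (v : V) : (polyEquiv b P).1 v = MvPolynomial.eval (b.repr v) P := by
  change ((MvPolynomial.aeval fun i =>
    (⟨b.coord i, dual_mem_polyFunctions _⟩ : polyFunctions V)) P).1 v = _
  induction P using MvPolynomial.induction_on with
  | C a => simp
  | add p q hp hq => simp [hp, hq]
  | mul_X p i hp => simp [hp]

/-- Polynomial functions on `ℂ^σ` are polynomials. -/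
theorem mem_polyFunctions_pi {σ : Type} [Finite σ] {f : (σ → ℂ) → ℂ} :
    f ∈ polyFunctions (σ → ℂ) ↔ ∃ P : MvPolynomial σ ℂ, f = fun x => MvPolynomial.eval x P := by
  have hb : ∀ x, ((Pi.basisFun ℂ σ).repr x : σ → ℂ) = x := fun x => rfl
  constructor
  · intro hf
    obtain ⟨P, hP⟩ := (polyEquiv (Pi.basisFun ℂ σ)).surjective ⟨f, hf⟩
    refine ⟨P, funext fun x => ?_⟩
    rw [← hb x, ← polyEquiv_apply, hP]
    rfl
  · rintro ⟨P, rfl⟩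
    convert (polyEquiv (Pi.basisFun ℂ σ) P).2 using 1
    funext x
    rw [polyEquiv_apply, hb]

instance : IsDomain (polyFunctions V) :=
  (polyEquiv (Module.finBasis ℂ V)).symm.toMulEquiv.isDomain _

/-- Regularity of polynomial rings is the source of all nonsingularity below. -/
instance : IsRegularRing (polyFunctions V) :=
  IsRegularRing.of_ringEquiv (polyEquiv (Module.finBasis ℂ V)).toRingEquiv

instance : Algebra.FiniteType ℂ (polyFunctions V) :=
  Algebra.FiniteType.equiv inferInstance (polyEquiv (Module.finBasis ℂ V))

theorem polyFunctions_mul_eq_zero {f g : V → ℂ} (hf : f ∈ polyFunctions V)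
    (hg : g ∈ polyFunctions V) (h : f * g = 0) : f = 0 ∨ g = 0 := by
  have : (⟨f, hf⟩ : polyFunctions V) * ⟨g, hg⟩ = 0 := Subtype.ext h
  rcases mul_eq_zero.1 this with h | h
  · exact Or.inl (congrArg Subtype.val h)
  · exact Or.inr (congrArg Subtype.val h)

/-- Otherwise the product of two nonzero polynomials would vanish. This is the irreducibility of
affine space in elementary form. -/
theorem exists_ne_zero_ne_zero {f g : V → ℂ} (hf : f ∈ polyFunctions V)
    (hg : g ∈ polyFunctions V) (hf' : f ≠ 0) (hg' : g ≠ 0) : ∃ v, f v ≠ 0 ∧ g v ≠ 0 := by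
  by_contra! h
  rcases polyFunctions_mul_eq_zero hf hg (funext fun v => by
    by_cases h0 : f v = 0
    · simp [h0]
    · simp [h v h0]) with h0 | h0
  · exact hf' h0
  · exact hg' h0

end PolynomialFunctions

/-! ### Affine space: Zariski topology, local rings, closed subvarieties -/

namespace affineSpace

open FunctionSpace

variable {V W : Type} [AddCommGroup V] [Module ℂ V] [FiniteDimensional ℂ V]
  [AddCommGroup W] [Module ℂ W] [FiniteDimensional ℂ W]

theorem isOpen_basic {P : V → ℂ} (hP : P ∈ polyFunctions V) :
    IsOpen[(affineSpace V).top] {x | P x ≠ 0} :=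
  TopologicalSpace.isOpen_generateFrom_of_mem ⟨(), P, hP, by ext; simp; rfl⟩

theorem isTopologicalBasis : @TopologicalSpace.IsTopologicalBasis V (affineSpace V).top
    {O | ∃ P ∈ polyFunctions V, O = {x | P x ≠ 0}} := by
  let : TopologicalSpace V := (affineSpace V).top
  refine ⟨?_, ?_, ?_⟩
  · rintro _ ⟨P, hP, rfl⟩ _ ⟨Q, hQ, rfl⟩ x hx
    exact ⟨_, ⟨P * Q, mul_mem hP hQ, rfl⟩, mul_ne_zero hx.1 hx.2,
      fun y hy => ⟨left_ne_zero_of_mul hy, right_ne_zero_of_mul hy⟩⟩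
  · exact Set.eq_univ_of_forall fun x => ⟨_, ⟨1, one_mem _, rfl⟩, one_ne_zero⟩
  · change fractionTopology _ _ = _
    unfold fractionTopology
    congr 1
    ext O
    simp

theorem exists_basic_subset {O : Set V} (hO : IsOpen[(affineSpace V).top] O) {x : V} (hx : x ∈ O) :
    ∃ P ∈ polyFunctions V, P x ≠ 0 ∧ ∀ y, P y ≠ 0 → y ∈ O := by
  obtain ⟨_, ⟨P, hP, rfl⟩, h1, h2⟩ :=
    (@TopologicalSpace.IsTopologicalBasis.exists_subset_of_mem_open V (affineSpace V).top _
      isTopologicalBasis x O hx hO)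
  exact ⟨P, hP, h1, h2⟩

theorem isRegularAt_iff {f : V → ℂ} {x : V} : (affineSpace V).IsRegularAt f x ↔
    ∃ P ∈ polyFunctions V, ∃ Q ∈ polyFunctions V, Q x ≠ 0 ∧
      f =ᶠ[@nhds V (affineSpace V).top x] P / Q :=
  ⟨fun ⟨_, _, h⟩ => h, fun h => ⟨(), trivial, h⟩⟩

theorem isRegularAt_poly {P : V → ℂ} (hP : P ∈ polyFunctions V) (x : V) :
    (affineSpace V).IsRegularAt P x :=
  isRegularAt_iff.2 ⟨P, hP, 1, one_mem _, one_ne_zero,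
    Eventually.of_forall fun _ => (div_one _).symm⟩

/-- Linear forms generate the polynomial functions, whose nonvanishing loci form a basis and whose
fractions are locally all regular functions. So linear coordinates suffice as a test, and morphisms
into matrix spaces can be checked entry by entry. -/
theorem isMorphism_iff {X : FunctionSpace} {φ : X.carrier → V} :
    IsMorphism X (affineSpace V) φ ↔
      ∀ (ℓ : Module.Dual ℂ V) (x : X.carrier), X.IsRegularAt (fun x => ℓ (φ x)) x := by
  refine ⟨fun h ℓ x =>
    h.comp_regular x ℓ (isRegularAt_poly (dual_mem_polyFunctions ℓ) _), fun h => ?_⟩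
  have key : ∀ P ∈ polyFunctions V, ∀ x, X.IsRegularAt (P ∘ φ) x := by
    intro P hP x
    rw [← mem_regularAt]
    induction hP using Algebra.adjoin_induction with
    | mem f hf => obtain ⟨ℓ, rfl⟩ := hf; exact h ℓ x
    | algebraMap r => exact (X.regularAt x).algebraMap_mem r
    | add f g _ _ hf hg => exact add_mem hf hg
    | mul f g _ _ hf hg => exact mul_mem hf hg
  have hc : Continuous[X.top, (affineSpace V).top] φ := by
    let : TopologicalSpace V := (affineSpace V).top
    refine (isTopologicalBasis (V := V)).continuous_iff.2 ?_
    rintro _ ⟨P, hP, rfl⟩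
    have := isOpen_ne_zero isOpen_univ (fun x _ => key P hP x)
    simpa using this
  refine ⟨hc, fun x f hf => ?_⟩
  obtain ⟨P, hP, Q, hQ, hne, hf⟩ := (isRegularAt_iff (V := V)).1 hf
  refine X.congr ((hc.tendsto x).eventually hf.symm) ?_
  change X.IsRegularAt ((P / Q) ∘ φ) x
  rw [div_eq_mul_inv]
  exact X.mul (key P hP x) (X.inv (key Q hQ x) hne)

theorem isMorphism_of_linearMap (f : V →ₗ[ℂ] W) : IsMorphism (affineSpace V) (affineSpace W) f :=
  isMorphism_iff.2 fun ℓ x => isRegularAt_poly (dual_mem_polyFunctions (ℓ.comp f)) x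

/-- Linear isomorphisms are isomorphisms of affine spaces. -/
def isoOfLinearEquiv (e : V ≃ₗ[ℂ] W) : Iso (affineSpace V) (affineSpace W) where
  toEquiv := e.toEquiv
  isMorphism := isMorphism_of_linearMap e.toLinearMap
  isMorphism_inv := isMorphism_of_linearMap e.symm.toLinearMap

instance irreducibleSpace : IrreducibleSpace (affineSpace V).carrier where
  toNonempty := ⟨(0 : V)⟩
  isPreirreducible_univ := by
    rintro O O' hO hO' ⟨(x : V), -, hx⟩ ⟨(y : V), -, hy⟩
    obtain ⟨P, hP, hPx, hPO⟩ := exists_basic_subset (V := V) hO hx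
    obtain ⟨Q, hQ, hQx, hQO⟩ := exists_basic_subset (V := V) hO' hy
    obtain ⟨v, h1, h2⟩ := exists_ne_zero_ne_zero hP hQ
      (fun h => hPx (congrFun h x)) (fun h => hQx (congrFun h y))
    exact ⟨v, trivial, hPO v h1, hQO v h2⟩

/-- The ideal of polynomial functions vanishing on a set. -/
def vanishing (S : Set V) : Ideal (polyFunctions V) where
  carrier := {f | ∀ x ∈ S, f.1 x = 0}
  zero_mem' _ _ := rfl
  add_mem' {f g} hf hg x hx := by
    change f.1 x + g.1 x = 0
    rw [hf x hx, hg x hx, add_zero]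
  smul_mem' f g hg x hx := by
    change f.1 x * g.1 x = 0
    rw [hg x hx, mul_zero]

theorem mem_vanishing {S : Set V} {f : polyFunctions V} :
    f ∈ vanishing S ↔ ∀ x ∈ S, f.1 x = 0 := Iff.rfl

theorem mem_of_vanishing {S : Set V} (hS : IsClosed[(affineSpace V).top] S) {x : V}
    (h : ∀ f ∈ vanishing S, f.1 x = 0) : x ∈ S := by
  by_contra hx
  obtain ⟨P, hP, h1, h2⟩ := exists_basic_subset (V := V) hS.isOpen_compl (x := x) hx
  exact h1 (h ⟨P, hP⟩ fun y hy => by_contra fun h0 => h2 y h0 hy)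

theorem isClosed_of_vanishing {S : Set V}
    (h : ∀ x, (∀ f ∈ vanishing S, f.1 x = 0) → x ∈ S) : IsClosed[(affineSpace V).top] S := by
  let : TopologicalSpace V := (affineSpace V).top
  refine ⟨isOpen_iff_mem_nhds.2 fun x hx => ?_⟩
  have : ¬ ∀ f ∈ vanishing S, f.1 x = 0 := fun h0 => hx (h x h0)
  push Not at this
  obtain ⟨f, hf, hne⟩ := this
  refine Filter.mem_of_superset ((isOpen_basic f.2).mem_nhds hne) fun y hy hyS => hy (hf y hyS)

theorem vanishing_strictAnti {S T : Set V} (hS : IsClosed[(affineSpace V).top] S) (h : S < T) :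
    vanishing T < vanishing S := by
  refine lt_of_le_not_ge (fun f hf x hx => hf x (h.le hx)) fun hle => h.not_ge fun x hx => ?_
  exact mem_of_vanishing hS fun f hf => hle hf x hx

/-- A strictly ascending chain of open sets yields a strictly ascending chain of vanishing ideals of
the complements, in a noetherian ring. -/
instance noetherianSpace : TopologicalSpace.NoetherianSpace (affineSpace V).carrier := by
  refine StrictMono.wellFoundedGT (β := Ideal (polyFunctions V))
    (f := fun U : TopologicalSpace.Opens (affineSpace V).carrier =>
      vanishing (V := V) (U.1)ᶜ) fun U U' h => ?_
  refine vanishing_strictAnti (V := V) U'.2.isClosed_compl ?_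
  exact compl_lt_compl_iff_lt.2 h

/-- The local ring at `x` is the localization of the polynomial ring at the ideal of functions
vanishing at `x`. -/
theorem isNonsingular : (affineSpace V).IsNonsingular := by
  intro (x : V)
  let ev : polyFunctions V →+* ℂ := (Pi.evalRingHom (fun _ : V => ℂ) x).comp
    (polyFunctions V).val.toRingHom
  let m : Ideal (polyFunctions V) := RingHom.ker ev
  have hm : m.IsPrime := RingHom.ker_isPrime ev
  have hmem : ∀ f : polyFunctions V, f ∈ m.primeCompl ↔ f.1 x ≠ 0 := fun f => Iff.rfl
  let φ : polyFunctions V →+* (affineSpace V).localRing x :=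
    { toFun := fun f => ⟨((f.1 : V → ℂ) : Germ (@nhds V (affineSpace V).top x) ℂ), f.1,
        isRegularAt_poly f.2 x, rfl⟩
      map_one' := rfl
      map_zero' := rfl
      map_mul' := fun _ _ => rfl
      map_add' := fun _ _ => rfl }
  let := φ.toAlgebra
  have hloc : IsLocalization.AtPrime ((affineSpace V).localRing x) m := by
    refine (isLocalization_iff _ _).2 ⟨?_, ?_, ?_⟩
    · rintro ⟨f, hf⟩
      have hr := (affineSpace V).inv (isRegularAt_poly f.2 x) hf
      refine IsUnit.of_mul_eq_one ⟨_, _, hr, rfl⟩ (Subtype.ext ?_)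
      refine Germ.coe_eq.2 ?_
      have := (affineSpace V).eventually_ne (isRegularAt_poly f.2 x) hf
      exact this.mono fun y hy => mul_inv_cancel₀ hy
    · rintro ⟨_, f, hf, rfl⟩
      obtain ⟨P, hP, Q, hQ, hne, hf⟩ := (isRegularAt_iff (V := V)).1 hf
      refine ⟨(⟨P, hP⟩, ⟨⟨Q, hQ⟩, hne⟩), Subtype.ext (Germ.coe_eq.2 ?_)⟩
      have := (affineSpace V).eventually_ne (isRegularAt_poly hQ x) hne
      filter_upwards [hf, this] with y h1 h2
      change f y * Q y = P y
      rw [h1]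
      exact div_mul_cancel₀ _ h2
    · intro f g h
      -- No multiplier is needed: `f - g` vanishes wherever some `P` with `P x ≠ 0` does not, so `P
      -- * (f - g) = 0` in a domain.
      refine ⟨1, ?_⟩
      have h1 : ∀ᶠ y in @nhds V (affineSpace V).top x, f.1 y = g.1 y :=
        Germ.coe_eq.1 (congrArg Subtype.val h)
      obtain ⟨O, hO, hOo, hx⟩ :=
        (@eventually_nhds_iff V (affineSpace V).top x _).1 h1
      obtain ⟨P, hP, hPx, hPO⟩ := exists_basic_subset (V := V) hOo hx
      congr 1
      refine Subtype.ext (sub_eq_zero.1 ?_)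
      refine (polyFunctions_mul_eq_zero hP (sub_mem f.2 g.2) (funext fun y => ?_)).resolve_left
        fun h => hPx (congrFun h x)
      by_cases h0 : P y = 0
      · simp [h0]
      · simp [hO y (hPO y h0)]
  have := IsRegularRing.isRegularLocalRing_localization m
  exact IsRegularLocalRing.of_ringEquiv (R := Localization.AtPrime m)
    (IsLocalization.algEquiv m.primeCompl (Localization.AtPrime m)
      ((affineSpace V).localRing x)).toRingEquiv

theorem isAffine_subspace {S : Set V} (hS : IsClosed[(affineSpace V).top] S) :
    ((affineSpace V).subspace S).IsAffine := by
  let e := (Module.finBasis ℂ V).equivFun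
  let i := isoOfLinearEquiv e
  refine ⟨_, i.invFun ⁻¹' S, hS.preimage i.isMorphism_inv.continuous, ⟨?_⟩⟩
  exact
    { toFun := fun x => ⟨i.toFun x.1, by
        change i.invFun (i.toFun x.1) ∈ S
        rw [show i.invFun (i.toFun x.1) = x.1 from i.left_inv _]
        exact x.2⟩
      invFun := fun y => ⟨i.invFun y.1, y.2⟩
      left_inv := fun x => Subtype.ext (i.left_inv _)
      right_inv := fun x => Subtype.ext (i.right_inv _)
      isMorphism := isMorphism_to_subspace.2 (i.isMorphism.comp (isMorphism_val (X := affineSpace V) S))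
      isMorphism_inv := isMorphism_to_subspace.2 (i.isMorphism_inv.comp (isMorphism_val _)) }

theorem isAffine : (affineSpace V).IsAffine :=
  (isAffine_subspace (V := V) (S := Set.univ) isClosed_univ).of_iso (isoSubspaceUniv _).symm

theorem isVariety_subspace {S : Set V} (hS : IsClosed[(affineSpace V).top] S) :
    ((affineSpace V).subspace S).IsVariety where
  affine_cover := ⟨{Set.univ}, Set.finite_singleton _, by simp, by
    rintro _ rfl
    exact ⟨isOpen_univ, (isAffine_subspace hS).of_iso (isoSubspaceUniv _)⟩⟩
  separated := by
    refine isClosed_diagonal_of_tensorFunctions fun (x : S) (y : S) hxy => ?_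
    have hne : (x.1 : V) - (y.1 : V) ≠ 0 := sub_ne_zero.2 fun h => hxy (Subtype.ext h)
    obtain ⟨φ, hφ⟩ : ∃ φ : Module.Dual ℂ V, φ ((x.1 : V) - (y.1 : V)) ≠ 0 := by
      by_contra! h
      exact hne ((Module.forall_dual_apply_eq_zero_iff ℂ _).1 h)
    have hreg : ((affineSpace V).subspace S).IsRegularOn (fun z : S => φ z.1) Set.univ := fun z _ =>
      (isMorphism_val (X := affineSpace V) S).comp_regular z φ
        (isRegularAt_poly (dual_mem_polyFunctions φ) _)
    refine ⟨Set.univ, Set.univ, isOpen_univ, isOpen_univ, trivial, trivial,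
      ((fun z : S => φ z.1) ∘ (Prod.fst : S × S → S) -
        (fun z : S => φ z.1) ∘ (Prod.snd : S × S → S) : S × S → ℂ),
      sub_mem (Algebra.subset_adjoin (Or.inl ⟨_, hreg, rfl⟩))
        (Algebra.subset_adjoin (Or.inr ⟨_, hreg, rfl⟩)), ?_, fun z _ => sub_self _⟩
    exact fun h => hφ ((map_sub φ _ _).trans h)

end affineSpace

/-! ### Krylov matrices and cyclic vectors -/

section StrictlyUpper

variable {n : ℕ}

/-- Strictly upper triangular matrices. -/
def Matrix.IsStrictlyUpper (v : Matrix (Fin n) (Fin n) ℂ) : Prop :=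
  ∀ i j, j ≤ i → v i j = 0

/-- Row `i` of `v x` only involves the entries `x j` with `j > i`, so every application of `v` kills
at least one more row from the bottom. -/
theorem Matrix.IsStrictlyUpper.pow_mulVec {v : Matrix (Fin n) (Fin n) ℂ} (hv : v.IsStrictlyUpper)
    (w : Fin n → ℂ) (a : ℕ) (i : Fin n) (hi : n ≤ i.val + a) : ((v ^ a).mulVec w) i = 0 := by
  induction a generalizing i with
  | zero => omega
  | succ a ih =>
    rw [pow_succ', ← Matrix.mulVec_mulVec]
    change ∑ j, v i j * ((v ^ a).mulVec w) j = 0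
    refine Finset.sum_eq_zero fun j _ => ?_
    by_cases hj : j ≤ i
    · rw [hv i j hj, zero_mul]
    · rw [ih j (by have : i.val < j.val := not_le.1 hj; omega), mul_zero]

/-- The matrix with columns `v ^ (n - 1) w, …, v w, w`. -/
def krylovMatrix (v : Matrix (Fin n) (Fin n) ℂ) (w : Fin n → ℂ) : Matrix (Fin n) (Fin n) ℂ :=
  Matrix.of fun i j => ((v ^ (n - 1 - j.val)).mulVec w) i

theorem krylovMatrix_upper {v : Matrix (Fin n) (Fin n) ℂ} (hv : v.IsStrictlyUpper)
    (w : Fin n → ℂ) (i j : Fin n) (hij : j < i) : krylovMatrix v w i j = 0 :=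
  hv.pow_mulVec w _ i (by have : j.val < i.val := hij; omega)

/-- Column by column, `(g v g⁻¹) ^ a (g w) = g (v ^ a w)`. This equivariance is what recovers `g`
from the conjugated matrix. -/
theorem krylovMatrix_conj (g : Matrix.GeneralLinearGroup (Fin n) ℂ)
    (v : Matrix (Fin n) (Fin n) ℂ) (w : Fin n → ℂ) :
    krylovMatrix (g.val * v * g⁻¹.val) (g.val.mulVec w) = g.val * krylovMatrix v w := by
  ext i j
  have h : (g.val * v * g⁻¹.val) ^ (n - 1 - j.val) = g.val * v ^ (n - 1 - j.val) * g⁻¹.val :=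
    Units.conj_pow g v _
  change ((g.val * v * g⁻¹.val) ^ (n - 1 - j.val)).mulVec (g.val.mulVec w) i =
    g.val.mulVec ((v ^ (n - 1 - j.val)).mulVec w) i
  rw [h, Matrix.mulVec_mulVec, Matrix.mulVec_mulVec, Matrix.mul_assoc _ g⁻¹.val, ← Units.val_mul,
    inv_mul_cancel, Units.val_one, Matrix.mul_one]

/-- If `v` is strictly upper triangular with a cyclic vector and `h v h⁻¹` is strictly upper
triangular too, then `h` is upper triangular. -/
theorem mem_upperBorel_of_conj {h : Matrix.GeneralLinearGroup (Fin n) ℂ}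
    {v : Matrix (Fin n) (Fin n) ℂ} (hv : v.IsStrictlyUpper)
    (hv' : (h.val * v * h⁻¹.val).IsStrictlyUpper) {w : Fin n → ℂ}
    (hw : (krylovMatrix v w).det ≠ 0) : h ∈ upperBorel n := by
  let k := Matrix.GeneralLinearGroup.mkOfDetNeZero _ hw
  have hk : k ∈ upperBorel n := fun i j hij => krylovMatrix_upper hv w i j hij
  -- `h k` is the Krylov matrix of `h v h⁻¹` and `h w`, hence triangular as well, and `h = (h k)
  -- k⁻¹`.
  have hhk : h * k ∈ upperBorel n := fun i j hij => by
    have : (h * k).val = krylovMatrix (h.val * v * h⁻¹.val) (h.val.mulVec w) := by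
      rw [krylovMatrix_conj]; rfl
    rw [this]
    exact krylovMatrix_upper hv' _ i j hij
  simpa using (upperBorel n).mul_mem hhk ((upperBorel n).inv_mem hk)

/-- The nilpotent Jordan block. -/
def jordanBlock (n : ℕ) : Matrix (Fin n) (Fin n) ℂ :=
  Matrix.of fun i j => if i.val + 1 = j.val then 1 else 0

theorem jordanBlock_isStrictlyUpper : (jordanBlock n).IsStrictlyUpper := by
  intro i j hij
  have : j.val ≤ i.val := hij
  simp only [jordanBlock, Matrix.of_apply]
  rw [if_neg (by omega)]

/-- The last basis vector is cyclic: each application of the block lowers its index by one, and the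
decreasing order of the powers in the columns makes the Krylov matrix the identity. -/
theorem exists_det_krylovMatrix_jordanBlock :
    ∃ w, (krylovMatrix (jordanBlock n) w).det ≠ 0 := by
  cases n with
  | zero => exact ⟨0, by simp⟩
  | succ m =>
    have key : ∀ a (ha : a ≤ m), (jordanBlock (m + 1) ^ a).mulVec (Pi.single (Fin.last m) 1) =
        Pi.single (⟨m - a, by omega⟩ : Fin (m + 1)) 1 := by
      intro a ha
      induction a with
      | zero => rw [pow_zero, Matrix.one_mulVec]; rfl
      | succ a ih =>
        rw [pow_succ', ← Matrix.mulVec_mulVec, ih (by omega), Matrix.mulVec_single_one]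
        ext i
        simp only [jordanBlock, Matrix.col_apply, Matrix.of_apply, Pi.single_apply, Fin.ext_iff]
        congr 1
        simp only [eq_iff_iff]
        omega
    refine ⟨Pi.single (Fin.last m) 1, ?_⟩
    have : krylovMatrix (jordanBlock (m + 1)) (Pi.single (Fin.last m) 1) = 1 := by
      ext i j
      simp only [krylovMatrix, Matrix.of_apply]
      rw [key _ (by omega), Matrix.one_apply, Pi.single_apply]
      congr 1
      simp only [eq_iff_iff, Fin.ext_iff]
      omega
    rw [this]
    simp

end StrictlyUpper

/-! ### The big cell: LU factorisation by leading minors -/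

section LowerUpper

variable {n : ℕ}

/-- Lower triangular matrices with diagonal entries `1`. -/
def Matrix.IsLowerUnipotent (y : Matrix (Fin n) (Fin n) ℂ) : Prop :=
  ∀ i j, i ≤ j → y i j = (1 : Matrix (Fin n) (Fin n) ℂ) i j

/-- The rows of `g` up to the index `j`, completed by rows of the identity matrix. -/
def Matrix.leadingRows (g : Matrix (Fin n) (Fin n) ℂ) (j : Fin n) : Matrix (Fin n) (Fin n) ℂ :=
  Matrix.of fun i l => if i ≤ j then g i l else (1 : Matrix (Fin n) (Fin n) ℂ) i l

/-- The upper triangular matrix `c` such that `g c` is lower unipotent. -/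
noncomputable def Matrix.upperFactor (g : Matrix (Fin n) (Fin n) ℂ) : Matrix (Fin n) (Fin n) ℂ :=
  Matrix.of fun i j => (g.leadingRows j)⁻¹ i j

theorem Matrix.leadingRows_mulVec (g : Matrix (Fin n) (Fin n) ℂ) (j : Fin n) (x : Fin n → ℂ)
    (i : Fin n) : (g.leadingRows j).mulVec x i = if i ≤ j then g.mulVec x i else x i := by
  by_cases h : i ≤ j
  · simp [Matrix.mulVec, dotProduct, Matrix.leadingRows, h]
  · simp only [Matrix.mulVec, dotProduct, Matrix.leadingRows, Matrix.of_apply, if_neg h]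
    simp [Matrix.one_apply]

/-- The two conditions on column `j` of the factor `c`, namely `(g c) i j = δ_ij` for `i ≤ j` and `c
i j = 0` for `i > j`, form one linear system with matrix `g.leadingRows j`. Its determinant is the
leading principal minor of `g` of size `j + 1`. -/
theorem Matrix.leadingRows_mulVec_upperFactor {g : Matrix (Fin n) (Fin n) ℂ} {j : Fin n}
    (h : (g.leadingRows j).det ≠ 0) :
    (g.leadingRows j).mulVec (fun i => g.upperFactor i j) = Pi.single j 1 := by
  have h1 : (fun i => g.upperFactor i j) = ((g.leadingRows j)⁻¹).mulVec (Pi.single j 1) := by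
    rw [Matrix.mulVec_single_one]; rfl
  rw [h1, Matrix.mulVec_mulVec, Matrix.mul_nonsing_inv _ (isUnit_iff_ne_zero.2 h),
    Matrix.one_mulVec]

theorem Matrix.upperFactor_upper {g : Matrix (Fin n) (Fin n) ℂ}
    (h : ∀ j, (g.leadingRows j).det ≠ 0) (i j : Fin n) (hij : j < i) : g.upperFactor i j = 0 := by
  have := congrFun (Matrix.leadingRows_mulVec_upperFactor (h j)) i
  rwa [Matrix.leadingRows_mulVec, if_neg hij.not_ge, Pi.single_eq_of_ne hij.ne'] at this

theorem Matrix.mul_upperFactor {g : Matrix (Fin n) (Fin n) ℂ}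
    (h : ∀ j, (g.leadingRows j).det ≠ 0) : (g * g.upperFactor).IsLowerUnipotent := by
  intro i j hij
  have := congrFun (Matrix.leadingRows_mulVec_upperFactor (h j)) i
  rw [Matrix.leadingRows_mulVec, if_pos hij] at this
  rw [Matrix.one_apply, ← Pi.single_apply]
  exact this

/-- Any upper triangular solution satisfies the same invertible linear systems, column by column.
This uniqueness gives the injectivity of the charts. -/
theorem Matrix.eq_upperFactor {g c : Matrix (Fin n) (Fin n) ℂ}
    (h : ∀ j, (g.leadingRows j).det ≠ 0) (hc : ∀ i j, j < i → c i j = 0)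
    (hgc : (g * c).IsLowerUnipotent) : c = g.upperFactor := by
  ext i j
  refine congrFun (Matrix.mulVec_injective_iff_isUnit.2 ((Matrix.isUnit_iff_isUnit_det _).2
    (isUnit_iff_ne_zero.2 (h j))) (a₁ := fun i => c i j) (a₂ := fun i => g.upperFactor i j) ?_) i
  rw [Matrix.leadingRows_mulVec_upperFactor (h j)]
  ext i
  rw [Matrix.leadingRows_mulVec, Pi.single_apply]
  split_ifs with h1 h2 h2
  · subst h2; simpa using! hgc i i le_rfl
  · simpa [Matrix.one_apply_ne h2] using! hgc i j h1
  · exact absurd h2.le h1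
  · exact hc i j (not_le.1 h1)

/-- Row `i` of `y b` combines only the rows of `b` up to `i`, so replacing the rows of `b` beyond
`j` does no harm. Consequently `y b` and `b` have the same leading minors. -/
theorem Matrix.leadingRows_mul {y b : Matrix (Fin n) (Fin n) ℂ} (hy : y.IsLowerUnipotent)
    (j : Fin n) : (y * b).leadingRows j = y.leadingRows j * b.leadingRows j := by
  ext i l
  by_cases h : i ≤ j
  · simp only [Matrix.leadingRows, Matrix.of_apply, if_pos h, Matrix.mul_apply]
    refine Finset.sum_congr rfl fun m _ => ?_
    by_cases hm : m ≤ i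
    · rw [if_pos (hm.trans h)]
    · have : y i m = 0 := by
        rw [hy i m (not_le.1 hm).le, Matrix.one_apply_ne (not_le.1 hm).ne]
      rw [this, zero_mul, zero_mul]
  · simp only [Matrix.leadingRows, Matrix.of_apply, if_neg h, Matrix.mul_apply]
    rw [Finset.sum_eq_single i]
    · simp [h]
    · intro m _ hm
      rw [Matrix.one_apply_ne hm.symm, zero_mul]
    · simp

theorem Matrix.IsLowerUnipotent.det_eq_one {y : Matrix (Fin n) (Fin n) ℂ}
    (hy : y.IsLowerUnipotent) : y.det = 1 := by
  rw [Matrix.det_of_isLowerTriangular _ fun i j hij => ?_]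
  · exact Finset.prod_eq_one fun i _ => by rw [hy i i le_rfl, Matrix.one_apply_eq]
  · have : i < j := hij
    rw [hy i j this.le, Matrix.one_apply_ne this.ne]

theorem Matrix.IsLowerUnipotent.det_leadingRows {y : Matrix (Fin n) (Fin n) ℂ}
    (hy : y.IsLowerUnipotent) (j : Fin n) : (y.leadingRows j).det = 1 := by
  refine Matrix.IsLowerUnipotent.det_eq_one fun i l hil => ?_
  simp only [Matrix.leadingRows, Matrix.of_apply]
  split_ifs
  · exact hy i l hil
  · rfl

theorem diag_ne_zero_of_mem_upperBorel {b : Matrix.GeneralLinearGroup (Fin n) ℂ}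
    (hb : b ∈ upperBorel n) (i : Fin n) : b.val i i ≠ 0 := by
  have h : b.val.det ≠ 0 := isUnit_iff_ne_zero.1 ((Matrix.isUnit_iff_isUnit_det _).1 b.isUnit)
  rw [Matrix.det_of_isUpperTriangular fun i j hij => hb i j hij] at h
  exact Finset.prod_ne_zero_iff.1 h i (Finset.mem_univ i)

theorem det_leadingRows_of_mem_upperBorel {b : Matrix.GeneralLinearGroup (Fin n) ℂ}
    (hb : b ∈ upperBorel n) (j : Fin n) : (b.val.leadingRows j).det ≠ 0 := by
  rw [Matrix.det_of_isUpperTriangular fun i l hil => ?_]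
  · refine Finset.prod_ne_zero_iff.2 fun i _ => ?_
    simp only [Matrix.leadingRows, Matrix.of_apply]
    split_ifs
    · exact diag_ne_zero_of_mem_upperBorel hb i
    · simp
  · have hil : l < i := hil
    simp only [Matrix.leadingRows, Matrix.of_apply]
    split_ifs
    · exact hb i l hil
    · exact Matrix.one_apply_ne hil.ne'

end LowerUpper

/-! ### Iwasawa decomposition over a valuation ring -/

section Iwasawa

variable {K : Type*} [Field K] {n : ℕ}

/-- Column reduction, by induction on the number `s` of treated columns. The next column is divided
by its entry of largest valuation, which makes it integral with a pivot `1`, and the pivot row is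
then cleared to the right. Earlier pivot rows already vanish in the columns involved, so they are
not disturbed. -/
theorem exists_upper_pivots (O : ValuationSubring K) {g : Matrix (Fin n) (Fin n) K}
    (hg : g.det ≠ 0) (s : ℕ) (hs : s ≤ n) :
    ∃ b : Matrix (Fin n) (Fin n) K, b.IsUpperTriangular ∧ (g * b).det ≠ 0 ∧
      ∃ r : Fin n → Fin n, ∀ j : Fin n, j.val < s → (∀ i, (g * b) i j ∈ O) ∧
        (g * b) (r j) j = 1 ∧ ∀ l, j < l → (g * b) (r j) l = 0 := by
  induction s with
  | zero => exact ⟨1, Matrix.blockTriangular_one, by simpa using hg, id, fun j hj => absurd hj (by simp)⟩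
  | succ s ih =>
    obtain ⟨b, hb, hdet, r, hr⟩ := ih (by omega)
    set g' := g * b with hg'
    let t : Fin n := ⟨s, hs⟩
    have : Nonempty (Fin n) := ⟨t⟩
    obtain ⟨i₀, hi₀⟩ := Finite.exists_max fun i => O.valuation (g' i t)
    have hx : g' i₀ t ≠ 0 := by
      intro h0
      refine hdet (Matrix.det_eq_zero_of_column_eq_zero t fun i => ?_)
      have := hi₀ i
      rwa [h0, map_zero, le_zero_iff, map_eq_zero] at this
    have hO : ∀ i, g' i t * (g' i₀ t)⁻¹ ∈ O := fun i => by
      rw [← O.valuation_le_one_iff, map_mul, map_inv₀]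
      exact mul_inv_le_one_of_le₀ (hi₀ i) zero_le
    -- Row `t` of the elementary matrix `b'`: earlier columns stay, column `t` is divided by the
    -- pivot, and a multiple of column `t` is subtracted from each later one.
    let c : Fin n → K := fun j =>
      if j < t then 0 else if j = t then (g' i₀ t)⁻¹ else -((g' i₀ t)⁻¹ * g' i₀ j)
    let b' : Matrix (Fin n) (Fin n) K := Matrix.updateRow 1 t c
    have hb' : b'.IsUpperTriangular := by
      intro i j (hij : j < i)
      by_cases hi : i = t
      · subst hi
        simp [b', c, hij]
      · simp [b', hi, Matrix.one_apply_ne hij.ne']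
    have hmul : ∀ i j, (g' * b') i j = g' i t * c j + if j = t then 0 else g' i j := by
      intro i j
      rw [Matrix.mul_apply, ← Finset.add_sum_erase _ _ (Finset.mem_univ t)]
      congr 1
      · simp [b']
      · have : ∀ l ∈ Finset.univ.erase t, g' i l * b' l j =
            g' i l * (1 : Matrix (Fin n) (Fin n) K) l j := fun l hl => by
          simp [b', Finset.ne_of_mem_erase hl]
        rw [Finset.sum_congr rfl this]
        split_ifs with h
        · subst h
          exact Finset.sum_eq_zero fun l hl => by
            rw [Matrix.one_apply_ne (Finset.ne_of_mem_erase hl), mul_zero]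
        · rw [Finset.sum_eq_single j]
          · simp
          · intro l _ hl
            rw [Matrix.one_apply_ne hl, mul_zero]
          · simp [h]
    refine ⟨b * b', hb.mul hb', ?_, fun j => if j = t then i₀ else r j, ?_⟩
    · rw [← Matrix.mul_assoc, ← hg', Matrix.det_mul]
      refine mul_ne_zero hdet ?_
      rw [Matrix.det_of_isUpperTriangular hb']
      refine Finset.prod_ne_zero_iff.2 fun i _ => ?_
      by_cases hi : i = t
      · subst hi
        simp [b', c, hx]
      · simp [b', hi]
    · rw [← Matrix.mul_assoc, ← hg']
      intro j hj
      rcases Nat.lt_succ_iff_lt_or_eq.1 hj with hj | hj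
      · have hjt : j < t := hj
        obtain ⟨h1, h2, h3⟩ := hr j hj
        simp only [hmul, if_neg hjt.ne, show c j = 0 by simp [c, hjt], mul_zero, zero_add]
        refine ⟨h1, h2, fun l hl => ?_⟩
        rw [h3 t hjt, h3 l hl]
        simp
      · have hjt : j = t := Fin.ext hj
        subst hjt
        simp only [hmul, if_pos]
        have hc : c t = (g' i₀ t)⁻¹ := by simp [c]
        refine ⟨fun i => ?_, ?_, fun l hl => ?_⟩
        · rw [hc, add_zero]; exact hO i
        · rw [hc, add_zero, mul_inv_cancel₀ hx]
        · rw [if_neg hl.ne', show c l = -((g' i₀ t)⁻¹ * g' i₀ l) by simp [c, hl.not_gt, hl.ne']]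
          rw [mul_neg, mul_inv_cancel_left₀ hx, neg_add_cancel]

/-- The Iwasawa decomposition over a valuation ring: `GL_n(K) = GL_n(O) B(K)`. -/
theorem exists_upper_mul_integral (O : ValuationSubring K) {g : Matrix (Fin n) (Fin n) K}
    (hg : g.det ≠ 0) : ∃ b : Matrix (Fin n) (Fin n) K, b.IsUpperTriangular ∧
      ∃ k : Matrix (Fin n) (Fin n) O, k.map (↑) = g * b ∧ IsUnit k.det := by
  obtain ⟨b, hb, hdet, r, hr⟩ := exists_upper_pivots O hg n le_rfl
  refine ⟨b, hb, Matrix.of fun i j => ⟨(g * b) i j, (hr j j.2).1 i⟩, rfl, ?_⟩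
  have hinj : Function.Injective r := by
    -- If two columns shared a pivot row, the pivot `1` of the later one would be an entry cleared
    -- by the earlier one.
    have key : ∀ i j, i < j → r i ≠ r j := fun i j hij h => by
      have h1 := (hr i i.2).2.2 j hij
      rw [h, (hr j j.2).2.1] at h1
      exact one_ne_zero h1
    intro i j h
    rcases lt_trichotomy i j with h1 | h1 | h1
    · exact absurd h (key _ _ h1)
    · exact h1
    · exact absurd h.symm (key _ _ h1)
  let σ : Equiv.Perm (Fin n) := Equiv.ofBijective r (Finite.injective_iff_bijective.1 hinj)
  set k : Matrix (Fin n) (Fin n) O := Matrix.of fun i j => ⟨(g * b) i j, (hr j j.2).1 i⟩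
  -- With its rows listed in the order of the pivots, `k` is lower triangular with ones on the
  -- diagonal, so `det k` is a sign.
  have h1 : (k.submatrix σ id).det = 1 := by
    rw [Matrix.det_of_isLowerTriangular _ fun i j hij => ?_]
    · exact Finset.prod_eq_one fun i _ => Subtype.ext (hr i i.2).2.1
    · exact Subtype.ext ((hr i i.2).2.2 j hij)
  rw [Matrix.det_permute] at h1
  exact IsUnit.of_mul_eq_one _ ((mul_comm _ _).trans h1)

end Iwasawa

/-! ### Completeness of the flag variety by valuations -/

section Completeness

/-- The point of affine space with a matrix and a vector as coordinates. -/
def matrixPoint {R : Type*} {n m : ℕ} (g : Matrix (Fin n) (Fin n) R) (z : Fin m → R) :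
    (Fin n × Fin n) ⊕ Fin m → R :=
  Sum.elim (fun p => g p.1 p.2) z

theorem comp_matrixPoint {R S : Type*} {n m : ℕ} (θ : R → S) (g : Matrix (Fin n) (Fin n) R)
    (z : Fin m → R) : θ ∘ matrixPoint g z = matrixPoint (g.map θ) (θ ∘ z) := by
  ext (p | l) <;> rfl

variable {n m : ℕ}

open MvPolynomial

theorem AlgHom.map_aeval_matrixPoint {A B : Type*} [CommRing A] [CommRing B] [Algebra ℂ A]
    [Algebra ℂ B] (θ : A →ₐ[ℂ] B) (g : Matrix (Fin n) (Fin n) A) (z : Fin m → A)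
    (f : MvPolynomial ((Fin n × Fin n) ⊕ Fin m) ℂ) :
    θ (aeval (matrixPoint g z) f) = aeval (matrixPoint (g.map θ) (θ ∘ z)) f := by
  rw [comp_aeval_apply, ← comp_matrixPoint]
  rfl

/-- The upper triangular matrix with given entries. -/
def upperPart {A : Type*} [Zero A] (t : Fin n × Fin n → A) : Matrix (Fin n) (Fin n) A :=
  Matrix.of fun i j => if i ≤ j then t (i, j) else 0

theorem upperPart_isUpperTriangular {A : Type*} [Zero A] (t : Fin n × Fin n → A) :
    (upperPart t).IsUpperTriangular :=
  fun _ _ hij => if_neg (not_le.2 hij)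

/-- Stability under `B` passes from `S` to points of its closure with values in a field `K`. The
polynomial `f (g t, z)` in the entries of an upper triangular `t` has coefficients that are
polynomials in `(g, z)`. At points of `S` it vanishes for all invertible `t`, hence identically; so
its coefficients vanish on `S` and are killed by `ψ`, and `t = b` may be substituted. -/
theorem aeval_mul_upper_eq_zero {S : Set (Matrix.GeneralLinearGroup (Fin n) ℂ × (Fin m → ℂ))}
    (hB : ∀ g z, ∀ b ∈ upperBorel n, (g, z) ∈ S → (g * b, z) ∈ S)
    {K : Type} [Field K] [Algebra ℂ K] (ψ : MvPolynomial ((Fin n × Fin n) ⊕ Fin m) ℂ →ₐ[ℂ] K)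
    (hψ : ∀ f, (∀ x ∈ S, aeval (matrixPoint x.1.val x.2) f = 0) → ψ f = 0)
    {b : Matrix (Fin n) (Fin n) K} (hb : b.IsUpperTriangular)
    {f : MvPolynomial ((Fin n × Fin n) ⊕ Fin m) ℂ}
    (hf : ∀ x ∈ S, aeval (matrixPoint x.1.val x.2) f = 0) :
    aeval (matrixPoint ((Matrix.of fun i j => ψ (X (Sum.inl (i, j)))) * b)
      (fun l => ψ (X (Sum.inr l)))) f = 0 := by
  let R := MvPolynomial ((Fin n × Fin n) ⊕ Fin m) ℂ
  let f' : MvPolynomial (Fin n × Fin n) R :=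
    aeval (matrixPoint ((Matrix.of fun i j => C (X (Sum.inl (i, j)))) * upperPart X)
      (fun l => C (X (Sum.inr l)))) f
  have key : ∀ {A : Type _} [CommRing A] [Algebra ℂ A] (χ : R →ₐ[ℂ] A) (t : Fin n × Fin n → A),
      eval t (map χ.toRingHom f') = aeval (matrixPoint ((Matrix.of fun i j => χ (X (Sum.inl (i, j))))
        * upperPart t) (fun l => χ (X (Sum.inr l)))) f := by
    intro A _ _ χ t
    let θ : MvPolynomial (Fin n × Fin n) R →ₐ[ℂ] A :=
      ((aeval t : MvPolynomial (Fin n × Fin n) A →ₐ[A] A).restrictScalars ℂ).comp (mapAlgHom χ)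
    have h1 : ∀ p, eval t (map χ.toRingHom p) = θ p := fun p => by simp [θ]
    rw [h1]
    change θ (aeval _ f) = _
    rw [AlgHom.map_aeval_matrixPoint]
    congr 2
    congr 1
    · change Matrix.map _ θ.toRingHom = _
      rw [Matrix.map_mul]
      congr 1
      · ext i j
        simp [θ]
      · ext i j
        simp only [upperPart, Matrix.map_apply, Matrix.of_apply]
        split_ifs <;> simp [θ]
    · ext l
      simp [θ]
  have hvan : ∀ x ∈ S, map (aeval (matrixPoint x.1.val x.2) : R →ₐ[ℂ] ℂ).toRingHom f' = 0 := by
    rintro ⟨g, z⟩ hx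
    -- The factor `det t` takes care of the singular `t`. It can be cancelled afterwards because its
    -- value at the identity is `1`.
    have hprod : map (aeval (matrixPoint g.val z) : R →ₐ[ℂ] ℂ).toRingHom f' *
        (upperPart (X : Fin n × Fin n → MvPolynomial (Fin n × Fin n) ℂ)).det = 0 := by
      refine MvPolynomial.funext fun t => ?_
      rw [map_mul, map_zero, key, RingHom.map_det]
      have hup : (eval t).mapMatrix (upperPart X) = upperPart t := by
        ext i j
        simp only [upperPart, RingHom.mapMatrix_apply, Matrix.map_apply, Matrix.of_apply]
        split_ifs <;> simp
      rw [hup]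
      by_cases hdet : (upperPart t).det = 0
      · rw [hdet, mul_zero]
      · have := hf _ (hB g z (Matrix.GeneralLinearGroup.mkOfDetNeZero _ hdet)
          (fun i j hij => upperPart_isUpperTriangular t hij) hx)
        have hg : (Matrix.of fun i j => aeval (R := ℂ) (matrixPoint g.val z)
            (X (Sum.inl (i, j)))) = g.val := by
          ext i j; simp [matrixPoint]
        have hz : (fun l => aeval (R := ℂ) (matrixPoint g.val z) (X (Sum.inr l))) = z := by
          ext l; simp [matrixPoint]
        rw [hg, hz]
        exact mul_eq_zero_of_left this _
    refine (mul_eq_zero.1 hprod).resolve_right fun h0 => ?_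
    have := congrArg (eval fun p : Fin n × Fin n => (1 : Matrix (Fin n) (Fin n) ℂ) p.1 p.2) h0
    rw [RingHom.map_det, map_zero] at this
    have hup : (eval fun p : Fin n × Fin n => (1 : Matrix (Fin n) (Fin n) ℂ) p.1 p.2).mapMatrix
        (upperPart X) = 1 := by
      ext i j
      simp only [upperPart, RingHom.mapMatrix_apply, Matrix.map_apply, Matrix.of_apply]
      split_ifs with h
      · simp
      · simp [Matrix.one_apply_ne (not_le.1 h).ne']
    rw [hup, Matrix.det_one] at this
    exact one_ne_zero this
  -- Each coefficient of `f'` vanishes on `S`, so `hψ` applies to it.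
  have hzero : map ψ.toRingHom f' = 0 := by
    ext d
    rw [coeff_map, coeff_zero]
    refine hψ _ fun x hx => ?_
    have := congrArg (coeff d) (hvan x hx)
    rwa [coeff_map, coeff_zero] at this
  have := key ψ fun p => b p.1 p.2
  rw [hzero, map_zero] at this
  have hup : upperPart (fun p => b p.1 p.2) = b := by
    ext i j
    simp only [upperPart, Matrix.of_apply]
    split_ifs with h
    · rfl
    · exact (hb (not_le.1 h)).symm
  rw [hup] at this
  exact this.symm

/-- Completeness of the flag variety: a closed subset of `GL_n × ℂᵐ` that is stable under right
multiplication by `B` has closed image in `ℂᵐ`. -/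
theorem exists_mem_of_mem_closure_image
    {S : Set (Matrix.GeneralLinearGroup (Fin n) ℂ × (Fin m → ℂ))}
    (hS : ∀ g z, (∀ f, (∀ x ∈ S, aeval (matrixPoint x.1.val x.2) f = 0) →
      aeval (R := ℂ) (matrixPoint g.val z) f = 0) → (g, z) ∈ S)
    (hB : ∀ g z, ∀ b ∈ upperBorel n, (g, z) ∈ S → (g * b, z) ∈ S) (z₀ : Fin m → ℂ)
    (hz₀ : ∀ a : MvPolynomial (Fin m) ℂ, (∀ x ∈ S, aeval x.2 a = 0) → aeval z₀ a = 0) :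
    ∃ g, (g, z₀) ∈ S := by
  let R := MvPolynomial ((Fin n × Fin n) ⊕ Fin m) ℂ
  let J : Ideal R := ⨅ x ∈ S, RingHom.ker (aeval (matrixPoint x.1.val x.2) : R →ₐ[ℂ] ℂ)
  have hJ : ∀ f, f ∈ J ↔ ∀ x ∈ S, aeval (matrixPoint x.1.val x.2) f = 0 := fun f => by
    simp only [J, Submodule.mem_iInf, RingHom.mem_ker]
  let D : R := (Matrix.of fun i j => (X (Sum.inl (i, j)) : R)).det
  have hD : ∀ {A : Type} [CommRing A] [Algebra ℂ A] (χ : R →ₐ[ℂ] A),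
      χ D = (Matrix.of fun i j => χ (X (Sum.inl (i, j)))).det := fun χ => AlgHom.map_det χ _
  have hDev : ∀ (g : Matrix (Fin n) (Fin n) ℂ) (z : Fin m → ℂ),
      aeval (R := ℂ) (matrixPoint g z) D = g.det := fun g z => by
    rw [hD]
    congr 1
    ext i j
    exact aeval_X _ _
  have hren : ∀ (g : Matrix (Fin n) (Fin n) ℂ) (z : Fin m → ℂ) (a : MvPolynomial (Fin m) ℂ),
      aeval (R := ℂ) (matrixPoint g z) (rename Sum.inr a) = aeval z a := fun g z a => by
    rw [aeval_rename]; rfl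
  -- A prime that contains `J` and avoids `M` is a generic point of an irreducible closed set in the
  -- closure of `S`. At it `g` is invertible, and its image in `ℂᵐ` specialises to `z₀`.
  let M : Submonoid R :=
    { carrier := {f | ∃ (k : ℕ) (a : MvPolynomial (Fin m) ℂ),
        aeval z₀ a ≠ 0 ∧ f = D ^ k * rename Sum.inr a}
      one_mem' := ⟨0, 1, by simp, by simp⟩
      mul_mem' := by
        rintro _ _ ⟨k, a, ha, rfl⟩ ⟨l, b, hb, rfl⟩
        refine ⟨k + l, a * b, by rw [map_mul]; exact mul_ne_zero ha hb, ?_⟩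
        rw [map_mul]
        ring }
  -- `D` is invertible on `S`, so `D ^ k * a ∈ J` forces `a` to vanish on the projection of `S`,
  -- hence at `z₀`.
  have hdisj : Disjoint (J : Set R) M := by
    rw [Set.disjoint_left]
    rintro _ hf ⟨k, a, ha, rfl⟩
    refine ha (hz₀ a fun x hx => ?_)
    have h1 := (hJ _).1 hf x hx
    rw [map_mul, map_pow, hDev, hren] at h1
    exact (mul_eq_zero.1 h1).resolve_left (pow_ne_zero _
      (isUnit_iff_ne_zero.1 ((Matrix.isUnit_iff_isUnit_det _).1 x.1.isUnit)))
  obtain ⟨P, hP, hJP, hPM⟩ := Ideal.exists_le_prime_disjoint J M hdisj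
  rw [Set.disjoint_left] at hPM
  let K := FractionRing (R ⧸ P)
  let ψ : R →ₐ[ℂ] K := (IsScalarTower.toAlgHom ℂ (R ⧸ P) K).comp (Ideal.Quotient.mkₐ ℂ P)
  have hψ : ∀ f, ψ f = 0 ↔ f ∈ P := fun f => by
    rw [← Ideal.Quotient.eq_zero_iff_mem]
    exact (IsFractionRing.injective (R ⧸ P) K).eq_iff' (map_zero _)
  let gK : Matrix (Fin n) (Fin n) K := Matrix.of fun i j => ψ (X (Sum.inl (i, j)))
  have hgK : gK.det ≠ 0 := by
    rw [← hD ψ, Ne, hψ]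
    exact fun h => hPM h ⟨1, 1, by simp, by simp⟩
  let φ : MvPolynomial (Fin m) ℂ →ₐ[ℂ] K := ψ.comp (rename Sum.inr)
  let ev : MvPolynomial (Fin m) ℂ →ₐ[ℂ] ℂ := aeval z₀
  let I : Ideal φ.toRingHom.range := (RingHom.ker ev).map φ.toRingHom.rangeRestrict
  have hI : I ≠ ⊤ := by
    rw [Ideal.ne_top_iff_one]
    intro h1
    obtain ⟨a, ha, h1⟩ := (Ideal.mem_map_iff_of_surjective _
      φ.toRingHom.rangeRestrict_surjective).1 h1
    have h2 : ψ (rename Sum.inr (1 - a)) = 0 := by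
      have h3 : ψ (rename Sum.inr a) = 1 := congrArg Subtype.val h1
      rw [map_sub, map_sub, h3, map_one, map_one, sub_self]
    refine hPM ((hψ _).1 h2) ⟨0, 1 - a, ?_, by simp⟩
    rw [map_sub, map_one, show aeval z₀ a = (0 : ℂ) from ha, sub_zero]
    exact one_ne_zero
  -- A valuation ring of `K` that contains the functions of `z` and in which those vanishing at `z₀`
  -- are nonunits.
  obtain ⟨O, hAO, hnonunits⟩ := Ideal.image_subset_nonunits_valuationSubring I hI
  have hφO : ∀ a, φ a ∈ O := fun a => hAO ⟨a, rfl⟩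
  let ι : ℂ →+* O := (algebraMap ℂ K).codRestrict O.toSubring fun c => by
    have := hφO (algebraMap ℂ _ c)
    rwa [AlgHom.commutes] at this
  let := ι.toAlgebra
  let sub : O →ₐ[ℂ] K := { O.subtype with commutes' := fun c => rfl }
  -- Moving within the `B`-orbit replaces the generic matrix by an integral one with unit
  -- determinant, which can be reduced modulo the maximal ideal.
  obtain ⟨b, hb, k, hk, hkdet⟩ := exists_upper_mul_integral O hgK
  let zO : Fin m → O := fun l => ⟨φ (X l), hφO _⟩
  have hO : ∀ f ∈ J, aeval (matrixPoint k zO) f = 0 := by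
    intro f hf
    have h1 := aeval_mul_upper_eq_zero hB ψ (fun f hf => (hψ f).2 (hJP ((hJ f).2 hf))) hb
      ((hJ f).1 hf)
    have h2 := AlgHom.map_aeval_matrixPoint sub k zO f
    have h3 : k.map sub = gK * b := hk
    have h4 : sub ∘ zO = fun l => ψ (X (Sum.inr l)) := by
      ext l
      change ψ (rename Sum.inr (X l)) = _
      rw [rename_X]
    rw [h3, h4, h1] at h2
    exact Subtype.ext h2
  let κ := IsLocalRing.ResidueField O
  let res : O →ₐ[ℂ] κ := IsScalarTower.toAlgHom ℂ O κ
  have hres : res ∘ zO = algebraMap ℂ κ ∘ z₀ := by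
    ext l
    have h1 : φ (X l - C (z₀ l)) ∈ O.nonunits :=
      hnonunits ⟨_, Ideal.mem_map_of_mem φ.toRingHom.rangeRestrict (x := X l - C (z₀ l))
        (by simp [ev, RingHom.mem_ker]), rfl⟩
    have h2 : zO l - algebraMap ℂ O (z₀ l) ∈ IsLocalRing.maximalIdeal O := by
      rw [map_sub, show φ (C (z₀ l)) = algebraMap ℂ K (z₀ l) from φ.commutes _] at h1
      obtain ⟨_, h⟩ := O.mem_nonunits_iff_exists_mem_maximalIdeal.1 h1
      exact h
    have h3 : res (zO l - algebraMap ℂ O (z₀ l)) = 0 := (IsLocalRing.residue_eq_zero_iff _).2 h2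
    rw [map_sub, AlgHom.commutes, sub_eq_zero] at h3
    exact h3
  let kκ : Matrix (Fin n) (Fin n) κ := k.map res
  have hκ : ∀ f ∈ J, aeval (matrixPoint kκ (algebraMap ℂ κ ∘ z₀)) f = 0 := by
    intro f hf
    rw [← hres, ← AlgHom.map_aeval_matrixPoint, hO f hf, map_zero]
  let sp : R →ₐ[ℂ] MvPolynomial (Fin n × Fin n) ℂ :=
    aeval (matrixPoint (Matrix.of fun i j => X (i, j)) (C ∘ z₀))
  by_contra! hno
  -- The residue field may be larger than `ℂ`, so the reduced point is not yet the desired one. If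
  -- no complex `g` existed, the Nullstellensatz would put a power of `det` in the ideal of the
  -- fibre over `z₀`, which contradicts the reduced matrix being invertible.
  have hrad : sp D ∈ (J.map sp).radical := by
    rw [← vanishingIdeal_zeroLocus_eq_radical (K := ℂ), mem_vanishingIdeal_iff]
    intro x hx
    by_contra hne
    have hcomp : ∀ f, aeval x (sp f) = aeval (matrixPoint (Matrix.of fun i j => x (i, j)) z₀) f := by
      intro f
      rw [AlgHom.map_aeval_matrixPoint]
      congr 2
      congr 1
      · ext i j; simp
      · ext l; simp
    rw [hcomp, hDev] at hne
    refine hno (Matrix.GeneralLinearGroup.mkOfDetNeZero _ hne) (hS _ _ fun f hf => ?_)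
    exact (hcomp f).symm.trans (hx _ (Ideal.mem_map_of_mem sp ((hJ f).2 hf)))
  obtain ⟨N, hN⟩ := hrad
  let τ : MvPolynomial (Fin n × Fin n) ℂ →ₐ[ℂ] κ := aeval fun p => kκ p.1 p.2
  have hτ : ∀ f, τ (sp f) = aeval (matrixPoint kκ (algebraMap ℂ κ ∘ z₀)) f := by
    intro f
    rw [AlgHom.map_aeval_matrixPoint]
    congr 2
    congr 1
    · ext i j; simp [τ]
    · ext l; simp [τ]
  have hle : J.map sp ≤ RingHom.ker τ := Ideal.map_le_iff_le_comap.2 fun f hf => by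
    rw [Ideal.mem_comap, RingHom.mem_ker, hτ, hκ f hf]
  have h0 := hle hN
  rw [RingHom.mem_ker, map_pow, hτ] at h0
  have hdet : aeval (matrixPoint kκ (algebraMap ℂ κ ∘ z₀)) D = res k.det := by
    rw [hD, AlgHom.map_det]
    congr 1
    ext i j
    exact aeval_X _ _
  rw [hdet] at h0
  exact pow_ne_zero N (hkdet.map res).ne_zero h0

end Completeness

/-! ### Bounds for the Krull dimension -/

section Dimension

open FunctionSpace

/-- Incomparability: chains of primes contract strictly along an integral homomorphism. -/
theorem ringKrullDim_le_of_isIntegral {A B : Type*} [CommRing A] [CommRing B] (g : A →+* B)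
    (hg : g.IsIntegral) : ringKrullDim B ≤ ringKrullDim A := by
  let := g.toAlgebra
  have : Algebra.IsIntegral A B := ⟨hg⟩
  refine Order.krullDim_le_of_strictMono (PrimeSpectrum.comap (algebraMap A B)) fun P Q h => ?_
  exact Ideal.IsIntegral.comap_lt_comap (I := P.asIdeal) (J := Q.asIdeal) h

/-- A finitely generated algebra that embeds into a polynomial ring in `d` variables has dimension
at most `d`. -/
theorem ringKrullDim_le_of_injective_mvPolynomial {A : Type} [CommRing A] [Algebra ℂ A]
    [Algebra.FiniteType ℂ A] {d : ℕ} (f : A →ₐ[ℂ] MvPolynomial (Fin d) ℂ)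
    (hf : Function.Injective f) : ringKrullDim A ≤ d := by
  have : Nontrivial A := f.toRingHom.domain_nontrivial
  -- Noether normalization gives `dim A ≤ s`, and comparing transcendence degrees gives `s ≤ d`.
  obtain ⟨s, g, hg, hint⟩ := exists_integral_inj_algHom_of_fg ℂ A
  have h1 := ringKrullDim_le_of_isIntegral g.toRingHom hint
  rw [MvPolynomial.ringKrullDim_of_isNoetherianRing, ringKrullDim_eq_zero_of_field, zero_add,
    Nat.card_fin] at h1
  refine h1.trans (Nat.cast_le.2 ?_)
  have h2 := trdeg_le_of_injective (f.comp g) (hf.comp hg)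
  rw [MvPolynomial.trdeg_of_isDomain, MvPolynomial.trdeg_of_isDomain] at h2
  simpa using h2

variable {V E : Type} [AddCommGroup V] [Module ℂ V] [FiniteDimensional ℂ V]
  [AddCommGroup E] [Module ℂ E] [FiniteDimensional ℂ E]

theorem affineSpace.vanishing_isPrime {T : Set V}
    (hT : @IsIrreducible V (affineSpace V).top T) : (affineSpace.vanishing T).IsPrime := by
  let : TopologicalSpace V := (affineSpace V).top
  obtain ⟨⟨x, hx⟩, hpre⟩ := hT
  constructor
  · intro h
    have h1 : (1 : polyFunctions V) ∈ affineSpace.vanishing T := by rw [h]; trivial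
    exact one_ne_zero (h1 x hx)
  · intro f g hfg
    by_contra! h
    simp only [affineSpace.mem_vanishing] at h
    push Not at h
    obtain ⟨⟨y, hy, hfy⟩, z, hz, hgz⟩ := h
    obtain ⟨w, hw, hfw, hgw⟩ := hpre _ _ (affineSpace.isOpen_basic f.2)
      (affineSpace.isOpen_basic g.2) ⟨y, hy, hfy⟩ ⟨z, hz, hgz⟩
    exact mul_ne_zero hfw hgw (hfg w hw)

/-- A closed set that contains a dense polynomial image of an affine space of dimension `d` has
dimension at most `d`. -/
theorem affineSpace.topologicalKrullDim_le {S : Set (affineSpace V).carrier}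
    (hS : IsClosed S) {χ : E → V}
    (hχ : ∀ φ : Module.Dual ℂ V, (fun v => φ (χ v)) ∈ polyFunctions E)
    (hdense : ∀ f ∈ polyFunctions V, f ∘ χ = 0 → ∀ x ∈ S, f x = 0) :
    topologicalKrullDim S ≤ (Module.finrank ℂ E : ℕ) := by
  let pull : polyFunctions V →ₐ[ℂ] polyFunctions E :=
    { toFun := fun f => ⟨f.1 ∘ χ, polyFunctions_comp hχ f.2⟩
      map_one' := rfl
      map_zero' := rfl
      map_mul' := fun _ _ => rfl
      map_add' := fun _ _ => rfl
      commutes' := fun _ => rfl }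
  let I : Ideal (polyFunctions V) := RingHom.ker pull
  have h1 : ringKrullDim (polyFunctions V ⧸ I) ≤ (Module.finrank ℂ E : ℕ) := by
    let e := (polyEquiv (Module.finBasis ℂ E)).symm
    let f : (polyFunctions V ⧸ I) →ₐ[ℂ] MvPolynomial (Fin (Module.finrank ℂ E)) ℂ :=
      e.toAlgHom.comp (Ideal.kerLiftAlg pull)
    have hf : Function.Injective f := e.injective.comp (Ideal.kerLiftAlg_injective pull)
    exact ringKrullDim_le_of_injective_mvPolynomial (A := polyFunctions V ⧸ I) f hf
  refine le_trans ?_ h1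
  rw [ringKrullDim_quotient, ← Order.krullDim_orderDual, topologicalKrullDim]
  have hirr : ∀ T : TopologicalSpace.IrreducibleCloseds S,
      @IsIrreducible V (affineSpace V).top (Subtype.val '' T.carrier) := fun T =>
    T.isIrreducible'.image (Y := (affineSpace V).carrier) Subtype.val continuous_subtype_val.continuousOn
  have hcl : ∀ T : TopologicalSpace.IrreducibleCloseds S,
      IsClosed[(affineSpace V).top] (Subtype.val '' T.carrier) := fun T =>
    hS.isClosedEmbedding_subtypeVal.isClosedMap _ T.isClosed'
  -- An irreducible closed subset of `S` goes to its prime vanishing ideal, which contains the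
  -- kernel `I` by density. Inclusions are reversed, hence the order dual.
  refine Order.krullDim_le_of_strictMono (fun T => OrderDual.toDual
    ⟨⟨affineSpace.vanishing (V := V) (Subtype.val '' T.carrier),
      affineSpace.vanishing_isPrime (hirr T)⟩, ?_⟩) ?_
  · rintro f hf _ ⟨x, -, rfl⟩
    exact hdense f.1 f.2 (congrArg Subtype.val hf) x.1 x.2
  · intro T T' h
    refine affineSpace.vanishing_strictAnti (hcl T) ?_
    exact Subtype.val_injective.image_strictMono h

/-- Nonempty open subsets of `ℂᵈ` have dimension at least `d`. -/
theorem affineSpace.le_topologicalKrullDim_pi {d : ℕ} {O : Set (affineSpace (Fin d → ℂ)).carrier}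
    (hO : IsOpen O) (hne : O.Nonempty) : (d : ℕ) ≤ topologicalKrullDim O := by
  obtain ⟨(p : Fin d → ℂ), hp⟩ := hne
  -- `r i` keeps the first `i` coordinates and resets the others to those of `p`. The sets of fixed
  -- points `L i` form a flag of coordinate flats through `p`, so all of them meet `O`.
  let r : ℕ → (Fin d → ℂ) → (Fin d → ℂ) := fun i x j => if j.val < i then x j else p j
  have hr : ∀ (i : ℕ) (φ : Module.Dual ℂ (Fin d → ℂ)),
      (fun x => φ (r i x)) ∈ polyFunctions (Fin d → ℂ) := by
    intro i φ
    have : (fun x => φ (r i x)) = ∑ j : Fin d, fun x : Fin d → ℂ => r i x j * φ (Pi.single j 1) := by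
      funext x
      rw [Finset.sum_apply]
      conv_lhs => rw [← (Pi.basisFun ℂ (Fin d)).sum_repr (r i x)]
      simp
    rw [this]
    refine sum_mem fun j _ => ?_
    by_cases hj : j.val < i
    · convert dual_mem_polyFunctions (V := Fin d → ℂ)
        (φ (Pi.single j 1) • LinearMap.proj j) using 1
      funext x
      simp [r, hj, mul_comm]
    · convert (polyFunctions (Fin d → ℂ)).algebraMap_mem (p j * φ (Pi.single j 1)) using 1
      funext x
      simp [r, hj]
  have hrc : ∀ i, Continuous[(affineSpace (Fin d → ℂ)).top, (affineSpace (Fin d → ℂ)).top] (r i) :=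
    fun i => (affineSpace.isMorphism_iff (X := affineSpace (Fin d → ℂ)).2 fun φ x =>
      affineSpace.isRegularAt_poly (hr i φ) x).continuous
  let L : ℕ → Set (affineSpace (Fin d → ℂ)).carrier := fun i => {x : Fin d → ℂ | r i x = x}
  have hL : ∀ i, Set.range (r i) = L i := by
    intro i
    ext x
    constructor
    · rintro ⟨y, rfl⟩
      funext j
      by_cases hj : j.val < i <;> simp [r, hj]
    · exact fun h => ⟨x, h⟩
  have hLirr : ∀ i, IsIrreducible (L i) := fun i => by
    have h := (IrreducibleSpace.isIrreducible_univ (affineSpace (Fin d → ℂ)).carrier).image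
      (Y := (affineSpace (Fin d → ℂ)).carrier) (r i) (hrc i).continuousOn
    exact (Set.image_univ.trans (hL i)) ▸ h
  have hLcl : ∀ i, IsClosed (L i) := fun i => by
    refine affineSpace.isClosed_of_vanishing (V := Fin d → ℂ) fun x hx => funext fun j => ?_
    have := hx ⟨fun x => r i x j - x j, sub_mem (hr i (LinearMap.proj j))
      (dual_mem_polyFunctions (V := Fin d → ℂ) (LinearMap.proj j))⟩ fun y hy => by
        change r i y j - y j = 0
        rw [show r i y = y from hy, sub_self]
    exact sub_eq_zero.1 this
  have hpL : ∀ i, p ∈ L i := fun i => funext fun j => by simp [r]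
  have hmono : ∀ i, L i ≤ L (i + 1) := fun i x hx => funext fun j => by
    have h1 := congrFun (show r i x = x from hx) j
    by_cases hj : j.val < i
    · simp [r, hj.trans (Nat.lt_succ_self i)]
    · simp only [r, if_neg hj] at h1
      simp [r, h1]
  -- Strictness must be seen inside `O`: on `L (i + 1)` both a polynomial defining a neighbourhood
  -- of `p` in `O` and the difference of the coordinate `i` from that of `p` are nonzero
  -- polynomials.
  have hstrict : ∀ i, i < d → ∃ x ∈ O, x ∈ L (i + 1) ∧ x ∉ L i := by
    intro i hi
    obtain ⟨f, hf, hfp, hfO⟩ := affineSpace.exists_basic_subset (V := Fin d → ℂ) hO hp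
    obtain ⟨x, hx1, hx2⟩ := exists_ne_zero_ne_zero (polyFunctions_comp (hr (i + 1)) hf)
      (sub_mem (dual_mem_polyFunctions (LinearMap.proj (⟨i, hi⟩ : Fin d) : Module.Dual ℂ _))
        ((polyFunctions (Fin d → ℂ)).algebraMap_mem (p ⟨i, hi⟩)))
      (fun h => hfp (by
        have := congrFun h p
        rwa [Function.comp_apply, show r (i + 1) p = p from hpL _] at this))
      (fun h => by
        have := congrFun h (fun j => p j + 1)
        simp at this)
    refine ⟨r (i + 1) x, hfO _ hx1, by rw [← hL]; exact ⟨x, rfl⟩, fun h => hx2 ?_⟩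
    have := congrFun (show r i (r (i + 1) x) = r (i + 1) x from h) ⟨i, hi⟩
    simp only [r, lt_irrefl, if_false, Nat.lt_succ_self, if_true] at this
    exact sub_eq_zero.2 this.symm
  let s : LTSeries (TopologicalSpace.IrreducibleCloseds O) :=
    { length := d
      toFun := fun i =>
        { carrier := Subtype.val ⁻¹' L i
          isIrreducible' := ⟨⟨⟨p, hp⟩, hpL i⟩,
            (hLirr i).isPreirreducible.preimage hO.isOpenEmbedding_subtypeVal⟩
          isClosed' := (hLcl i).preimage continuous_subtype_val }
      step := fun i => by
        refine lt_of_le_of_ne (Set.preimage_mono (hmono i)) fun h => ?_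
        obtain ⟨x, hxO, h1, h2⟩ := hstrict i i.2
        have h3 : (⟨x, hxO⟩ : O) ∈ (Subtype.val ⁻¹' L (i + 1) : Set O) := h1
        rw [← show (Subtype.val ⁻¹' L i : Set O) = Subtype.val ⁻¹' L (i + 1) from h] at h3
        exact h2 h3 }
  exact Order.LTSeries.length_le_krullDim s

end Dimension

/-! ### Matrices with entries in an algebra of functions -/

section MatrixEntries

variable {T : Type} {l m n : Type}

/-- A family of matrices has its entries in an algebra of functions. -/
def HasEntries (A : Subalgebra ℂ (T → ℂ)) (M : T → Matrix m n ℂ) : Prop :=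
  ∀ i j, (fun t => M t i j) ∈ A

variable {A : Subalgebra ℂ (T → ℂ)}

theorem HasEntries.const (M : Matrix m n ℂ) : HasEntries A fun _ => M :=
  fun i j => A.algebraMap_mem (M i j)

theorem HasEntries.add {M N : T → Matrix m n ℂ} (hM : HasEntries A M) (hN : HasEntries A N) :
    HasEntries A fun t => M t + N t :=
  fun i j => add_mem (hM i j) (hN i j)

theorem HasEntries.sub {M N : T → Matrix m n ℂ} (hM : HasEntries A M) (hN : HasEntries A N) :
    HasEntries A fun t => M t - N t :=
  fun i j => sub_mem (hM i j) (hN i j)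

theorem HasEntries.mul [Fintype m] {M : T → Matrix l m ℂ} {N : T → Matrix m n ℂ} (hM : HasEntries A M)
    (hN : HasEntries A N) : HasEntries A fun t => M t * N t := by
  intro i j
  have : (fun t => (M t * N t) i j) = ∑ k, (fun t => M t i k) * fun t => N t k j := by
    funext t
    simp [Matrix.mul_apply]
  rw [this]
  exact sum_mem fun k _ => mul_mem (hM i k) (hN k j)

theorem HasEntries.pow [Fintype n] [DecidableEq n] {M : T → Matrix n n ℂ} (hM : HasEntries A M) (a : ℕ) :
    HasEntries A fun t => M t ^ a := by
  induction a with
  | zero => simpa using HasEntries.const 1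
  | succ a ih => simpa only [pow_succ] using ih.mul hM

theorem HasEntries.det [Fintype n] [DecidableEq n] {M : T → Matrix n n ℂ} (hM : HasEntries A M) :
    (fun t => (M t).det) ∈ A := by
  have : (fun t => (M t).det) = ∑ σ : Equiv.Perm n,
      ((Equiv.Perm.sign σ : ℤ) : ℂ) • ∏ i, fun t => M t (σ i) i := by
    funext t
    simp [Matrix.det_apply']
  rw [this]
  exact sum_mem fun σ _ => A.smul_mem (prod_mem fun i _ => hM _ _) _

theorem HasEntries.adjugate [Fintype n] [DecidableEq n] {M : T → Matrix n n ℂ} (hM : HasEntries A M) :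
    HasEntries A fun t => (M t).adjugate := by
  intro i j
  simp only [Matrix.adjugate_apply]
  refine HasEntries.det fun k l => ?_
  by_cases hk : k = j
  · subst hk
    simp only [Matrix.updateRow_self]
    exact A.algebraMap_mem (Pi.single (M := fun _ => ℂ) i 1 l)
  · simpa only [Matrix.updateRow_ne hk] using hM k l

theorem HasEntries.dual_mem [Fintype m] [Fintype n] [DecidableEq m] [DecidableEq n]
    {M : T → Matrix m n ℂ} (hM : HasEntries A M)
    (φ : Module.Dual ℂ (Matrix m n ℂ)) : (fun t => φ (M t)) ∈ A := by
  have : (fun t => φ (M t)) = ∑ i, ∑ j, φ (Matrix.single i j 1) • fun t => M t i j := by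
    funext t
    conv_lhs => rw [Matrix.matrix_eq_sum_single (M t)]
    simp only [map_sum, Finset.sum_apply, Pi.smul_apply, smul_eq_mul]
    refine Finset.sum_congr rfl fun i _ => Finset.sum_congr rfl fun j _ => ?_
    rw [← mul_one (M t i j), ← smul_eq_mul (M t i j), ← Matrix.smul_single, map_smul, smul_eq_mul,
      smul_eq_mul, mul_one, mul_comm]
  rw [this]
  exact sum_mem fun i _ => sum_mem fun j _ => A.smul_mem (hM i j) _

/-- Cramer's rule: the adjugate is polynomial in the entries, and the determinant is invertible near
`x`. -/
theorem HasEntries.inv [Fintype n] [DecidableEq n] {X : FunctionSpace} {x : X.carrier} {M : X.carrier → Matrix n n ℂ}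
    (hM : HasEntries (X.regularAt x) M) (hx : (M x).det ≠ 0) :
    HasEntries (X.regularAt x) fun t => (M t)⁻¹ := by
  intro i j
  have : (fun t => (M t)⁻¹ i j) = (fun t => (M t).det)⁻¹ * fun t => (M t).adjugate i j := by
    funext t
    simp [Matrix.inv_def]
  rw [this]
  exact mul_mem (X.inv hM.det hx) (hM.adjugate i j)

end MatrixEntries

/-! ### Coordinates on the enhanced adjoint representation -/

namespace EnhancedSpace

variable {n p q : ℕ} {T : Type}

theorem smul_fst (g : Matrix.GeneralLinearGroup (Fin n) ℂ) (w : EnhancedSpace n p q) :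
    (g • w).1 = g.val * w.1 := rfl

theorem smul_snd_fst (g : Matrix.GeneralLinearGroup (Fin n) ℂ) (w : EnhancedSpace n p q) :
    (g • w).2.1 = w.2.1 * g⁻¹.val := rfl

theorem smul_snd_snd (g : Matrix.GeneralLinearGroup (Fin n) ℂ) (w : EnhancedSpace n p q) :
    (g • w).2.2 = g.val * w.2.2 * g⁻¹.val := rfl

/-- A family of points has its coordinates in an algebra of functions. -/
structure HasCoords (A : Subalgebra ℂ (T → ℂ)) (w : T → EnhancedSpace n p q) : Prop where
  fst : HasEntries A fun t => (w t).1
  snd_fst : HasEntries A fun t => (w t).2.1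
  snd_snd : HasEntries A fun t => (w t).2.2

variable {A : Subalgebra ℂ (T → ℂ)}

theorem HasCoords.dual_mem {w : T → EnhancedSpace n p q} (hw : HasCoords A w)
    (φ : Module.Dual ℂ (EnhancedSpace n p q)) : (fun t => φ (w t)) ∈ A := by
  let φ' : Matrix (Fin n) (Fin p) ℂ × Matrix (Fin q) (Fin n) ℂ × Matrix (Fin n) (Fin n) ℂ →ₗ[ℂ] ℂ :=
    φ
  have : (fun t => φ (w t)) = (fun t => (φ'.comp (LinearMap.inl ℂ _ _)) (w t).1) +
      ((fun t => (φ'.comp ((LinearMap.inr ℂ _ _).comp (LinearMap.inl ℂ _ _))) (w t).2.1) +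
      fun t => (φ'.comp ((LinearMap.inr ℂ _ _).comp (LinearMap.inr ℂ _ _))) (w t).2.2) := by
    funext t
    change φ' (w t) = φ' _ + (φ' _ + φ' _)
    rw [← map_add, ← map_add]
    congr 1
    exact Prod.ext (by simp) (Prod.ext (by simp) (by simp))
  rw [this]
  exact add_mem (hw.fst.dual_mem _) (add_mem (hw.snd_fst.dual_mem _) (hw.snd_snd.dual_mem _))

theorem HasCoords.smul {w : T → EnhancedSpace n p q} (hw : HasCoords A w)
    {g : T → Matrix.GeneralLinearGroup (Fin n) ℂ} (hg : HasEntries A fun t => (g t).val)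
    (hg' : HasEntries A fun t => (g t)⁻¹.val) : HasCoords A fun t => g t • w t where
  fst := hg.mul hw.fst
  snd_fst := hw.snd_fst.mul hg'
  snd_snd := (hg.mul hw.snd_snd).mul hg'

theorem HasCoords.of_dual {w : T → EnhancedSpace n p q}
    (h : ∀ φ : Module.Dual ℂ (EnhancedSpace n p q), (fun t => φ (w t)) ∈ A) : HasCoords A w where
  fst i j := h (((LinearMap.proj j).comp (LinearMap.proj i)).comp
    (LinearMap.fst ℂ (Matrix (Fin n) (Fin p) ℂ)
      (Matrix (Fin q) (Fin n) ℂ × Matrix (Fin n) (Fin n) ℂ)))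
  snd_fst i j := h (((LinearMap.proj j).comp (LinearMap.proj i)).comp
    ((LinearMap.fst ℂ (Matrix (Fin q) (Fin n) ℂ) (Matrix (Fin n) (Fin n) ℂ)).comp
    (LinearMap.snd ℂ (Matrix (Fin n) (Fin p) ℂ)
      (Matrix (Fin q) (Fin n) ℂ × Matrix (Fin n) (Fin n) ℂ))))
  snd_snd i j := h (((LinearMap.proj j).comp (LinearMap.proj i)).comp
    ((LinearMap.snd ℂ (Matrix (Fin q) (Fin n) ℂ) (Matrix (Fin n) (Fin n) ℂ)).comp
    (LinearMap.snd ℂ (Matrix (Fin n) (Fin p) ℂ)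
      (Matrix (Fin q) (Fin n) ℂ × Matrix (Fin n) (Fin n) ℂ))))

end EnhancedSpace

/-! ### Stabilizer of `U_k` and the null cone -/

section Unstable

variable {n p q k : ℕ}

theorem smul_mem_unstableSubspace {b : Matrix.GeneralLinearGroup (Fin n) ℂ}
    (hb : b ∈ upperBorel n) {u : EnhancedSpace n p q} (hu : u ∈ unstableSubspace n p q k) :
    b • u ∈ unstableSubspace n p q k := by
  have hb' := (upperBorel n).inv_mem hb
  refine ⟨fun i j hi => ?_, fun i j hj => ?_, fun i j hij => ?_⟩
  · rw [EnhancedSpace.smul_fst, Matrix.mul_apply]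
    refine Finset.sum_eq_zero fun l _ => ?_
    by_cases hl : l < i
    · rw [hb i l hl, zero_mul]
    · rw [hu.1 l j (hi.trans (not_lt.1 hl)), mul_zero]
  · rw [EnhancedSpace.smul_snd_fst, Matrix.mul_apply]
    refine Finset.sum_eq_zero fun l _ => ?_
    by_cases hl : j < l
    · rw [hb' l j hl, mul_zero]
    · rw [hu.2.1 i l (lt_of_le_of_lt (not_lt.1 hl) hj), zero_mul]
  · rw [EnhancedSpace.smul_snd_snd, Matrix.mul_apply]
    refine Finset.sum_eq_zero fun l _ => ?_
    by_cases hl : j < l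
    · rw [hb' l j hl, mul_zero]
    · rw [Matrix.mul_apply, Finset.sum_eq_zero fun m _ => ?_, zero_mul]
      by_cases hm : m < i
      · rw [hb i m hm, zero_mul]
      · rw [hu.2.2 m l ((not_lt.1 hl).trans (hij.trans (not_lt.1 hm))), mul_zero]

theorem isStrictlyUpper_of_mem {u : EnhancedSpace n p q} (hu : u ∈ unstableSubspace n p q k) :
    u.2.2.IsStrictlyUpper :=
  hu.2.2

/-- The point of `U_k` whose only nonzero component is a nilpotent Jordan block. -/
def jordanPoint (n p q : ℕ) : EnhancedSpace n p q := (0, 0, jordanBlock n)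

theorem jordanPoint_mem : jordanPoint n p q ∈ unstableSubspace n p q k :=
  ⟨fun _ _ _ => rfl, fun _ _ _ => rfl, jordanBlock_isStrictlyUpper⟩

open scoped Pointwise in
-- A single test point suffices for the hard inclusion: the Jordan block has a cyclic vector and
-- must stay strictly upper triangular.
theorem stabilizer_unstableSubspace :
    MulAction.stabilizer (Matrix.GeneralLinearGroup (Fin n) ℂ)
        (unstableSubspace n p q k : Set (EnhancedSpace n p q)) = upperBorel n := by
  ext g
  rw [MulAction.mem_stabilizer_iff]
  constructor
  · intro h
    have h1 : g • jordanPoint n p q ∈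
        g • (unstableSubspace n p q k : Set (EnhancedSpace n p q)) :=
      Set.smul_mem_smul_set jordanPoint_mem
    rw [h] at h1
    obtain ⟨w, hw⟩ := exists_det_krylovMatrix_jordanBlock (n := n)
    exact mem_upperBorel_of_conj jordanBlock_isStrictlyUpper (isStrictlyUpper_of_mem h1) hw
  · intro hg
    ext u
    rw [Set.mem_smul_set_iff_inv_smul_mem]
    refine ⟨fun h => ?_, fun h => smul_mem_unstableSubspace ((upperBorel n).inv_mem hg) h⟩
    rw [← smul_inv_smul g u]
    exact smul_mem_unstableSubspace hg h

/-- Diagonal matrices with powers of `t ≠ 0` as entries. -/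
noncomputable def diagonalPow {t : ℂ} (ht : t ≠ 0) (e : Fin n → ℤ) :
    Matrix.GeneralLinearGroup (Fin n) ℂ where
  val := Matrix.diagonal fun i => t ^ e i
  inv := Matrix.diagonal fun i => t ^ (-e i)
  val_inv := by
    rw [Matrix.diagonal_mul_diagonal, ← Matrix.diagonal_one]
    congr 1
    funext i
    rw [← zpow_add₀ ht, add_neg_cancel, zpow_zero]
  inv_val := by
    rw [Matrix.diagonal_mul_diagonal, ← Matrix.diagonal_one]
    congr 1
    funext i
    rw [← zpow_add₀ ht, neg_add_cancel, zpow_zero]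

/-- Hilbert–Mumford in the easy direction. Give the basis vector `i` the weight `2k - 1 - 2i`, which
decreases in `i`, is positive for `i < k` and negative for `i ≥ k`. All entries allowed in `U_k`
then have positive weight, so `u` is contracted to `0` while an invariant stays constant. -/
theorem nullComponent_subset_nullCone : nullComponent n p q k ⊆ nullCone n p q := by
  rintro _ ⟨g, u, hu, rfl⟩ f hf hinv
  rw [hinv]
  -- The exponents are truncated differences in `ℕ`. Truncation only affects positions where `u`
  -- vanishes, and it makes the curve polynomial, hence defined at `t = 0`.
  let γ : ℂ → EnhancedSpace n p q := fun t =>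
    (Matrix.of fun i j => u.1 i j * t ^ (2 * k - 1 - 2 * i.val),
      Matrix.of fun i j => u.2.1 i j * t ^ (2 * j.val + 1 - 2 * k),
      Matrix.of fun i j => u.2.2 i j * t ^ (2 * j.val - 2 * i.val))
  have hpow : ∀ (c : ℂ) (a : ℕ), (fun t : ℂ => c * t ^ a) ∈ polyFunctions ℂ := fun c a =>
    mul_mem ((polyFunctions ℂ).algebraMap_mem c)
      (pow_mem (dual_mem_polyFunctions (V := ℂ) LinearMap.id) a)
  have hγ : EnhancedSpace.HasCoords (polyFunctions ℂ) γ :=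
    ⟨fun i j => hpow _ _, fun i j => hpow _ _, fun i j => hpow _ _⟩
  have hγ0 : γ 0 = 0 := by
    refine Prod.ext (Matrix.ext fun i j => ?_) (Prod.ext (Matrix.ext fun i j => ?_)
      (Matrix.ext fun i j => ?_))
    · change u.1 i j * 0 ^ _ = 0
      by_cases h : k ≤ i.val
      · rw [hu.1 i j h, zero_mul]
      · rw [zero_pow (by omega), mul_zero]
    · change u.2.1 i j * 0 ^ _ = 0
      by_cases h : j.val < k
      · rw [hu.2.1 i j h, zero_mul]
      · rw [zero_pow (by omega), mul_zero]
    · change u.2.2 i j * 0 ^ _ = 0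
      by_cases h : j ≤ i
      · rw [hu.2.2 i j h, zero_mul]
      · have : i.val < j.val := not_le.1 h
        rw [zero_pow (by omega), mul_zero]
  have hγ1 : γ 1 = u := by
    refine Prod.ext (Matrix.ext fun i j => ?_) (Prod.ext (Matrix.ext fun i j => ?_)
      (Matrix.ext fun i j => ?_)) <;> simp [γ]
  have hγt : ∀ t : ℂ, t ≠ 0 → ∃ h : Matrix.GeneralLinearGroup (Fin n) ℂ, γ t = h • u := by
    intro t ht
    let e : Fin n → ℤ := fun i => 2 * k - 1 - 2 * i.val
    refine ⟨diagonalPow ht e, ?_⟩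
    refine Prod.ext (Matrix.ext fun i j => ?_) (Prod.ext (Matrix.ext fun i j => ?_)
      (Matrix.ext fun i j => ?_))
    · change u.1 i j * t ^ _ = (Matrix.diagonal (fun i => t ^ e i) * u.1) i j
      rw [Matrix.diagonal_mul, mul_comm]
      by_cases h : k ≤ i.val
      · rw [hu.1 i j h, mul_zero, mul_zero]
      · rw [← zpow_natCast]
        congr 2
        simp only [e]
        omega
    · change u.2.1 i j * t ^ _ = (u.2.1 * Matrix.diagonal fun i => t ^ (-e i)) i j
      rw [Matrix.mul_diagonal]
      by_cases h : j.val < k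
      · rw [hu.2.1 i j h, zero_mul, zero_mul]
      · rw [← zpow_natCast]
        congr 2
        simp only [e]
        omega
    · change u.2.2 i j * t ^ _ = (Matrix.diagonal (fun i => t ^ e i) * u.2.2 *
        Matrix.diagonal fun i => t ^ (-e i)) i j
      rw [Matrix.mul_diagonal, Matrix.diagonal_mul, mul_right_comm, mul_comm (_ * _)]
      by_cases h : j ≤ i
      · rw [hu.2.2 i j h, zero_mul, zero_mul]
      · have : i.val < j.val := not_le.1 h
        rw [← zpow_natCast, ← zpow_add₀ ht]
        congr 2
        simp only [e]
        omega
  -- Invariance applies for `t ≠ 0` only. Multiplying by `t` gives an identity for all `t`, and `t`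
  -- cancels in the domain of polynomials.
  have hconst : f ∘ γ - (fun _ => f u) = 0 := by
    refine (polyFunctions_mul_eq_zero (dual_mem_polyFunctions (V := ℂ) LinearMap.id)
      (sub_mem (polyFunctions_comp hγ.dual_mem hf) ((polyFunctions ℂ).algebraMap_mem (f u)))
      (funext fun t => ?_)).resolve_left fun h => one_ne_zero (congrFun h 1)
    by_cases ht : t = 0
    · simp [ht]
    · obtain ⟨h, hh⟩ := hγt t ht
      change t * (f (γ t) - f u) = 0
      rw [hh, hinv, sub_self, mul_zero]
  have := congrFun hconst 0
  change f (γ 0) - f u = 0 at this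
  rw [hγ0] at this
  exact (sub_eq_zero.1 this).symm

end Unstable

/-! ### Charts of the associated bundle -/

section Charts

open FunctionSpace EnhancedSpace

variable {n p q k : ℕ}

/-- Strictly lower triangular matrices. -/
def strictlyLower (n : ℕ) : Submodule ℂ (Matrix (Fin n) (Fin n) ℂ) where
  carrier := {l | ∀ i j, i ≤ j → l i j = 0}
  zero_mem' := fun _ _ _ => rfl
  add_mem' := fun ha hb i j h => by rw [Matrix.add_apply, ha i j h, hb i j h, add_zero]
  smul_mem' := fun c a ha i j h => by rw [Matrix.smul_apply, ha i j h, smul_zero]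

theorem one_add_isLowerUnipotent (l : strictlyLower n) :
    (1 + l.1 : Matrix (Fin n) (Fin n) ℂ).IsLowerUnipotent := fun i j h => by
  rw [Matrix.add_apply, l.2 i j h, add_zero]

/-- The lower unipotent matrix `1 + l` as an invertible matrix. -/
noncomputable def lowerUnipotent (l : strictlyLower n) : Matrix.GeneralLinearGroup (Fin n) ℂ :=
  Matrix.GeneralLinearGroup.mkOfDetNeZero (1 + l.1)
    (by rw [(one_add_isLowerUnipotent l).det_eq_one]; exact one_ne_zero)

theorem lowerUnipotent_val (l : strictlyLower n) : (lowerUnipotent l).val = 1 + l.1 := rfl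

theorem det_ne_zero (g : Matrix.GeneralLinearGroup (Fin n) ℂ) : g.val.det ≠ 0 :=
  isUnit_iff_ne_zero.1 ((Matrix.isUnit_iff_isUnit_det _).1 g.isUnit)

/-- Determinant `1` makes the inverse polynomial rather than rational, so `(l, u) ↦ (1 + l) • u` is
a polynomial map. -/
theorem lowerUnipotent_inv_val (l : strictlyLower n) :
    (lowerUnipotent l)⁻¹.val = (1 + l.1).adjugate := by
  rw [Matrix.coe_units_inv, lowerUnipotent_val, Matrix.inv_def,
    (one_add_isLowerUnipotent l).det_eq_one]
  simp

/-- The model of the charts of `G ×_B U_k`. -/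
abbrev ChartModel (n p q k : ℕ) : Type := strictlyLower n × unstableSubspace n p q k

theorem polyFunctions_strictlyLower :
    HasEntries (polyFunctions (ChartModel n p q k)) fun w => w.1.1 := fun i j =>
  dual_mem_polyFunctions (V := ChartModel n p q k) ((Matrix.entryLinearMap ℂ ℂ i j).comp
    ((strictlyLower n).subtype.comp (LinearMap.fst ℂ _ _)))

theorem polyFunctions_unstable :
    HasCoords (polyFunctions (ChartModel n p q k)) fun w => w.2.1 :=
  HasCoords.of_dual fun φ => dual_mem_polyFunctions (V := ChartModel n p q k)
    (φ.comp ((unstableSubspace n p q k).subtype.comp (LinearMap.snd ℂ _ _)))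

theorem polyFunctions_lowerUnipotent :
    HasEntries (polyFunctions (ChartModel n p q k)) fun w => (lowerUnipotent w.1).val :=
  (HasEntries.const 1).add polyFunctions_strictlyLower

theorem polyFunctions_lowerUnipotent_inv :
    HasEntries (polyFunctions (ChartModel n p q k)) fun w => (lowerUnipotent w.1)⁻¹.val := by
  simp only [lowerUnipotent_inv_val]
  exact ((HasEntries.const 1).add polyFunctions_strictlyLower).adjugate

/-- Polynomial functions are regular. -/
theorem polyFunctions_le_regularAt {V : Type} [AddCommGroup V] [Module ℂ V]
    [FiniteDimensional ℂ V] (x : V) : polyFunctions V ≤ (affineSpace V).regularAt x :=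
  fun _ h => affineSpace.isRegularAt_poly h x

theorem HasEntries.mono {T m n : Type} {A A' : Subalgebra ℂ (T → ℂ)} {M : T → Matrix m n ℂ}
    (hM : HasEntries A M) (h : A ≤ A') : HasEntries A' M := fun i j => h (hM i j)

theorem EnhancedSpace.HasCoords.mono {T : Type} {A A' : Subalgebra ℂ (T → ℂ)}
    {w : T → EnhancedSpace n p q} (hw : HasCoords A w) (h : A ≤ A') : HasCoords A' w :=
  ⟨hw.fst.mono h, hw.snd_fst.mono h, hw.snd_snd.mono h⟩

theorem isMorphism_to_glVariety {X : FunctionSpace}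
    {φ : X.carrier → Matrix.GeneralLinearGroup (Fin n) ℂ}
    (h : ∀ x, HasEntries (X.regularAt x) fun x => (φ x).val) :
    IsMorphism X (glVariety n) φ :=
  isMorphism_to_induced.2 (affineSpace.isMorphism_iff.2 fun ℓ x => (h x).dual_mem ℓ)

theorem isMorphism_to_enhanced {X : FunctionSpace} {φ : X.carrier → EnhancedSpace n p q} :
    IsMorphism X (enhancedVariety n p q) φ ↔ ∀ x, HasCoords (X.regularAt x) φ :=
  ⟨fun h x => HasCoords.of_dual fun ℓ => affineSpace.isMorphism_iff.1 h ℓ x,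
    fun h => affineSpace.isMorphism_iff.2 fun ℓ x => (h x).dual_mem ℓ⟩

/-- Morphisms to `G × U_k`. -/
theorem isMorphism_to_groupTimesUnstable {X : FunctionSpace}
    {φ : X.carrier → Matrix.GeneralLinearGroup (Fin n) ℂ}
    {ω : X.carrier → (unstableSubspace n p q k : Set (EnhancedSpace n p q))}
    (h : ∀ x, HasEntries (X.regularAt x) fun x => (φ x).val)
    (h' : ∀ x, HasCoords (X.regularAt x) fun x => ((ω x).1 : EnhancedSpace n p q)) :
    IsMorphism X (groupTimesUnstable n p q k) fun x => (φ x, ω x) :=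
  IsMorphism.prodMk (isMorphism_to_glVariety h)
    (isMorphism_to_subspace.2 (isMorphism_to_enhanced.2 h'))

theorem glVariety_entries (x : (glVariety n).carrier) : HasEntries ((glVariety n).regularAt x)
    (fun g : Matrix.GeneralLinearGroup (Fin n) ℂ => g.val) := fun i j =>
  (affineSpace.isMorphism_iff (X := glVariety n)).1 (isMorphism_induced_map
    (X := affineSpace (Matrix (Fin n) (Fin n) ℂ))
    (fun g : Matrix.GeneralLinearGroup (Fin n) ℂ => g.val)) (Matrix.entryLinearMap ℂ ℂ i j) x

/-- Matrix entries pull back to regular functions along morphisms to `GL_n`. -/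
theorem entries_of_isMorphism {X : FunctionSpace}
    {φ : X.carrier → Matrix.GeneralLinearGroup (Fin n) ℂ} (h : IsMorphism X (glVariety n) φ)
    (x : X.carrier) : HasEntries (X.regularAt x) fun x => (φ x).val :=
  fun i j => h.comp_regular x _ (glVariety_entries (φ x) i j)

theorem inv_entries {X : FunctionSpace} {x : X.carrier}
    {φ : X.carrier → Matrix.GeneralLinearGroup (Fin n) ℂ}
    (h : HasEntries (X.regularAt x) fun x => (φ x).val) :
    HasEntries (X.regularAt x) fun x => (φ x)⁻¹.val := by
  simp only [Matrix.coe_units_inv]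
  exact h.inv (det_ne_zero _)

theorem groupTimesUnstable_entries (x : (groupTimesUnstable n p q k).carrier) :
    HasEntries ((groupTimesUnstable n p q k).regularAt x)
      (fun x : Matrix.GeneralLinearGroup (Fin n) ℂ ×
        (unstableSubspace n p q k : Set (EnhancedSpace n p q)) => x.1.val) :=
  entries_of_isMorphism isMorphism_fst x

theorem groupTimesUnstable_coords (x : (groupTimesUnstable n p q k).carrier) :
    HasCoords ((groupTimesUnstable n p q k).regularAt x)
      (fun x : Matrix.GeneralLinearGroup (Fin n) ℂ ×
        (unstableSubspace n p q k : Set (EnhancedSpace n p q)) => (x.2.1 : EnhancedSpace n p q)) :=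
  isMorphism_to_enhanced.1 ((isMorphism_val (X := enhancedVariety n p q) _).comp isMorphism_snd) x

/-- The class `[g, u]` of a point of `G × U_k`. -/
def bundleMk (x : Matrix.GeneralLinearGroup (Fin n) ℂ ×
    (unstableSubspace n p q k : Set (EnhancedSpace n p q))) :
    (associatedBundle n p q k).carrier :=
  Quotient.mk (associatedSetoid n p q k) x

theorem isMorphism_bundleMk :
    IsMorphism (groupTimesUnstable n p q k) (associatedBundle n p q k) bundleMk :=
  isMorphism_quotient_mk _

theorem bundleMk_surjective : Function.Surjective (bundleMk (n := n) (p := p) (q := q) (k := k)) :=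
  Quotient.mk_surjective

/-- In other words, `[g, u] ↦ (gB, g u)` embeds the bundle in `G / B × W` as a set. Given both
equalities, the element `b` of the orbit relation is forced. -/
theorem bundleMk_eq_iff {x y : Matrix.GeneralLinearGroup (Fin n) ℂ ×
    (unstableSubspace n p q k : Set (EnhancedSpace n p q))} :
    bundleMk x = bundleMk y ↔
      x.1⁻¹ * y.1 ∈ upperBorel n ∧ x.1 • (x.2.1 : EnhancedSpace n p q) = y.1 • y.2.1 := by
  refine (Quotient.eq (r := associatedSetoid n p q k)).trans ⟨?_, ?_⟩
  · rintro ⟨b, hb, h1, h2⟩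
    rw [h1]
    refine ⟨by simpa using (upperBorel n).inv_mem hb, ?_⟩
    rw [h2, smul_smul, inv_mul_cancel_right]
  · rintro ⟨h1, h2⟩
    refine ⟨(x.1⁻¹ * y.1)⁻¹, (upperBorel n).inv_mem h1, by simp, ?_⟩
    rw [mul_inv_rev, inv_inv, mul_smul, h2, inv_smul_smul]

theorem collapsingMap_bundleMk (x : Matrix.GeneralLinearGroup (Fin n) ℂ ×
    (unstableSubspace n p q k : Set (EnhancedSpace n p q))) :
    (collapsingMap n p q k (bundleMk x)).1 = (x.1 • x.2.1 : EnhancedSpace n p q) := rfl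

theorem isMorphism_collapsingMap :
    IsMorphism (associatedBundle n p q k) (nullComponentVariety n p q k)
      (collapsingMap n p q k) := by
  refine isMorphism_from_quotient (isMorphism_to_subspace.2 (isMorphism_to_enhanced.2 fun x => ?_))
  exact (groupTimesUnstable_coords x).smul (groupTimesUnstable_entries x)
    (inv_entries (groupTimesUnstable_entries x))

theorem collapsingMap_surjective : Function.Surjective (collapsingMap n p q k) := by
  rintro ⟨_, g, u, hu, rfl⟩
  exact ⟨bundleMk (g, ⟨u, hu⟩), rfl⟩

/-- `(l, u) ↦ (a (1 + l), u)`. -/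
noncomputable def chartLift (a : Matrix.GeneralLinearGroup (Fin n) ℂ) (w : ChartModel n p q k) :
    Matrix.GeneralLinearGroup (Fin n) ℂ ×
      (unstableSubspace n p q k : Set (EnhancedSpace n p q)) :=
  (a * lowerUnipotent w.1, w.2)

theorem isMorphism_chartLift (a : Matrix.GeneralLinearGroup (Fin n) ℂ) :
    IsMorphism (affineSpace (ChartModel n p q k)) (groupTimesUnstable n p q k) (chartLift a) :=
  isMorphism_to_groupTimesUnstable
    (fun x => ((HasEntries.const a.val).mul polyFunctions_lowerUnipotent).mono
      (polyFunctions_le_regularAt (V := ChartModel n p q k) x))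
    (fun x => polyFunctions_unstable.mono (polyFunctions_le_regularAt (V := ChartModel n p q k) x))

/-- The chart `(l, u) ↦ [a (1 + l), u]`. -/
noncomputable def chart (a : Matrix.GeneralLinearGroup (Fin n) ℂ) (w : ChartModel n p q k) :
    (associatedBundle n p q k).carrier :=
  bundleMk (chartLift a w)

theorem isMorphism_chart (a : Matrix.GeneralLinearGroup (Fin n) ℂ) :
    IsMorphism (affineSpace (ChartModel n p q k)) (associatedBundle n p q k) (chart a) :=
  isMorphism_bundleMk.comp (isMorphism_chartLift a)

/-- Lower unipotent and upper triangular matrices meet only in `1`: both `(1 + l)⁻¹ (1 + l')` and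
`1` are upper factors of `1 + l`. -/
theorem chart_injective (a : Matrix.GeneralLinearGroup (Fin n) ℂ) :
    Function.Injective (chart (p := p) (q := q) (k := k) a) := by
  rintro ⟨l, u⟩ ⟨l', u'⟩ h
  obtain ⟨h1, h2⟩ := bundleMk_eq_iff.1 h
  simp only [chartLift] at h1 h2
  rw [mul_inv_rev, mul_assoc, inv_mul_cancel_left] at h1
  have hl : lowerUnipotent l = lowerUnipotent l' := by
    have hd : ∀ j, ((lowerUnipotent l).val.leadingRows j).det ≠ 0 := fun j => by
      rw [lowerUnipotent_val, (one_add_isLowerUnipotent l).det_leadingRows]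
      exact one_ne_zero
    have e1 := Matrix.eq_upperFactor hd (c := ((lowerUnipotent l)⁻¹ * lowerUnipotent l').val)
      (fun i j hij => h1 i j hij) (by
        rw [← Units.val_mul, mul_inv_cancel_left]
        exact one_add_isLowerUnipotent l')
    have e2 := Matrix.eq_upperFactor hd (c := 1) (fun i j hij => Matrix.one_apply_ne hij.ne') (by
        rw [Matrix.mul_one]
        exact one_add_isLowerUnipotent l)
    rw [← e2] at e1
    exact inv_mul_eq_one.1 (Units.ext e1)
  have hl' : l = l' := Subtype.ext (add_left_cancel (congrArg Units.val hl))
  rw [hl, smul_left_cancel_iff] at h2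
  exact Prod.ext hl' (Subtype.ext h2)

/-- The points `[g, u]` with `a⁻¹ g` in the big cell. -/
def chartDomain (a : Matrix.GeneralLinearGroup (Fin n) ℂ) :
    Set (associatedBundle n p q k).carrier :=
  Set.range (chart a)

/-- Explicit coordinates of a point in the domain of a chart. -/
theorem exists_chart_eq (a : Matrix.GeneralLinearGroup (Fin n) ℂ)
    (x : Matrix.GeneralLinearGroup (Fin n) ℂ ×
      (unstableSubspace n p q k : Set (EnhancedSpace n p q)))
    (hx : ∀ j, ((a⁻¹ * x.1).val.leadingRows j).det ≠ 0) :
    ∃ (c : Matrix.GeneralLinearGroup (Fin n) ℂ) (w : ChartModel n p q k),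
      c.val = (a⁻¹ * x.1).val.upperFactor ∧ chart a w = bundleMk x ∧
      w.1.1 = (a⁻¹ * x.1).val * c.val - 1 ∧ w.2.1 = c⁻¹ • (x.2.1 : EnhancedSpace n p q) := by
  have hy := Matrix.mul_upperFactor hx
  have hdet : (a⁻¹ * x.1).val.upperFactor.det ≠ 0 := by
    have := hy.det_eq_one
    rw [Matrix.det_mul] at this
    exact right_ne_zero_of_mul (this.trans_ne one_ne_zero)
  let c := Matrix.GeneralLinearGroup.mkOfDetNeZero _ hdet
  have hc : c ∈ upperBorel n := fun i j hij => Matrix.upperFactor_upper hx i j hij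
  have hl : (a⁻¹ * x.1).val * c.val - 1 ∈ strictlyLower n := fun i j hij => by
    rw [Matrix.sub_apply, sub_eq_zero]
    exact hy i j hij
  refine ⟨c, (⟨_, hl⟩, ⟨_, smul_mem_unstableSubspace ((upperBorel n).inv_mem hc) x.2.2⟩), rfl, ?_,
    rfl, rfl⟩
  have hlow : lowerUnipotent ⟨_, hl⟩ = a⁻¹ * x.1 * c := Units.ext (by
    rw [lowerUnipotent_val, add_sub_cancel, ← Units.val_mul])
  refine bundleMk_eq_iff.2 ⟨?_, ?_⟩
  · simp only [chartLift, hlow]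
    simpa [mul_assoc] using hc
  · simp only [chartLift, hlow]
    rw [smul_smul]
    congr 1
    group

/-- The big cell is the locus where all leading minors are nonzero, and it is stable under right
multiplication by `B`. This exhibits the preimage of the domain as the nonvanishing locus of regular
functions on `G × U_k`. -/
theorem bundleMk_mem_chartDomain_iff {a : Matrix.GeneralLinearGroup (Fin n) ℂ}
    {x : Matrix.GeneralLinearGroup (Fin n) ℂ ×
      (unstableSubspace n p q k : Set (EnhancedSpace n p q))} :
    bundleMk x ∈ chartDomain a ↔ ∀ j, ((a⁻¹ * x.1).val.leadingRows j).det ≠ 0 := by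
  constructor
  · rintro ⟨w, hw⟩ j
    obtain ⟨h1, -⟩ := bundleMk_eq_iff.1 hw
    have : a⁻¹ * x.1 = lowerUnipotent w.1 * ((chartLift a w).1⁻¹ * x.1) := by
      simp only [chartLift]
      group
    rw [this, Units.val_mul, lowerUnipotent_val,
      Matrix.leadingRows_mul (one_add_isLowerUnipotent _), Matrix.det_mul,
      (one_add_isLowerUnipotent _).det_leadingRows, one_mul]
    exact det_leadingRows_of_mem_upperBorel h1 j
  · intro h
    obtain ⟨c, w, -, hw, -⟩ := exists_chart_eq a x h
    exact ⟨w, hw⟩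

theorem HasEntries.leadingRows {T : Type} {A : Subalgebra ℂ (T → ℂ)}
    {M : T → Matrix (Fin n) (Fin n) ℂ} (hM : HasEntries A M) (j : Fin n) :
    HasEntries A fun t => (M t).leadingRows j := by
  intro i l
  simp only [Matrix.leadingRows, Matrix.of_apply]
  split_ifs
  · exact hM i l
  · exact A.algebraMap_mem _

theorem translate_entries (a : Matrix.GeneralLinearGroup (Fin n) ℂ)
    (x : (groupTimesUnstable n p q k).carrier) :
    HasEntries ((groupTimesUnstable n p q k).regularAt x)
      (fun x : Matrix.GeneralLinearGroup (Fin n) ℂ ×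
        (unstableSubspace n p q k : Set (EnhancedSpace n p q)) => (a⁻¹ * x.1).val) :=
  (HasEntries.const a⁻¹.val).mul (groupTimesUnstable_entries x)

theorem isOpen_chartDomain (a : Matrix.GeneralLinearGroup (Fin n) ℂ) :
    IsOpen (chartDomain (p := p) (q := q) (k := k) a) := by
  let f : Fin n → (groupTimesUnstable n p q k).carrier → ℂ := fun j =>
    fun x : Matrix.GeneralLinearGroup (Fin n) ℂ ×
      (unstableSubspace n p q k : Set (EnhancedSpace n p q)) =>
        ((a⁻¹ * x.1).val.leadingRows j).det
  have hreg : ∀ x, (∏ j, f j) ∈ (groupTimesUnstable n p q k).regularAt x := fun x =>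
    prod_mem fun j _ => ((translate_entries a x).leadingRows j).det
  have h := isOpen_ne_zero isOpen_univ fun x _ => hreg x
  have hset : bundleMk ⁻¹' chartDomain a = {x ∈ Set.univ | (∏ j, f j) x ≠ 0} := by
    ext x
    refine bundleMk_mem_chartDomain_iff.trans
      (Iff.trans ?_ (iff_of_eq (true_and ((∏ j, f j) x ≠ 0))).symm)
    have hfx : (∏ j, f j) x = ∏ j, f j x := Finset.prod_apply _ _ _
    rw [hfx, Finset.prod_ne_zero_iff]
    simp [f]
  exact isOpen_coinduced.2 (hset ▸ h)

theorem mem_chartDomain_self (x : Matrix.GeneralLinearGroup (Fin n) ℂ ×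
    (unstableSubspace n p q k : Set (EnhancedSpace n p q))) : bundleMk x ∈ chartDomain x.1 := by
  refine bundleMk_mem_chartDomain_iff.2 fun j => ?_
  have : (1 : Matrix (Fin n) (Fin n) ℂ).IsLowerUnipotent := fun _ _ _ => rfl
  rw [inv_mul_cancel, Units.val_one, this.det_leadingRows]
  exact one_ne_zero

theorem HasEntries.upperFactor {X : FunctionSpace} {x : X.carrier}
    {M : X.carrier → Matrix (Fin n) (Fin n) ℂ} (hM : HasEntries (X.regularAt x) M)
    (hx : ∀ j, ((M x).leadingRows j).det ≠ 0) :
    HasEntries (X.regularAt x) fun t => (M t).upperFactor :=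
  fun i j => (hM.leadingRows j).inv (hx j) i j

/-- The charts are isomorphisms onto open subsets. -/
noncomputable def chartIso (a : Matrix.GeneralLinearGroup (Fin n) ℂ) :
    Iso (affineSpace (ChartModel n p q k)) ((associatedBundle n p q k).subspace (chartDomain a)) where
  toEquiv := Equiv.ofInjective _ (chart_injective a)
  isMorphism := isMorphism_to_subspace.2 (isMorphism_chart a)
  isMorphism_inv := by
    let e := Equiv.ofInjective _ (chart_injective (p := p) (q := q) (k := k) a)
    change IsMorphism ((associatedBundle n p q k).subspace (chartDomain a))
      (affineSpace (ChartModel n p q k)) (fun z : chartDomain a => e.symm z)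
    refine affineSpace.isMorphism_iff.2 fun ℓ z => ?_
    classical
    -- The coordinate is extended by `0` off the chart so that its regularity can be tested on the
    -- bundle, that is, after pull-back to `G × U_k`.
    let F : (associatedBundle n p q k).carrier → ℂ := fun z =>
      if h : z ∈ chartDomain a then ℓ (e.symm ⟨z, h⟩) else 0
    have hF : (fun z : chartDomain a => ℓ (e.symm z)) = F ∘ Subtype.val := by
      funext z
      change _ = F z.1
      simp only [F, dif_pos z.2]
      rfl
    refine (congrFun (congrArg _ hF) z).mpr ?_
    refine (isRegularAt_subspace (isOpen_chartDomain a) z).2 ?_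
    refine ⟨chartDomain a, isOpen_chartDomain a, z.2, fun x hx => ?_⟩
    -- Extending the two parts of `ℓ` to the ambient matrix spaces reduces its regularity to that of
    -- matrix entries.
    obtain ⟨ℓ₁, h₁⟩ := LinearMap.exists_extend (ℓ.comp (LinearMap.inl ℂ _ _))
    obtain ⟨ℓ₂, h₂⟩ := LinearMap.exists_extend (ℓ.comp (LinearMap.inr ℂ _ _))
    have hℓ : ∀ w, ℓ w = ℓ₁ w.1.1 + ℓ₂ w.2.1 := fun w => by
      have e1 := LinearMap.congr_fun h₁ w.1
      have e2 := LinearMap.congr_fun h₂ w.2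
      simp only [LinearMap.comp_apply, Submodule.subtype_apply] at e1 e2
      rw [e1, e2, ← map_add]
      simp
    -- With `c` the upper factor of `a⁻¹ g`, the coordinates of `[g, u]` are `a⁻¹ g c - 1` and `c⁻¹
    -- • u`. Here `H` and `G` are these expressions, which make sense, with junk values, on all of
    -- `G × U_k`.
    let uf : (groupTimesUnstable n p q k).carrier → Matrix (Fin n) (Fin n) ℂ :=
      fun x : Matrix.GeneralLinearGroup (Fin n) ℂ ×
        (unstableSubspace n p q k : Set (EnhancedSpace n p q)) => (a⁻¹ * x.1).val.upperFactor
    let G : (groupTimesUnstable n p q k).carrier → EnhancedSpace n p q :=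
      fun x : Matrix.GeneralLinearGroup (Fin n) ℂ ×
        (unstableSubspace n p q k : Set (EnhancedSpace n p q)) =>
      ((uf x)⁻¹ * x.2.1.1, x.2.1.2.1 * uf x, (uf x)⁻¹ * x.2.1.2.2 * uf x)
    let H : (groupTimesUnstable n p q k).carrier → Matrix (Fin n) (Fin n) ℂ :=
      fun x : Matrix.GeneralLinearGroup (Fin n) ℂ ×
        (unstableSubspace n p q k : Set (EnhancedSpace n p q)) => (a⁻¹ * x.1).val * uf x - 1
    have hx' := bundleMk_mem_chartDomain_iff.1 hx
    have huf : HasEntries ((groupTimesUnstable n p q k).regularAt x) uf :=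
      (translate_entries a x).upperFactor hx'
    have hufdet : (uf x).det ≠ 0 := by
      obtain ⟨c, -, hc, -⟩ := exists_chart_eq a x hx'
      change (Matrix.upperFactor _).det ≠ 0
      rw [← hc]
      exact det_ne_zero c
    have hu := groupTimesUnstable_coords x
    have hG : HasCoords ((groupTimesUnstable n p q k).regularAt x) G :=
      ⟨(huf.inv hufdet).mul hu.fst, hu.snd_fst.mul huf,
        ((huf.inv hufdet).mul hu.snd_snd).mul huf⟩
    have hH : HasEntries ((groupTimesUnstable n p q k).regularAt x) H :=
      ((translate_entries a x).mul huf).sub (HasEntries.const 1)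
    refine (groupTimesUnstable n p q k).congr ?_
      (add_mem (hH.dual_mem ℓ₁) (hG.dual_mem ℓ₂) : _ ∈ (groupTimesUnstable n p q k).regularAt x)
    filter_upwards [((isOpen_chartDomain a).preimage
      (isMorphism_bundleMk (p := p) (q := q) (k := k)).continuous).eventually_mem hx] with y hy
    obtain ⟨c, w, hc, hw, h1, h2⟩ := exists_chart_eq a y (bundleMk_mem_chartDomain_iff.1 hy)
    have hFy : F (bundleMk y) = ℓ w := by
      refine (dif_pos hy).trans (congrArg ℓ ?_)
      rw [Equiv.symm_apply_eq]
      exact Subtype.ext hw.symm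
    have hcy : c.val = uf y := hc
    have hHy : H y = w.1.1 := by
      rw [h1, hc]
    have hGy : G y = w.2.1 := by
      rw [h2]
      refine Prod.ext ?_ (Prod.ext ?_ ?_)
      · rw [smul_fst, Matrix.coe_units_inv, hcy]
      · rw [smul_snd_fst, inv_inv, hcy]
      · rw [smul_snd_snd, inv_inv, Matrix.coe_units_inv, hcy]
    change ℓ₁ (H y) + ℓ₂ (G y) = F (bundleMk y)
    rw [hFy, hℓ, hHy, hGy]

end Charts

/-! ### The associated bundle as a nonsingular irreducible variety -/

namespace FunctionSpace

/-- Tensor functions are built from functions on the whole space that are only required to be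
regular on an open set; extension by zero supplies them. -/
theorem IsRegularOn.exists_extend {X : FunctionSpace} {U : Set X.carrier} (hU : IsOpen U) {f : U → ℂ}
    (hf : ∀ u, (X.subspace U).IsRegularAt f u) :
    ∃ F : X.carrier → ℂ, X.IsRegularOn F U ∧ ∀ u : U, F u = f u := by
  have h : (Function.extend Subtype.val f 0 : X.carrier → ℂ) ∘ Subtype.val = f :=
    funext fun u => Subtype.val_injective.extend_apply _ _ u
  refine ⟨Function.extend Subtype.val f 0, fun x hx => ?_, congrFun h⟩
  refine (isRegularAt_subspace hU ⟨x, hx⟩).1 ?_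
  exact h.symm ▸ hf ⟨x, hx⟩

end FunctionSpace

section Bundle

open FunctionSpace EnhancedSpace

variable {n p q k : ℕ}

/-- The pairs `(m, u)` with `m` invertible. -/
def invertiblePairs (n p q k : ℕ) :
    Set (affineSpace (Matrix (Fin n) (Fin n) ℂ × unstableSubspace n p q k)).carrier :=
  {w : Matrix (Fin n) (Fin n) ℂ × unstableSubspace n p q k | w.1.det ≠ 0}

theorem isOpen_invertiblePairs : IsOpen (invertiblePairs n p q k) := by
  have h : HasEntries (polyFunctions (Matrix (Fin n) (Fin n) ℂ × unstableSubspace n p q k))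
      fun w => w.1 := fun i j =>
    dual_mem_polyFunctions (V := Matrix (Fin n) (Fin n) ℂ × unstableSubspace n p q k)
      ((Matrix.entryLinearMap ℂ ℂ i j).comp (LinearMap.fst ℂ _ _))
  exact affineSpace.isOpen_basic h.det

theorem isIrreducible_invertiblePairs : IsIrreducible (invertiblePairs n p q k) :=
  ⟨⟨((1, 0) : Matrix (Fin n) (Fin n) ℂ × unstableSubspace n p q k), by
      change (1 : Matrix (Fin n) (Fin n) ℂ).det ≠ 0
      rw [Matrix.det_one]
      exact one_ne_zero⟩,
    (IrreducibleSpace.isIrreducible_univ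
      (affineSpace (Matrix (Fin n) (Fin n) ℂ × unstableSubspace n p q k)).carrier).isPreirreducible.open_subset
      isOpen_invertiblePairs (Set.subset_univ _)⟩

/-- `(m, u) ↦ [m, u]`. -/
noncomputable def pairsToBundle (w : invertiblePairs n p q k) :
    (associatedBundle n p q k).carrier :=
  bundleMk (Matrix.GeneralLinearGroup.mkOfDetNeZero _ w.2, w.1.2)

theorem isMorphism_pairsToBundle :
    IsMorphism ((affineSpace (Matrix (Fin n) (Fin n) ℂ × unstableSubspace n p q k)).subspace
      (invertiblePairs n p q k)) (associatedBundle n p q k) pairsToBundle := by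
  have hv := affineSpace.isMorphism_iff.1
    (isMorphism_val (X := affineSpace (Matrix (Fin n) (Fin n) ℂ × unstableSubspace n p q k))
      (invertiblePairs n p q k))
  refine isMorphism_bundleMk.comp (isMorphism_to_groupTimesUnstable (fun x i j => ?_)
    fun x => HasCoords.of_dual fun ℓ => ?_)
  · exact hv ((Matrix.entryLinearMap ℂ ℂ i j).comp (LinearMap.fst ℂ _ _)) x
  · exact hv (ℓ.comp ((unstableSubspace n p q k).subtype.comp (LinearMap.snd ℂ _ _))) x

theorem pairsToBundle_surjective :
    Function.Surjective (pairsToBundle (n := n) (p := p) (q := q) (k := k)) := fun z => by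
  obtain ⟨⟨g, u⟩, rfl⟩ := bundleMk_surjective z
  exact ⟨⟨((g.val, u) : Matrix (Fin n) (Fin n) ℂ × unstableSubspace n p q k), det_ne_zero g⟩,
    congrArg bundleMk (Prod.ext (Units.ext rfl) rfl)⟩

/-- The bundle is a continuous image of a nonempty open subset of an affine space. -/
instance associatedBundle.irreducibleSpace : IrreducibleSpace (associatedBundle n p q k).carrier := by
  have := (Subtype.irreducibleSpace (isIrreducible_invertiblePairs (n := n) (p := p) (q := q) (k := k)))
  have h := (IrreducibleSpace.isIrreducible_univ (invertiblePairs n p q k)).image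
    (Y := (associatedBundle n p q k).carrier) pairsToBundle
    isMorphism_pairsToBundle.continuous.continuousOn
  rw [Set.image_univ, pairsToBundle_surjective.range_eq] at h
  exact (irreducibleSpace_def _).2 h

/-- Quasi-compactness, inherited from a noetherian space, cuts the cover by all charts down to a
finite one. -/
instance associatedBundle.compactSpace : CompactSpace (associatedBundle n p q k).carrier := by
  have : TopologicalSpace.NoetherianSpace (invertiblePairs n p q k) :=
    TopologicalSpace.NoetherianSpace.set _
  exact ⟨pairsToBundle_surjective.range_eq ▸
    isCompact_range (X := invertiblePairs n p q k) isMorphism_pairsToBundle.continuous⟩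

theorem associatedBundle.isNonsingular : (associatedBundle n p q k).IsNonsingular := by
  refine isNonsingular_of_cover (affineSpace.isNonsingular (V := ChartModel n p q k)) fun z => ?_
  obtain ⟨x, rfl⟩ := bundleMk_surjective z
  exact ⟨_, isOpen_chartDomain x.1, mem_chartDomain_self x, ⟨(chartIso x.1).symm⟩⟩

/-- A section of `G × U_k → G ×_B U_k` over the domain of a chart. -/
noncomputable def chartSection (a : Matrix.GeneralLinearGroup (Fin n) ℂ)
    (z : chartDomain (p := p) (q := q) (k := k) a) : Matrix.GeneralLinearGroup (Fin n) ℂ ×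
      (unstableSubspace n p q k : Set (EnhancedSpace n p q)) :=
  chartLift a ((chartIso a).invFun z)

theorem bundleMk_chartSection (a : Matrix.GeneralLinearGroup (Fin n) ℂ)
    (z : chartDomain (p := p) (q := q) (k := k) a) : bundleMk (chartSection a z) = z.1 :=
  congrArg Subtype.val ((chartIso a).right_inv z)

theorem isMorphism_chartSection (a : Matrix.GeneralLinearGroup (Fin n) ℂ) :
    IsMorphism ((associatedBundle n p q k).subspace (chartDomain a)) (groupTimesUnstable n p q k)
      (chartSection a) :=
  (isMorphism_chartLift a).comp (chartIso a).isMorphism_inv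

/-- Distinct points `z`, `z'` with different images in `W` are told apart by a linear form.
Otherwise they differ in `G / B`: for local sections `s`, `t` over charts around them, some entry of
`s(z)⁻¹ t(z')` below the diagonal is nonzero. This entry is a sum of products of a function of `z`
and one of `z'`, and it vanishes on the diagonal, where `s⁻¹ t` lies in `B`. -/
theorem associatedBundle.separated :
    IsClosed {z : (prod (associatedBundle n p q k) (associatedBundle n p q k)).carrier |
      z.1 = z.2} := by
  refine isClosed_diagonal_of_tensorFunctions fun z z' hne => ?_
  by_cases hψ : (collapsingMap n p q k z).1 = (collapsingMap n p q k z').1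
  · obtain ⟨x, rfl⟩ := bundleMk_surjective z
    obtain ⟨y, rfl⟩ := bundleMk_surjective z'
    have hx := mem_chartDomain_self x
    have hy := mem_chartDomain_self y
    set s := chartSection x.1 with hs
    set t := chartSection y.1 with ht
    have key : (s ⟨_, hx⟩).1⁻¹ * (t ⟨_, hy⟩).1 ∉ upperBorel n := fun hB => by
      have e1 := bundleMk_chartSection x.1 ⟨_, hx⟩
      have e2 := bundleMk_chartSection y.1 ⟨_, hy⟩
      refine hne (e1.symm.trans (Eq.trans (bundleMk_eq_iff.2 ⟨hB, ?_⟩) e2))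
      rw [← collapsingMap_bundleMk, ← collapsingMap_bundleMk, e1, e2, hψ]
    obtain ⟨i, j, hij, hne'⟩ : ∃ i j, j < i ∧ ((s ⟨_, hx⟩).1⁻¹ * (t ⟨_, hy⟩).1).val i j ≠ 0 := by
      by_contra! h
      exact key fun i j hij => h i j hij
    have hA : ∀ l, ∃ A : (associatedBundle n p q k).carrier → ℂ,
        (associatedBundle n p q k).IsRegularOn A (chartDomain x.1) ∧
        ∀ u : chartDomain x.1, A u = (s u).1⁻¹.val i l := fun l =>
      IsRegularOn.exists_extend (isOpen_chartDomain x.1) fun u =>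
        (inv_entries (entries_of_isMorphism (isMorphism_fst.comp (isMorphism_chartSection x.1)) u)) i l
    have hB : ∀ l, ∃ B : (associatedBundle n p q k).carrier → ℂ,
        (associatedBundle n p q k).IsRegularOn B (chartDomain y.1) ∧
        ∀ u : chartDomain y.1, B u = (t u).1.val l j := fun l =>
      IsRegularOn.exists_extend (isOpen_chartDomain y.1) fun u =>
        (entries_of_isMorphism (isMorphism_fst.comp (isMorphism_chartSection y.1)) u) l j
    choose A hA hA' using hA
    choose B hB hB' using hB
    have hP : ∀ z z', (hz : z ∈ chartDomain x.1) → (hz' : z' ∈ chartDomain y.1) →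
        (∑ l, (A l ∘ Prod.fst) * (B l ∘ Prod.snd) :
          (associatedBundle n p q k).carrier × (associatedBundle n p q k).carrier → ℂ) (z, z') =
        ((s ⟨z, hz⟩).1⁻¹ * (t ⟨z', hz'⟩).1).val i j := fun z z' hz hz' => by
      rw [Finset.sum_apply, Units.val_mul, Matrix.mul_apply]
      exact Finset.sum_congr rfl fun l _ => congrArg₂ (· * ·) (hA' l ⟨z, hz⟩) (hB' l ⟨z', hz'⟩)
    refine ⟨_, _, isOpen_chartDomain x.1, isOpen_chartDomain y.1, hx, hy,
      ∑ l, (A l ∘ Prod.fst) * (B l ∘ Prod.snd), sum_mem fun l _ => mul_mem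
        (Algebra.subset_adjoin (Or.inl ⟨_, hA l, rfl⟩))
        (Algebra.subset_adjoin (Or.inr ⟨_, hB l, rfl⟩)), ?_, ?_⟩
    · rw [hP _ _ hx hy]
      exact hne'
    · rintro z ⟨hz, hz'⟩
      rw [hP _ _ hz hz']
      refine (bundleMk_eq_iff.1 ?_).1 i j hij
      rw [hs, ht, bundleMk_chartSection, bundleMk_chartSection]
  · obtain ⟨ℓ, hℓ⟩ : ∃ ℓ : Module.Dual ℂ (EnhancedSpace n p q),
        ℓ (collapsingMap n p q k z).1 ≠ ℓ (collapsingMap n p q k z').1 := by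
      by_contra! h
      exact hψ (Module.eval_apply_injective (V := EnhancedSpace n p q) ℂ (LinearMap.ext h))
    let f : (associatedBundle n p q k).carrier → ℂ := fun z => ℓ (collapsingMap n p q k z).1
    have hf : ∀ z, (associatedBundle n p q k).IsRegularAt f z :=
      affineSpace.isMorphism_iff.1 ((isMorphism_val (X := enhancedVariety n p q) _).comp
        (isMorphism_collapsingMap (n := n) (p := p) (q := q) (k := k))) ℓ
    refine ⟨Set.univ, Set.univ, isOpen_univ, isOpen_univ, trivial, trivial,
      f ∘ Prod.fst - f ∘ Prod.snd, sub_mem (Algebra.subset_adjoin (Or.inl ⟨f, fun z _ => hf z, rfl⟩))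
        (Algebra.subset_adjoin (Or.inr ⟨f, fun z _ => hf z, rfl⟩)), sub_ne_zero.2 hℓ,
      fun z _ => sub_self _⟩

theorem associatedBundle.isVariety : (associatedBundle n p q k).IsVariety where
  affine_cover := by
    obtain ⟨t, ht⟩ := isCompact_univ.elim_finite_subcover
      (fun a : Matrix.GeneralLinearGroup (Fin n) ℂ => chartDomain (p := p) (q := q) (k := k) a)
      isOpen_chartDomain fun z _ => by
        obtain ⟨x, rfl⟩ := bundleMk_surjective z
        exact Set.mem_iUnion.2 ⟨x.1, mem_chartDomain_self x⟩
    refine ⟨chartDomain '' t, t.finite_toSet.image _, ?_, ?_⟩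
    · rw [Set.sUnion_image]
      exact Set.eq_univ_of_univ_subset (by simpa using ht)
    · rintro _ ⟨a, -, rfl⟩
      exact ⟨isOpen_chartDomain a, affineSpace.isAffine.of_iso (chartIso a).symm⟩
  separated := associatedBundle.separated

end Bundle

/-! ### Properness of the collapsing map -/

section Properness

open FunctionSpace EnhancedSpace

theorem Submodule.isClosed_affineSpace {V : Type} [AddCommGroup V] [Module ℂ V]
    [FiniteDimensional ℂ V] (U : Submodule ℂ V) :
    IsClosed[(affineSpace V).top] (U : Set V) := by
  refine affineSpace.isClosed_of_vanishing fun x hx => ?_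
  by_contra hxU
  obtain ⟨φ, h1, h2⟩ := U.exists_le_ker_of_notMem hxU
  exact h1 (hx ⟨φ, dual_mem_polyFunctions φ⟩ fun y hy => h2 hy)

variable {n p q k : ℕ}

/-- The structure on `GL_n × ℂᵐ` induced from the affine space of all pairs. -/
def groupTimesAffine (n m : ℕ) : FunctionSpace :=
  (affineSpace ((Fin n × Fin n) ⊕ Fin m → ℂ)).induced
    (S := Matrix.GeneralLinearGroup (Fin n) ℂ × (Fin m → ℂ)) fun x => matrixPoint x.1.val x.2

theorem groupTimesAffine_coordinate {m : ℕ} (i : (Fin n × Fin n) ⊕ Fin m)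
    (x : (groupTimesAffine n m).carrier) : (groupTimesAffine n m).IsRegularAt
      (fun x : Matrix.GeneralLinearGroup (Fin n) ℂ × (Fin m → ℂ) => matrixPoint x.1.val x.2 i) x :=
  (affineSpace.isMorphism_iff (X := groupTimesAffine n m)).1 (isMorphism_induced_map
    (X := affineSpace ((Fin n × Fin n) ⊕ Fin m → ℂ))
    (fun x : Matrix.GeneralLinearGroup (Fin n) ℂ × (Fin m → ℂ) => matrixPoint x.1.val x.2))
    (LinearMap.proj i) x

theorem isMorphism_groupTimesAffine_fst {m : ℕ} :
    IsMorphism (groupTimesAffine n m) (glVariety n)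
      (fun x : Matrix.GeneralLinearGroup (Fin n) ℂ × (Fin m → ℂ) => x.1) :=
  isMorphism_to_glVariety fun x i j => groupTimesAffine_coordinate (Sum.inl (i, j)) x

theorem affineSpace.isMorphism_pi_iff {σ : Type} [Finite σ] {X : FunctionSpace}
    {φ : X.carrier → σ → ℂ} :
    IsMorphism X (affineSpace (σ → ℂ)) φ ↔ ∀ i x, X.IsRegularAt (fun x => φ x i) x := by
  have := Fintype.ofFinite σ
  refine isMorphism_iff.trans ⟨fun h i => h (LinearMap.proj i), fun h ℓ x => ?_⟩
  classical
  have : (fun x => ℓ (φ x)) = ∑ i, algebraMap ℂ (X.carrier → ℂ) (ℓ (Pi.single i 1)) *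
      fun x => φ x i := by
    funext x
    rw [Finset.sum_apply, LinearMap.pi_apply_eq_sum_univ]
    refine Finset.sum_congr rfl fun i _ => ?_
    rw [smul_eq_mul, mul_comm]
    have hs : (fun j => if i = j then (1 : ℂ) else 0) = Pi.single i 1 := funext fun j => by
      rw [Pi.single_apply]
      simp [eq_comm]
    rw [hs]
    rfl
  refine mem_regularAt.1 (this ▸ sum_mem fun i _ => mul_mem (Subalgebra.algebraMap_mem _ _) (h i x))

theorem isMorphism_groupTimesAffine_snd {m : ℕ} :
    IsMorphism (groupTimesAffine n m) (affineSpace (Fin m → ℂ))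
      (fun x : Matrix.GeneralLinearGroup (Fin n) ℂ × (Fin m → ℂ) => x.2) :=
  affineSpace.isMorphism_pi_iff.2 fun i x => groupTimesAffine_coordinate (Sum.inr i) x

theorem mem_of_isClosed_groupTimesAffine {m : ℕ} {S : Set (groupTimesAffine n m).carrier}
    (hS : IsClosed S) (g : Matrix.GeneralLinearGroup (Fin n) ℂ) (z : Fin m → ℂ)
    (h : ∀ f : MvPolynomial ((Fin n × Fin n) ⊕ Fin m) ℂ,
      (∀ x : Matrix.GeneralLinearGroup (Fin n) ℂ × (Fin m → ℂ), x ∈ S →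
        MvPolynomial.aeval (R := ℂ) (matrixPoint x.1.val x.2) f = 0) →
      MvPolynomial.aeval (R := ℂ) (matrixPoint g.val z) f = 0) :
    ((g, z) : Matrix.GeneralLinearGroup (Fin n) ℂ × (Fin m → ℂ)) ∈ S := by
  obtain ⟨C, hC, rfl⟩ := isClosed_induced_iff.1 hS
  refine affineSpace.mem_of_vanishing (V := (Fin n × Fin n) ⊕ Fin m → ℂ) hC fun ⟨f, hf⟩ hfC => ?_
  obtain ⟨P, rfl⟩ := mem_polyFunctions_pi.1 hf
  simp only [MvPolynomial.aeval_eq_eval] at h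
  exact h P fun x hx => hfC _ hx

/-- The projection to `ℂᵐ` of a closed subset of `GL_n × ℂᵐ` stable under the Borel subgroup is
closed. -/
theorem isClosed_image_snd_of_upperBorel {m : ℕ} {S : Set (groupTimesAffine n m).carrier}
    (hS : IsClosed S) (hB : ∀ (g : Matrix.GeneralLinearGroup (Fin n) ℂ) (z : Fin m → ℂ),
      ∀ b ∈ upperBorel n, (g, z) ∈ S → (g * b, z) ∈ S) :
    IsClosed[(affineSpace (Fin m → ℂ)).top]
      {z | ∃ g : Matrix.GeneralLinearGroup (Fin n) ℂ, (g, z) ∈ S} := by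
  refine affineSpace.isClosed_of_vanishing (V := Fin m → ℂ) fun z hz => ?_
  refine exists_mem_of_mem_closure_image
    (fun g z h => mem_of_isClosed_groupTimesAffine hS g z h) hB z fun a ha => ?_
  rw [MvPolynomial.aeval_eq_eval]
  refine hz ⟨_, mem_polyFunctions_pi.2 ⟨a, rfl⟩⟩ fun y ⟨g, hg⟩ => ?_
  simpa only [MvPolynomial.aeval_eq_eval] using ha _ hg

theorem inv_smul_mem_unstableSubspace_mul {g b : Matrix.GeneralLinearGroup (Fin n) ℂ}
    (hb : b ∈ upperBorel n) {w : EnhancedSpace n p q} (h : g⁻¹ • w ∈ unstableSubspace n p q k) :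
    (g * b)⁻¹ • w ∈ unstableSubspace n p q k := by
  rw [mul_inv_rev, mul_smul]
  exact smul_mem_unstableSubspace ((upperBorel n).inv_mem hb) h

/-- The image in an affine variety of a closed subset of a fibre product with `G ×_B U_k` is
closed. -/
theorem isClosed_image_fiberProduct {m : ℕ} {A : Set (affineSpace (Fin m → ℂ)).carrier}
    (hA : IsClosed A) {H : A → EnhancedSpace n p q}
    (hH : IsMorphism ((affineSpace (Fin m → ℂ)).subspace A) (enhancedVariety n p q) H)
    {Z : FunctionSpace} {θ : A → Z.carrier}
    (hθ : IsMorphism ((affineSpace (Fin m → ℂ)).subspace A) Z θ)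
    {T : Set (prod (associatedBundle n p q k) Z).carrier} (hT : IsClosed T) :
    IsClosed {y : ((affineSpace (Fin m → ℂ)).subspace A).carrier |
      ∃ x, (x, θ y) ∈ T ∧ (collapsingMap n p q k x).1 = H y} := by
  -- The fibre product is replaced by the set `S` of pairs `(g, z)` with `z ∈ A`, `g⁻¹ • H z ∈ U_k`
  -- and `([g, g⁻¹ • H z], θ z) ∈ T`. The conditions are imposed one after the other, because `H` is
  -- only defined on `A` and the class only where the second condition holds.
  let N := groupTimesAffine n m
  let D₁ : Set N.carrier := (fun x : Matrix.GeneralLinearGroup (Fin n) ℂ × (Fin m → ℂ) => x.2) ⁻¹' A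
  have hD₁ : IsClosed D₁ := hA.preimage isMorphism_groupTimesAffine_snd.continuous
  have hv₁ := isMorphism_val (X := N) D₁
  let y₁ : D₁ → A := fun x => ⟨x.1.2, x.2⟩
  have hy₁ : IsMorphism (N.subspace D₁) ((affineSpace (Fin m → ℂ)).subspace A) y₁ :=
    isMorphism_to_subspace.2 (isMorphism_groupTimesAffine_snd.comp hv₁)
  let w₁ : D₁ → EnhancedSpace n p q := fun x => x.1.1⁻¹ • H (y₁ x)
  have hg₁ : IsMorphism (N.subspace D₁) (glVariety n) fun x : D₁ => x.1.1 :=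
    isMorphism_groupTimesAffine_fst.comp hv₁
  have hw₁ : IsMorphism (N.subspace D₁) (enhancedVariety n p q) w₁ :=
    isMorphism_to_enhanced.2 fun x => (isMorphism_to_enhanced.1 (hH.comp hy₁) x).smul
      (g := fun x : D₁ => x.1.1⁻¹) (inv_entries (entries_of_isMorphism hg₁ x))
      (by simpa only [inv_inv] using entries_of_isMorphism hg₁ x)
  let D₂ : Set (N.subspace D₁).carrier := w₁ ⁻¹' (unstableSubspace n p q k)
  have hD₂ : IsClosed D₂ :=
    (Submodule.isClosed_affineSpace (unstableSubspace n p q k)).preimage hw₁.continuous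
  have hv₂ := isMorphism_val (X := N.subspace D₁) D₂
  let ω : D₂ → Matrix.GeneralLinearGroup (Fin n) ℂ ×
      (unstableSubspace n p q k : Set (EnhancedSpace n p q)) := fun x => (x.1.1.1, ⟨w₁ x.1, x.2⟩)
  have hω : IsMorphism ((N.subspace D₁).subspace D₂) (groupTimesUnstable n p q k) ω :=
    IsMorphism.prodMk (hg₁.comp hv₂) (isMorphism_to_subspace.2 (hw₁.comp hv₂))
  let t : D₂ → (associatedBundle n p q k).carrier × Z.carrier := fun x =>
    (bundleMk (ω x), θ (y₁ x.1))
  have ht : IsMorphism ((N.subspace D₁).subspace D₂) (prod (associatedBundle n p q k) Z) t :=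
    IsMorphism.prodMk (isMorphism_bundleMk.comp hω) (hθ.comp (hy₁.comp hv₂))
  have hS₂ : IsClosed (t ⁻¹' T : Set ((N.subspace D₁).subspace D₂).carrier) :=
    hT.preimage ht.continuous
  have hS₁ := hD₂.isClosedEmbedding_subtypeVal.isClosedMap _ hS₂
  have hS := hD₁.isClosedEmbedding_subtypeVal.isClosedMap _ hS₁
  set S : Set (Matrix.GeneralLinearGroup (Fin n) ℂ × (Fin m → ℂ)) :=
    Subtype.val '' (Subtype.val '' (t ⁻¹' T)) with hSdef
  have hmem : ∀ (g : Matrix.GeneralLinearGroup (Fin n) ℂ) (z : Fin m → ℂ), (g, z) ∈ S ↔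
      ∃ (hz : z ∈ A) (hu : g⁻¹ • H ⟨z, hz⟩ ∈ unstableSubspace n p q k),
        (bundleMk (g, ⟨g⁻¹ • H ⟨z, hz⟩, hu⟩), θ ⟨z, hz⟩) ∈ T := by
    intro g z
    constructor
    · rintro ⟨_, ⟨x, hx, rfl⟩, h⟩
      obtain ⟨⟨⟨g', z'⟩, hz⟩, hu⟩ := x
      obtain ⟨rfl, rfl⟩ := Prod.ext_iff.1 h
      exact ⟨hz, hu, hx⟩
    · rintro ⟨hz, hu, h⟩
      exact ⟨_, ⟨⟨⟨(g, z), hz⟩, hu⟩, h, rfl⟩, rfl⟩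
  -- A point `[g, u]` over `H y` necessarily has `u = g⁻¹ • H y`, so `g` alone parametrizes the
  -- fibre.
  have himage : ∀ y : A, (∃ x, (x, θ y) ∈ T ∧ (collapsingMap n p q k x).1 = H y) ↔
      ∃ g, (g, y.1) ∈ S := by
    intro y
    constructor
    · rintro ⟨x, hx, hxy⟩
      obtain ⟨⟨g, u⟩, rfl⟩ := bundleMk_surjective x
      have hu : g⁻¹ • H y = u.1 := inv_smul_eq_iff.2 hxy.symm
      exact ⟨g, (hmem g y.1).2 ⟨y.2, hu ▸ u.2,
        (congrArg (fun u => (bundleMk (g, u), θ y) ∈ T) (Subtype.ext hu.symm)).mp hx⟩⟩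
    · rintro ⟨g, hg⟩
      obtain ⟨hz, hu, h⟩ := (hmem g y.1).1 hg
      refine ⟨_, h, ?_⟩
      rw [collapsingMap_bundleMk]
      exact smul_inv_smul g (H y : EnhancedSpace n p q)
  -- `S` is stable under `B` since `(g b, (g b)⁻¹ • H z)` and `(g, g⁻¹ • H z)` have the same class.
  have hC := isClosed_image_snd_of_upperBorel hS fun g z b hb h => by
    obtain ⟨hz, hu, hT'⟩ := (hmem g z).1 h
    refine (hmem _ _).2 ⟨hz, inv_smul_mem_unstableSubspace_mul hb hu, ?_⟩
    refine (congrArg (fun x => (x, θ ⟨z, hz⟩) ∈ T) (bundleMk_eq_iff.2 ⟨?_, ?_⟩)).mp hT'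
    · simpa using hb
    · simp only [smul_inv_smul]
  have hset : {y : A | ∃ x, (x, θ y) ∈ T ∧ (collapsingMap n p q k x).1 = H y} =
      Subtype.val ⁻¹' {z | ∃ g : Matrix.GeneralLinearGroup (Fin n) ℂ, (g, z) ∈ S} :=
    Set.ext himage
  exact hset ▸ hC.preimage (isMorphism_val (X := affineSpace (Fin m → ℂ)) A).continuous

/-- Closedness is local on `Z`, so `Z` may be replaced by an affine open subset, a closed subset of
some `ℂᵐ`, where `isClosed_image_fiberProduct` applies. -/
theorem isProperMorphism_collapsingMap :
    IsProperMorphism (associatedBundle n p q k) (nullComponentVariety n p q k)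
      (collapsingMap n p q k) := by
  refine ⟨isMorphism_collapsingMap, fun Z h hZ hh T hT => ?_⟩
  obtain ⟨𝒰, -, hcover, h𝒰⟩ := hZ.affine_cover
  refine ⟨isOpen_iff_mem_nhds.2 fun z hz => ?_⟩
  obtain ⟨U, hU, hzU⟩ := Set.mem_sUnion.1 (hcover ▸ Set.mem_univ z : z ∈ ⋃₀ 𝒰)
  obtain ⟨hUo, m, A, hA, ⟨e⟩⟩ := h𝒰 U hU
  have hθ : IsMorphism ((affineSpace (Fin m → ℂ)).subspace A) Z fun y : A => (e.invFun y : U).1 :=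
    (isMorphism_val U).comp e.isMorphism_inv
  have hcl := isClosed_image_fiberProduct hA ((isMorphism_val (X := enhancedVariety n p q)
    (nullComponent n p q k)).comp (hh.comp hθ)) hθ hT
  have hset : e.toFun ⁻¹' {y | ∃ x, (x, (e.invFun y : U).1) ∈ T ∧
      (collapsingMap n p q k x).1 = (h (e.invFun y : U).1).1} =
      {u : U | ∃ x, (x, u.1) ∈ T ∧ collapsingMap n p q k x = h u.1} := by
    ext u
    have hu : e.invFun (e.toFun u) = u := e.left_inv u
    simp only [Set.mem_preimage, Set.mem_ofPred_eq, hu]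
    exact exists_congr fun x => and_congr_right fun _ => Subtype.ext_iff.symm
  have hcl' : IsClosed {u : U | ∃ x, (x, u.1) ∈ T ∧ collapsingMap n p q k x = h u.1} :=
    hset ▸ hcl.preimage e.isMorphism.continuous
  refine Filter.mem_of_superset ((hUo.isOpenEmbedding_subtypeVal.isOpenMap _
    hcl'.isOpen_compl).mem_nhds ⟨⟨z, hzU⟩, hz, rfl⟩) ?_
  rintro _ ⟨u, hu, rfl⟩
  exact hu

/-- Properness over `C_k` says nothing about the position of `C_k` in `W`. Instead, the projection
statement is applied over the base `W`, identified with a coordinate space, with `T` the whole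
product. -/
theorem isClosed_nullComponent : IsClosed (nullComponent n p q k) := by
  let e : EnhancedSpace n p q ≃ₗ[ℂ] (Fin (Module.finrank ℂ (EnhancedSpace n p q)) → ℂ) :=
    (Module.finBasis ℂ (EnhancedSpace n p q)).equivFun
  let e' := affineSpace.isoOfLinearEquiv e
  have h := isClosed_image_fiberProduct (k := k) isClosed_univ
    (e'.isMorphism_inv.comp (isMorphism_val Set.univ)) IsMorphism.id isClosed_univ
  have h' := h.preimage ((isoSubspaceUniv _).isMorphism_inv.comp e'.isMorphism).continuous
  refine (congrArg (fun S : Set (enhancedVariety n p q).carrier => IsClosed S)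
    (Set.ext fun w => ?_)).mp h'
  have hw : e'.invFun (e'.toFun w) = w := e'.left_inv w
  constructor
  · rintro ⟨x, -, hx⟩
    exact (hx.trans hw) ▸ (collapsingMap n p q k x).2
  · intro hC
    obtain ⟨x, hx⟩ := collapsingMap_surjective ⟨w, hC⟩
    exact ⟨x, trivial, (congrArg Subtype.val hx).trans hw.symm⟩

end Properness

/-! ### Birationality over the locus of cyclic vectors -/

section Birational

open FunctionSpace EnhancedSpace

variable {n p q k : ℕ}

theorem HasEntries.krylovMatrix {T : Type} {A : Subalgebra ℂ (T → ℂ)}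
    {M : T → Matrix (Fin n) (Fin n) ℂ} (hM : HasEntries A M) (w : Fin n → ℂ) :
    HasEntries A fun t => _root_.krylovMatrix (M t) w :=
  fun i _ => ((hM.pow _).mul (HasEntries.const (Matrix.of fun i (_ : Fin 1) => w i))) i 0

theorem EnhancedSpace.HasCoords.inv_smul {X : FunctionSpace} {x : X.carrier}
    {w : X.carrier → EnhancedSpace n p q} (hw : HasCoords (X.regularAt x) w)
    {g : X.carrier → Matrix.GeneralLinearGroup (Fin n) ℂ}
    (hg : HasEntries (X.regularAt x) fun t => (g t).val) :
    HasCoords (X.regularAt x) fun t => (g t)⁻¹ • w t :=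
  hw.smul (inv_entries hg) (by simpa only [inv_inv] using hg)

theorem nullComponent_coords (x : (nullComponentVariety n p q k).carrier) :
    HasCoords ((nullComponentVariety n p q k).regularAt x)
      (fun x : nullComponent n p q k => (x.1 : EnhancedSpace n p q)) :=
  isMorphism_to_enhanced.1 (isMorphism_val (X := enhancedVariety n p q) _) x

instance nullComponentVariety.irreducibleSpace :
    IrreducibleSpace (nullComponentVariety n p q k).carrier := by
  have h := (IrreducibleSpace.isIrreducible_univ (associatedBundle n p q k).carrier).image
    (Y := (nullComponentVariety n p q k).carrier) (collapsingMap n p q k)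
    isMorphism_collapsingMap.continuous.continuousOn
  rw [Set.image_univ, collapsingMap_surjective.range_eq] at h
  exact (irreducibleSpace_def _).2 h

/-- The points `(ξ, η, v)` of `C_k` such that `w` is a cyclic vector of `v`. -/
def krylovLocus (n p q k : ℕ) (w : Fin n → ℂ) : Set (nullComponentVariety n p q k).carrier :=
  {x : nullComponent n p q k | (krylovMatrix (x.1 : EnhancedSpace n p q).2.2 w).det ≠ 0}

theorem isOpen_krylovLocus (w : Fin n → ℂ) : IsOpen (krylovLocus n p q k w) := by
  have h := isOpen_ne_zero (X := nullComponentVariety n p q k) isOpen_univ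
    fun x _ => ((nullComponent_coords x).snd_snd.krylovMatrix w).det
  exact (congrArg _ (Set.ext fun x => iff_of_eq (true_and _))).mp h

/-- The points `(ξ, η, v)` of `C_k` such that `v` has a cyclic vector. -/
def cyclicLocus (n p q k : ℕ) : Set (nullComponentVariety n p q k).carrier :=
  ⋃ w, krylovLocus n p q k w

theorem isOpen_cyclicLocus : IsOpen (cyclicLocus n p q k) :=
  isOpen_iUnion isOpen_krylovLocus

theorem exists_krylovMatrix_eq_mul (g : Matrix.GeneralLinearGroup (Fin n) ℂ)
    (u : EnhancedSpace n p q) (w : Fin n → ℂ) :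
    krylovMatrix (g • u).2.2 w = g.val * krylovMatrix u.2.2 (g⁻¹.val.mulVec w) := by
  rw [← krylovMatrix_conj, smul_snd_snd, Matrix.mulVec_mulVec, ← Units.val_mul, mul_inv_cancel,
    Units.val_one, Matrix.one_mulVec]

/-- If `g u = g' u'`, then `g⁻¹ g'` conjugates one strictly upper triangular matrix with a cyclic
vector to another, so it lies in `B`. -/
theorem injOn_collapsingMap {x y : (associatedBundle n p q k).carrier}
    (hx : collapsingMap n p q k x ∈ cyclicLocus n p q k)
    (h : collapsingMap n p q k x = collapsingMap n p q k y) : x = y := by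
  obtain ⟨⟨g, u⟩, rfl⟩ := bundleMk_surjective x
  obtain ⟨⟨g', u'⟩, rfl⟩ := bundleMk_surjective y
  have h' : g • (u.1 : EnhancedSpace n p q) = g' • u'.1 := congrArg Subtype.val h
  refine bundleMk_eq_iff.2 ⟨?_, h'⟩
  obtain ⟨w, hw⟩ := Set.mem_iUnion.1 hx
  have hw' : (krylovMatrix (g' • (u'.1 : EnhancedSpace n p q)).2.2 w).det ≠ 0 := h' ▸ hw
  rw [exists_krylovMatrix_eq_mul, Matrix.det_mul] at hw'
  have hu : (g⁻¹ * g') • (u'.1 : EnhancedSpace n p q) = u.1 := by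
    rw [mul_smul, ← h', inv_smul_smul]
  refine mem_upperBorel_of_conj (isStrictlyUpper_of_mem u'.2) ?_ (right_ne_zero_of_mul hw')
  rw [← smul_snd_snd, hu]
  exact isStrictlyUpper_of_mem u.2

/-- For `x = g u` the Krylov matrix of `x` is `g` times that of `u`, which is in `B`. So it
represents the same coset as `g`, and it depends polynomially on `x`. -/
theorem krylovMatrix_inv_smul_mem {x : EnhancedSpace n p q} (hx : x ∈ nullComponent n p q k)
    {w : Fin n → ℂ} (hw : (krylovMatrix x.2.2 w).det ≠ 0) :
    (Matrix.GeneralLinearGroup.mkOfDetNeZero _ hw)⁻¹ • x ∈ unstableSubspace n p q k := by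
  obtain ⟨g, u, hu, rfl⟩ := hx
  have hb : g⁻¹ * Matrix.GeneralLinearGroup.mkOfDetNeZero _ hw ∈ upperBorel n := fun i j hij => by
    have : (g⁻¹ * Matrix.GeneralLinearGroup.mkOfDetNeZero _ hw).val =
        krylovMatrix u.2.2 (g⁻¹.val.mulVec w) := by
      change g⁻¹.val * krylovMatrix _ w = _
      rw [exists_krylovMatrix_eq_mul, ← Matrix.mul_assoc, ← Units.val_mul, inv_mul_cancel,
        Units.val_one, Matrix.one_mul]
    rw [this]
    exact krylovMatrix_upper (isStrictlyUpper_of_mem hu) _ i j hij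
  have := smul_mem_unstableSubspace ((upperBorel n).inv_mem hb) hu
  rwa [mul_inv_rev, inv_inv, mul_smul] at this

/-- `ψ_k` is bijective over the points with a cyclic vector. -/
noncomputable def collapsingEquiv (n p q k : ℕ) :
    (collapsingMap n p q k ⁻¹' cyclicLocus n p q k) ≃ cyclicLocus n p q k :=
  Equiv.ofBijective (fun x => ⟨collapsingMap n p q k x.1, x.2⟩)
    ⟨fun x y h => Subtype.ext (injOn_collapsingMap x.2 (congrArg Subtype.val h)), fun y => by
      obtain ⟨x, hx⟩ := collapsingMap_surjective y.1
      exact ⟨⟨x, by rw [Set.mem_preimage, hx]; exact y.2⟩, Subtype.ext hx⟩⟩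

/-- `ψ_k` is an isomorphism over the points with a cyclic vector. -/
noncomputable def collapsingIso (n p q k : ℕ) :
    Iso ((associatedBundle n p q k).subspace (collapsingMap n p q k ⁻¹' cyclicLocus n p q k))
      ((nullComponentVariety n p q k).subspace (cyclicLocus n p q k)) where
  toEquiv := collapsingEquiv n p q k
  isMorphism := isMorphism_to_subspace.2 (isMorphism_collapsingMap.comp (isMorphism_val _))
  isMorphism_inv := by
    refine isMorphism_to_subspace.2 (isMorphism_of_locally fun y => ?_)
    obtain ⟨w, hw⟩ := Set.mem_iUnion.1 y.2
    let D : Set ((nullComponentVariety n p q k).subspace (cyclicLocus n p q k)).carrier :=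
      Subtype.val ⁻¹' krylovLocus n p q k w
    have hD : IsOpen D := (isOpen_krylovLocus w).preimage
      (isMorphism_val (X := nullComponentVariety n p q k) _).continuous
    refine ⟨D, hD, hw, ?_⟩
    -- For a fixed `w` the inverse is `x ↦ [κ x, (κ x)⁻¹ • x]`. Different `w` give the same class,
    -- by injectivity over the cyclic locus.
    let κ : D → Matrix.GeneralLinearGroup (Fin n) ℂ := fun x =>
      Matrix.GeneralLinearGroup.mkOfDetNeZero _ x.2
    let v : D → EnhancedSpace n p q := fun x => x.1.1.1
    have hc : ∀ x : D, HasCoords ((((nullComponentVariety n p q k).subspace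
        (cyclicLocus n p q k)).subspace D).regularAt x)
        v := isMorphism_to_enhanced.1
      ((isMorphism_val (X := enhancedVariety n p q) _).comp
        ((isMorphism_val (X := nullComponentVariety n p q k) _).comp (isMorphism_val D)))
    have hκ : ∀ x : D, HasEntries ((((nullComponentVariety n p q k).subspace
        (cyclicLocus n p q k)).subspace D).regularAt x) fun x : D => (κ x).val :=
      fun x => (hc x).snd_snd.krylovMatrix w
    let ω : D → (unstableSubspace n p q k : Set (EnhancedSpace n p q)) := fun x =>
      ⟨(κ x)⁻¹ • v x, krylovMatrix_inv_smul_mem x.1.1.2 x.2⟩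
    have hm : IsMorphism (((nullComponentVariety n p q k).subspace
        (cyclicLocus n p q k)).subspace D) (associatedBundle n p q k)
        fun x => bundleMk (κ x, ω x) :=
      isMorphism_bundleMk.comp (isMorphism_to_groupTimesUnstable hκ fun x =>
        (hc x).inv_smul (hκ x))
    have heq : (fun x : D => bundleMk (κ x, ω x)) =
        fun x : D => ((collapsingEquiv n p q k).symm x.1).1 := by
      funext x
      have hx : collapsingMap n p q k (bundleMk (κ x, ω x)) = x.1.1 :=
        Subtype.ext (smul_inv_smul (κ x) (v x))
      have hx' : (collapsingEquiv n p q k ((collapsingEquiv n p q k).symm x.1)).1 = x.1.1 :=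
        congrArg Subtype.val ((collapsingEquiv n p q k).apply_symm_apply x.1)
      exact injOn_collapsingMap (hx.symm ▸ x.1.2) (hx.trans hx'.symm)
    exact heq ▸ hm

theorem jordanPoint_mem_cyclicLocus :
    (bundleMk (1, ⟨jordanPoint n p q, jordanPoint_mem⟩) : (associatedBundle n p q k).carrier) ∈
      collapsingMap n p q k ⁻¹' cyclicLocus n p q k := by
  obtain ⟨w, hw⟩ := exists_det_krylovMatrix_jordanBlock (n := n)
  refine Set.mem_iUnion.2 ⟨w, ?_⟩
  change (krylovMatrix ((1 : Matrix.GeneralLinearGroup (Fin n) ℂ) • jordanPoint n p q).2.2 w).det ≠ 0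
  rw [one_smul]
  exact hw

/-- Both spaces are irreducible, so density of the open sets only needs a point, and the Jordan
block provides one. -/
theorem isBirationalMorphism_collapsingMap :
    IsBirationalMorphism (associatedBundle n p q k) (nullComponentVariety n p q k)
      (collapsingMap n p q k) := by
  have hU : IsOpen (collapsingMap n p q k ⁻¹' cyclicLocus n p q k) :=
    isOpen_cyclicLocus.preimage isMorphism_collapsingMap.continuous
  exact ⟨isMorphism_collapsingMap, _, _, hU, hU.dense ⟨_, jordanPoint_mem_cyclicLocus⟩,
    isOpen_cyclicLocus, isOpen_cyclicLocus.dense ⟨_, jordanPoint_mem_cyclicLocus⟩,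
    collapsingIso n p q k, fun _ => rfl⟩

end Birational

/-! ### The dimension of `C_k` -/

section Dimension

open FunctionSpace EnhancedSpace

variable {n p q k : ℕ}

/-- The positions of the free coordinates in the model of the charts. -/
abbrev ChartIndex (n p q k : ℕ) : Type :=
  {x : Fin n × Fin n // x.1 ≠ x.2} ⊕ ({i : Fin n // i.val < k} × Fin p) ⊕
    (Fin q × {j : Fin n // ¬ j.val < k})

theorem card_chartIndex (hk : k ≤ n) :
    Fintype.card (ChartIndex n p q k) = n ^ 2 - n + p * k + q * (n - k) := by
  have h1 : Fintype.card {i : Fin n // i.val < k} = k := by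
    rw [Fintype.card_congr (Fin.castLEquiv hk).symm, Fintype.card_fin]
  have h2 : Fintype.card {i : Fin n // ¬ i.val < k} = n - k := by
    rw [Fintype.card_subtype_compl, h1, Fintype.card_fin]
  have h3 : Fintype.card {x : Fin n × Fin n // x.1 ≠ x.2} = n ^ 2 - n := by
    have h : Finset.univ.filter (fun x : Fin n × Fin n => x.1 ≠ x.2) =
        (Finset.univ : Finset (Fin n)).offDiag := by
      ext x
      simp
    rw [Fintype.card_subtype, h, Finset.offDiag_card, Finset.card_univ, Fintype.card_fin, sq]
  simp only [Fintype.card_sum, Fintype.card_prod, h1, h2, h3, Fintype.card_fin]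
  ring

/-- The coordinates on the model of the charts. -/
def chartCoordinates (n p q k : ℕ) : ChartModel n p q k →ₗ[ℂ] (ChartIndex n p q k → ℂ) where
  -- The strictly lower `l` and the strictly upper `v` occupy complementary positions, so their sum
  -- records both in the `n ^ 2 - n` off-diagonal entries.
  toFun w := Sum.elim (fun x => w.1.1 x.1.1 x.1.2 + w.2.1.2.2 x.1.1 x.1.2)
    (Sum.elim (fun x => w.2.1.1 x.1 x.2) fun x => w.2.1.2.1 x.1 x.2)
  map_add' w w' := by
    funext x
    rcases x with x | x | x
    · exact add_add_add_comm _ _ _ _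
    · rfl
    · rfl
  map_smul' c w := by
    funext x
    rcases x with x | x | x
    · exact (mul_add _ _ _).symm
    · rfl
    · rfl

theorem chartCoordinates_bijective : Function.Bijective (chartCoordinates n p q k) := by
  constructor
  · refine (injective_iff_map_eq_zero _).2 ?_
    rintro ⟨⟨l, hl⟩, ⟨⟨ξ, η, v⟩, hξ, hη, hv⟩⟩ h
    have h1 : ∀ i j, i ≠ j → l i j + v i j = 0 := fun i j hij => congrFun h (Sum.inl ⟨(i, j), hij⟩)
    have hl' : l = 0 := by
      ext i j
      rcases le_or_gt i j with hij | hij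
      · exact hl i j hij
      · have := h1 i j hij.ne'
        rwa [show v i j = 0 from hv i j hij.le, add_zero] at this
    have hv' : v = 0 := by
      ext i j
      rcases le_or_gt j i with hij | hij
      · exact hv i j hij
      · have := h1 i j hij.ne
        rwa [show l i j = 0 from hl i j hij.le, zero_add] at this
    have hξ' : ξ = 0 := by
      ext i j
      by_cases hi : i.val < k
      · exact congrFun h (Sum.inr (Sum.inl (⟨i, hi⟩, j)))
      · exact hξ i j (not_lt.1 hi)
    have hη' : η = 0 := by
      ext i j
      by_cases hj : j.val < k
      · exact hη i j hj
      · exact congrFun h (Sum.inr (Sum.inr (i, ⟨j, hj⟩)))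
    subst hl' hv' hξ' hη'
    rfl
  · intro f
    refine ⟨(⟨Matrix.of fun i j => if h : j < i then f (Sum.inl ⟨(i, j), h.ne'⟩) else 0, ?_⟩,
      ⟨(Matrix.of fun i j => if h : i.val < k then f (Sum.inr (Sum.inl (⟨i, h⟩, j))) else 0,
        Matrix.of fun i j => if h : j.val < k then 0 else f (Sum.inr (Sum.inr (i, ⟨j, h⟩))),
        Matrix.of fun i j => if h : i < j then f (Sum.inl ⟨(i, j), h.ne⟩) else 0), ?_, ?_, ?_⟩), ?_⟩
    · exact fun i j hij => dif_neg hij.not_gt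
    · exact fun i j hij => dif_neg hij.not_gt
    · exact fun i j hij => dif_pos hij
    · exact fun i j hij => dif_neg hij.not_gt
    · funext x
      rcases x with ⟨⟨i, j⟩, hij⟩ | ⟨⟨i, hi⟩, j⟩ | ⟨i, ⟨j, hj⟩⟩
      · rcases lt_or_gt_of_ne hij with h | h
        · simp [chartCoordinates, h, h.not_gt]
        · simp [chartCoordinates, h, h.not_gt]
      · exact dif_pos hi
      · exact dif_neg hj

theorem finrank_chartModel (hk : k ≤ n) :
    Module.finrank ℂ (ChartModel n p q k) = n ^ 2 - n + p * k + q * (n - k) := by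
  rw [(LinearEquiv.ofBijective _ chartCoordinates_bijective).finrank_eq,
    Module.finrank_fintype_fun_eq_card, card_chartIndex hk]

/-- On the chart at `1` the map `ψ_k` is polynomial. Its image is dense because the chart is dense
in the irreducible bundle and `ψ_k` is surjective. -/
theorem topologicalKrullDim_nullComponent_le :
    topologicalKrullDim (nullComponentVariety n p q k).carrier ≤
      (Module.finrank ℂ (ChartModel n p q k) : ℕ) := by
  refine affineSpace.topologicalKrullDim_le (V := EnhancedSpace n p q) (isClosed_nullComponent (k := k))
    (χ := fun w : ChartModel n p q k => lowerUnipotent w.1 • (w.2.1 : EnhancedSpace n p q))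
    (polyFunctions_unstable.smul polyFunctions_lowerUnipotent
      polyFunctions_lowerUnipotent_inv).dual_mem ?_
  intro f hf h0 x hx
  by_contra hfx
  have hO : IsOpen[(associatedBundle n p q k).top]
      ((fun z => (collapsingMap n p q k z).1) ⁻¹' {v : EnhancedSpace n p q | f v ≠ 0}) :=
    (affineSpace.isOpen_basic hf).preimage ((isMorphism_val (X := enhancedVariety n p q) _).comp
      (isMorphism_collapsingMap (n := n) (p := p) (q := q) (k := k))).continuous
  obtain ⟨z, hz⟩ := collapsingMap_surjective ⟨x, hx⟩
  have hne := nonempty_preirreducible_inter hO (isOpen_chartDomain 1)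
    ⟨z, by rw [Set.mem_preimage, hz]; exact hfx⟩
    ⟨_, mem_chartDomain_self (1, ⟨0, Submodule.zero_mem _⟩)⟩
  obtain ⟨_, hy, w, rfl⟩ := hne
  refine hy ((congrArg f ?_).trans (congrFun h0 w))
  change ((1 : Matrix.GeneralLinearGroup (Fin n) ℂ) * lowerUnipotent w.1) • _ = _
  rw [one_mul]
  rfl

/-- The part of the chart at `1` over the cyclic locus is a nonempty open subset of affine space, so
it has full dimension. `ψ_k` embeds it topologically in `C_k`, and the dimension does not drop along
inducing maps. -/
theorem le_topologicalKrullDim_nullComponent : (Module.finrank ℂ (ChartModel n p q k) : ℕ) ≤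
    topologicalKrullDim (nullComponentVariety n p q k).carrier := by
  let e := affineSpace.isoOfLinearEquiv (Module.finBasis ℂ (ChartModel n p q k)).equivFun
  let c : (affineSpace (Fin (Module.finrank ℂ (ChartModel n p q k)) → ℂ)).carrier →
      (associatedBundle n p q k).carrier := fun x => chart 1 (e.symm.toFun x)
  have hc : IsInducing c := IsInducing.subtypeVal.comp ((chartIso 1).toHomeomorph.isInducing.comp
    e.symm.toHomeomorph.isInducing)
  let O := c ⁻¹' (collapsingMap n p q k ⁻¹' cyclicLocus n p q k)
  have hO : IsOpen O :=
    (isOpen_cyclicLocus.preimage isMorphism_collapsingMap.continuous).preimage hc.continuous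
  have hne : O.Nonempty := by
    obtain ⟨w, hw⟩ := mem_chartDomain_self (1, ⟨jordanPoint n p q, jordanPoint_mem (k := k)⟩)
    refine ⟨e.toFun w, ?_⟩
    have : c (e.toFun w) = bundleMk (1, ⟨jordanPoint n p q, jordanPoint_mem (k := k)⟩) :=
      (congrArg (chart 1) (e.left_inv w)).trans hw
    rw [Set.mem_preimage, this]
    exact jordanPoint_mem_cyclicLocus
  refine (affineSpace.le_topologicalKrullDim_pi hO hne).trans ?_
  let g : O → collapsingMap n p q k ⁻¹' cyclicLocus n p q k := fun x => ⟨c x.1, x.2⟩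
  have hg : IsInducing g := IsInducing.subtypeVal.of_comp_iff.1 (hc.comp IsInducing.subtypeVal)
  exact (IsInducing.subtypeVal.comp
    ((collapsingIso n p q k).toHomeomorph.isInducing.comp hg)).topologicalKrullDim_le

end Dimension

open scoped Pointwise in
theorem mainTheorem5 (n p q k : ℕ) (hk : k ≤ n) :
    MulAction.stabilizer (Matrix.GeneralLinearGroup (Fin n) ℂ)
        (unstableSubspace n p q k : Set (EnhancedSpace n p q)) = upperBorel n ∧
    nullComponent n p q k ⊆ nullCone n p q ∧
    FunctionSpace.IsResolution (associatedBundle n p q k) (nullComponentVariety n p q k)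
      (collapsingMap n p q k) ∧
    IsClosed (nullComponent n p q k) ∧
    IsIrreducible (nullComponent n p q k) ∧
    topologicalKrullDim (nullComponentVariety n p q k).carrier =
      ((n ^ 2 - n + p * k + q * (n - k) : ℕ) : WithBot ℕ∞) := by
  refine ⟨stabilizer_unstableSubspace, nullComponent_subset_nullCone,
    { variety := associatedBundle.isVariety
      irreducible := associatedBundle.irreducibleSpace
      nonsingular := associatedBundle.isNonsingular
      target_variety := affineSpace.isVariety_subspace (V := EnhancedSpace n p q)
        isClosed_nullComponent
      target_irreducible := nullComponentVariety.irreducibleSpace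
      proper := isProperMorphism_collapsingMap
      birational := isBirationalMorphism_collapsingMap },
    isClosed_nullComponent, ?_, ?_⟩
  · have h := (IrreducibleSpace.isIrreducible_univ (nullComponentVariety n p q k).carrier).image
      (Y := (enhancedVariety n p q).carrier) Subtype.val continuous_subtype_val.continuousOn
    exact (congrArg (IsIrreducible (X := (enhancedVariety n p q).carrier))
      (Set.image_univ.trans Subtype.range_coe)).mp h
  · rw [← finrank_chartModel hk]
    exact le_antisymm topologicalKrullDim_nullComponent_le le_topologicalKrullDim_nullComponent
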